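/- **Setting.** Let $n\ge 2$ and $k\in\{1,\dots,n-1\}$, and write points of $\mathbb R^{n+1}=\mathbb R^n\times\mathbb R$ as $\mathbf X=(X,t)$. We consider two group laws $$(X,t)\cdot(Y,s)=(X+Y,\;t+s+\eta(X,Y)):$$ the parabolic case, $\eta\equiv 0$; and the (first) Heisenberg case, $n=2$, $k=1$, $\eta(X,Y)=\tfrac12(X_1Y_2-X_2Y_1)$. In both cases $\mathbf X^{-1}=(-X,-t)$. Put $\|\mathbf X\|=(|X|^2+|t|)^{1/2}$, $d(\mathbf X,\mathbf Y)=\|\mathbf X\cdot\mathbf Y^{-1}\|$, $B_r(\mathbf X)=B(\mathbf X,r)=\{\mathbf Y: d(\mathbf X,\mathbf Y)<r\}$. Balls, diameters, distances to sets and Lipschitz constants are taken with respect to $d$. Measures are locally finite Borel measures. Fix $C_0>0$. A measure $\mu$ is *$(k+2)$-regular* if $C_0^{-1}r^{k+2}\le\mu(B_r(\mathbf X))\le C_0r^{k+2}$ for all $\mathbf X\in\operatorname{supp}\mu$ and $0<r<\operatorname{diam}(\operatorname{supp}\mu)$. *Littlewood–Paley condition.* For $\ell>0$ let $\varphi_\ell(X,t)=\varphi(X/\ell,t/\ell^2)$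 and $\varphi*\mu(\mathbf Y)=\int\varphi(\mathbf Y\cdot\mathbf X^{-1})\,d\mu(\mathbf X)$. The measure $\mu$ is *good for spatially antisymmetric Littlewood–Paley kernels* if for every compactly supported Lipschitz $\varphi\in C^\infty(\mathbb R^{n+1})$ with $\varphi(X,t)=-\varphi(-X,t)$ there is a constant $C(\varphi)$ such that for all $\mathbf X\in\operatorname{supp}\mu$ and $0<R<\operatorname{diam}(\operatorname{supp}\mu)$ $$\sum_{j\in\mathbb Z,\;2^{-j}\le R}\int_{B_R(\mathbf X)}\bigl(2^{j(k+2)}\,\varphi_{2^{-j}}*\mu(\mathbf Y)\bigr)^2d\mu(\mathbf Y)\le C(\varphi)R^{k+2}.$$ *Dyadic cubes.* A system of dyadic cubes $\mathbb D(\mu)=\bigcup_j\mathbb D_j$ consists, for each $j\in\mathbb Z$ with $2^j\le\operatorname{diam}(\operatorname{supp}\mu)$, of a partition $\mathbb D_j$ of $\operatorname{supp}\mu$ into Borel sets ($\ell(E)=2^j$ for $E\in\mathbb D_j$; cubes of different generations are regarded as different) such that, with a uniform constant $A>0$: if $E\in\mathbb D_i$, $E'\in\mathbb D_j$, $i\le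 j$, then $E\subseteq E'$ or $E\cap E'=\varnothing$; $A^{-1}\ell(E)\le\operatorname{diam}E\le\tfrac14\ell(E)$; $A^{-1}\ell(E)^{k+2}\le\mu(E)\le A\,\ell(E)^{k+2}$; and $E$ contains a point $\mathbf Z_E$ (its center) with $d(\mathbf Z_E,\mathbf Y)\ge A^{-1}\ell(E)$ for all $\mathbf Y\in\operatorname{supp}\mu\setminus E$. A family $\mathcal Q\subseteq\mathbb D(\mu)$ is *Carleson* if for some $C$, $\sum_{E\in\mathcal Q,\,E\subseteq E_0}\mu(E)\le C\mu(E_0)$ for every $E_0\in\mathbb D(\mu)$. *$\alpha$-numbers.* Let $\widetilde{\mathcal M}_k$ be the set of $(k+2)$-regular measures (with constant $C_0$) of the form $\mathcal H^k|_L\times\nu$, where $L\subset\mathbb R^n$ is a $k$-dimensional linear subspace and $\nu$ is a measure on $\mathbb R$, and let $\mathcal M_k$ be the set of right translates $\omega(E)=\sigma(E\cdot\mathbf Z)$ with $\sigma\in\widetilde{\mathcal M}_k$, $\mathbf Z\in\mathbb R^{n+1}$. Put $$\alpha_{k,\mu}(B(\mathbf X,r))=\frac1{r^{k+3}}\inf_{\omega\in\mathcal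 M_k}\;\sup\Bigl\{\Bigl|\int f\,d\mu-\int f\,d\omega\Bigr|:\ \operatorname{supp}f\subset B_{3r}(\mathbf X),\ \|f\|_{\mathrm{Lip}}\le1\Bigr\}$$ (with $\inf\varnothing=\infty$), and $\alpha_{k,\mu}(E)=\alpha_{k,\mu}(B(\mathbf Z_E,\ell(E)))$ for $E\in\mathbb D(\mu)$. *Uniform rectifiability.* A $(k+2)$-dimensional vertical plane is an affine plane in $\mathbb R^{n+1}$ that contains a line in the $t$-direction and whose projection to $\mathbb R^n$ is a $k$-dimensional affine plane. Put $$\beta_{\mu,k}(\mathbf X,r)^2=\inf_L\frac1{\mu(B(\mathbf X,r))}\int_{B(\mathbf X,r)}\Bigl(\frac{\operatorname{dist}(\mathbf Y,L)}r\Bigr)^2d\mu(\mathbf Y),$$ the infimum being over all such planes $L$. A $(k+2)$-regular measure $\mu$ is *uniformly rectifiable* if there is $C>0$ such that $$\int_0^R\int_{B_R(\mathbf X)}\beta_{\mu,k}(\mathbf Y,r)^2\,d\mu(\mathbf Y)\,\frac{dr}r\le CR^{k+2}\qquad\text{for all }\mathbf X\in\operatorname{supp}\mu,\ R>0.$$ **Theorem.**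 In the parabolic or the Heisenberg case, let $\mu$ be a $(k+2)$-regular measure on $\mathbb R^{n+1}$ that is good for spatially antisymmetric Littlewood–Paley kernels, and let $\mathbb D(\mu)$ be a system of dyadic cubes for $\mu$. If for every $\lambda>0$ the family $\{E\in\mathbb D(\mu):\alpha_{k,\mu}(E)>\lambda\}$ is Carleson, then $\mu$ is uniformly rectifiable. -/

import Mathlib

open MeasureTheory Set
open scoped ENNReal NNReal

noncomputable section

namespace HorizGeom

/-- Points `𝐗 = (X, t)` of `ℝⁿ⁺¹ = ℝⁿ × ℝ`, the spatial part carrying the Euclidean norm. -/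
abbrev Pt (n : ℕ) : Type := EuclideanSpace ℝ (Fin n) × ℝ

/-- The two geometric settings: parabolic space `ℝⁿ⁺¹` for any `n`, and the first Heisenberg
group, which lives on `ℝ²⁺¹`. -/
inductive Geometry : ℕ → Type
  | parabolic (n : ℕ) : Geometry n
  | heisenberg : Geometry 2

namespace Geometry

/-- The twist `η` of the group law: `0` in the parabolic case,
`η(X, Y) = (X₁ Y₂ - X₂ Y₁) / 2` in the Heisenberg case. -/
def η : {n : ℕ} → Geometry n → EuclideanSpace ℝ (Fin n) → EuclideanSpace ℝ (Fin n) → ℝ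
  | _, parabolic _, _, _ => 0
  | _, heisenberg, X, Y => (1 / 2) * (X 0 * Y 1 - X 1 * Y 0)

variable {n : ℕ} (G : Geometry n)

/-- The group law `(X, t) · (Y, s) = (X + Y, t + s + η(X, Y))`. -/
def op (p q : Pt n) : Pt n := (p.1 + q.1, p.2 + q.2 + G.η p.1 q.1)

/-- The group inverse `(X, t)⁻¹ = (-X, -t)`. -/
def inv (_G : Geometry n) (p : Pt n) : Pt n := (-p.1, -p.2)

theorem op_inv (p : Pt n) : G.op p (G.inv p) = 0 := by
  cases G <;> ext <;> simp [op, inv, η, mul_comm]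

/-- The homogeneous norm `‖(X, t)‖ = (|X|² + |t|)^{1/2}`. -/
def gauge (_G : Geometry n) (p : Pt n) : ℝ := Real.sqrt (‖p.1‖ ^ 2 + |p.2|)

/-- The right-invariant distance `d(𝐗, 𝐘) = ‖𝐗 · 𝐘⁻¹‖`. -/
def d (p q : Pt n) : ℝ := G.gauge (G.op p (G.inv q))

/-- The open ball `B_r(𝐗)`. -/
def ball (x : Pt n) (r : ℝ) : Set (Pt n) := {y | G.d x y < r}

/-- The diameter of a set with respect to `d`, as an extended nonnegative number. -/
def ediam (S : Set (Pt n)) : ℝ≥0∞ := ⨆ x ∈ S, ⨆ y ∈ S, ENNReal.ofReal (G.d x y)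

/-- The dilation `(X, t) ↦ (c X, c² t)`. -/
def dil (_G : Geometry n) (c : ℝ) (p : Pt n) : Pt n := (c • p.1, c ^ 2 * p.2)

end Geometry

variable {n : ℕ} (G : Geometry n)

/-- `μ` is `(k+2)`-Ahlfors--David regular with constant `C₀`:
`C₀⁻¹ r^{k+2} ≤ μ(B_r(𝐗)) ≤ C₀ r^{k+2}` for `𝐗 ∈ supp μ` and `0 < r < diam (supp μ)`. -/
def IsADR (k : ℕ) (C₀ : ℝ) (μ : Measure (Pt n)) : Prop :=
  ∀ x ∈ μ.support, ∀ r : ℝ, 0 < r → ENNReal.ofReal r < G.ediam μ.support →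
    ENNReal.ofReal (C₀⁻¹ * r ^ (k + 2)) ≤ μ (G.ball x r) ∧
      μ (G.ball x r) ≤ ENNReal.ofReal (C₀ * r ^ (k + 2))

/-- `f` is Lipschitz with constant `C` with respect to the distance `d`. -/
def LipBound (C : ℝ) (f : Pt n → ℝ) : Prop := ∀ x y, |f x - f y| ≤ C * G.d x y

/-! ### Uniform rectifiability through vertical `β`-numbers -/

/-- `(k+2)`-dimensional vertical planes: affine planes whose spatial projection is a
`k`-dimensional affine plane and which contain a line in the `t`-direction. -/
def IsVerticalPlane (k : ℕ) (L : AffineSubspace ℝ (Pt n)) : Prop :=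
  Module.finrank ℝ (L.direction.map (LinearMap.fst ℝ (EuclideanSpace ℝ (Fin n)) ℝ)) = k ∧
    ∃ X : EuclideanSpace ℝ (Fin n), ∀ t : ℝ, ((X, t) : Pt n) ∈ L

/-- The distance from a point to a set, with respect to `d`. -/
def distTo (x : Pt n) (L : Set (Pt n)) : ℝ≥0∞ := ⨅ z ∈ L, ENNReal.ofReal (G.d x z)

/-- The square `β_{μ,k}(𝐗, r)²` of the vertical `β`-number. -/
def betaSq (k : ℕ) (μ : Measure (Pt n)) (x : Pt n) (r : ℝ) : ℝ≥0∞ :=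
  ⨅ (L : AffineSubspace ℝ (Pt n)) (_ : IsVerticalPlane k L),
    (∫⁻ y in G.ball x r, (distTo G y L / ENNReal.ofReal r) ^ 2 ∂μ) / μ (G.ball x r)

/-- The square function estimate
`∫₀ᴿ ∫_{B_R(𝐗)} β_{μ,k}(𝐘, r)² dμ(𝐘) dr/r ≤ C R^{k+2}` for all `𝐗 ∈ supp μ` and `R > 0`. -/
def IsUniformlyRectifiable (k : ℕ) (μ : Measure (Pt n)) : Prop :=
  ∃ C : ℝ, 0 < C ∧ ∀ x ∈ μ.support, ∀ R : ℝ, 0 < R →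
    ∫⁻ r in Ioo (0 : ℝ) R, (∫⁻ y in G.ball x R, betaSq G k μ y r ∂μ) / ENNReal.ofReal r
      ≤ ENNReal.ofReal (C * R ^ (k + 2))

/-! ### The geometric Littlewood--Paley condition -/

/-- Smooth, compactly supported, Lipschitz functions that are odd in the spatial variable. -/
def IsOddTest (φ : Pt n → ℝ) : Prop :=
  ContDiff ℝ ((⊤ : ℕ∞) : WithTop ℕ∞) φ ∧ HasCompactSupport φ ∧ (∃ C : ℝ, LipBound G C φ) ∧
    ∀ (X : EuclideanSpace ℝ (Fin n)) (t : ℝ), φ (X, t) = -φ (-X, t)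

/-- `ℓ^{-(k+2)} (φ_ℓ ∗ μ)(𝐘)`, where `φ_ℓ = φ ∘ δ_{1/ℓ}` and
`(φ ∗ μ)(𝐘) = ∫ φ(𝐘 · 𝐗⁻¹) dμ(𝐗)`. -/
def lpConv (k : ℕ) (φ : Pt n → ℝ) (μ : Measure (Pt n)) (ℓ : ℝ) (y : Pt n) : ℝ :=
  (ℓ ^ (k + 2))⁻¹ * ∫ x, φ (G.dil ℓ⁻¹ (G.op y (G.inv x))) ∂μ

/-- `μ` is good for spatially antisymmetric Littlewood--Paley kernels (of dimension `k+2`). -/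
def GoodForLP (k : ℕ) (μ : Measure (Pt n)) : Prop :=
  ∀ φ : Pt n → ℝ, IsOddTest G φ → ∃ C : ℝ, 0 < C ∧
    ∀ x ∈ μ.support, ∀ R : ℝ, 0 < R → ENNReal.ofReal R < G.ediam μ.support →
      ∑' j : {j : ℤ // (2 : ℝ) ^ (-j) ≤ R},
          ∫⁻ y in G.ball x R, ENNReal.ofReal (lpConv G k φ μ ((2 : ℝ) ^ (-(j : ℤ))) y ^ 2) ∂μ
        ≤ ENNReal.ofReal (C * R ^ (k + 2))

/-! ### `α`-numbers -/

/-- `M̃_m`: the `(k+2)`-regular measures (constant `C₀`) of the form `ℋᵐ|_L × ν`, for a linear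
`m`-dimensional subspace `L` of `ℝⁿ` and a locally finite Borel measure `ν` on `ℝ`. -/
def productModels (C₀ : ℝ) (k m : ℕ) : Set (Measure (Pt n)) :=
  {σ | IsLocallyFiniteMeasure σ ∧ IsADR G k C₀ σ ∧
    ∃ (L : Submodule ℝ (EuclideanSpace ℝ (Fin n))) (ν : Measure ℝ),
      Module.finrank ℝ L = m ∧ IsLocallyFiniteMeasure ν ∧
        σ = ((Measure.hausdorffMeasure (m : ℝ)).restrict (L : Set _)).prod ν}

/-- `M_m`: all right translates of the measures in `M̃_m`. The measure
`ω(E) = σ(E · 𝐙)` is the image of `σ` under `𝐘 ↦ 𝐘 · 𝐙⁻¹`. -/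
def models (C₀ : ℝ) (k m : ℕ) : Set (Measure (Pt n)) :=
  {ω | ∃ σ ∈ productModels G C₀ k m, ∃ z : Pt n, ω = σ.map (fun y => G.op y (G.inv z))}

/-- `dist_B(μ, ω)` for `B = B(𝐗, r)`: the supremum of `|∫ f d(μ - ω)|` over functions `f`
supported in `B_{3r}(𝐗)` with Lipschitz norm at most one. -/
def measDist (μ ω : Measure (Pt n)) (x : Pt n) (r : ℝ) : ℝ≥0∞ :=
  ⨆ (f : Pt n → ℝ) (_ : tsupport f ⊆ G.ball x (3 * r)) (_ : LipBound G 1 f),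
    ENNReal.ofReal |(∫ y, f y ∂μ) - ∫ y, f y ∂ω|

/-- The number `α_{m,μ}(B(𝐗, r))`; it is `∞` if there is no model measure. -/
def alpha (C₀ : ℝ) (k m : ℕ) (μ : Measure (Pt n)) (x : Pt n) (r : ℝ) : ℝ≥0∞ :=
  (⨅ ω ∈ models G C₀ k m, measDist G μ ω x r) / ENNReal.ofReal (r ^ (k + 3))

/-! ### Dyadic cubes and Carleson families -/

/-- A system of dyadic cubes for `μ`. `cubes j` is the `j`-th generation, whose cubes have side
length `2ʲ`; generations exist for `2ʲ ≤ diam (supp μ)` (so for all `j` if the support is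
unbounded). A dyadic cube is recorded together with its generation. -/
structure DyadicGrid (k : ℕ) (μ : Measure (Pt n)) where
  /-- the cubes of each generation -/
  cubes : ℤ → Set (Set (Pt n))
  /-- the centers of the cubes -/
  center : ℤ → Set (Pt n) → Pt n
  /-- the implicit constant in the comparisons -/
  A : ℝ
  A_pos : 0 < A
  generation_le : ∀ j, (cubes j).Nonempty → ENNReal.ofReal ((2 : ℝ) ^ j) ≤ G.ediam μ.support
  measurableSet : ∀ j, ∀ E ∈ cubes j, MeasurableSet E
  sUnion_eq : ∀ j, ENNReal.ofReal ((2 : ℝ) ^ j) ≤ G.ediam μ.support → ⋃₀ cubes j = μ.support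
  disjoint : ∀ j, ∀ E ∈ cubes j, ∀ E' ∈ cubes j, E ≠ E' → Disjoint E E'
  nested : ∀ i j, i ≤ j → ∀ E ∈ cubes i, ∀ E' ∈ cubes j, E ⊆ E' ∨ Disjoint E E'
  le_diam : ∀ j, ∀ E ∈ cubes j, ENNReal.ofReal (A⁻¹ * (2 : ℝ) ^ j) ≤ G.ediam E
  diam_le : ∀ j, ∀ E ∈ cubes j, G.ediam E ≤ ENNReal.ofReal ((2 : ℝ) ^ j / 4)
  le_measure : ∀ j, ∀ E ∈ cubes j, ENNReal.ofReal (A⁻¹ * ((2 : ℝ) ^ j) ^ (k + 2)) ≤ μ E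
  measure_le : ∀ j, ∀ E ∈ cubes j, μ E ≤ ENNReal.ofReal (A * ((2 : ℝ) ^ j) ^ (k + 2))
  center_mem : ∀ j, ∀ E ∈ cubes j, center j E ∈ E
  le_dist_center : ∀ j, ∀ E ∈ cubes j, ∀ y ∈ μ.support \ E,
    A⁻¹ * (2 : ℝ) ^ j ≤ G.d (center j E) y

namespace DyadicGrid

variable {G} {k : ℕ} {μ : Measure (Pt n)} (D : DyadicGrid G k μ)

/-- The collection `𝔻(μ)` of all dyadic cubes `E`, as pairs `(J(E), E)`. -/
def all : Set (ℤ × Set (Pt n)) := {p | p.2 ∈ D.cubes p.1}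

/-- A family `𝒬` of dyadic cubes is Carleson if, for some constant `C`,
`∑_{E ∈ 𝒬, E ⊆ E₀} μ(E) ≤ C μ(E₀)` for every dyadic cube `E₀`. -/
def IsCarleson (Q : Set (ℤ × Set (Pt n))) : Prop :=
  Q ⊆ D.all ∧ ∃ C : ℝ≥0, ∀ p₀ ∈ D.all,
    ∑' p : {p : ℤ × Set (Pt n) // p ∈ Q ∧ p.2 ⊆ p₀.2}, μ p.1.2 ≤ C * μ p₀.2

/-- The dyadic cubes `E` with `α_{m,μ}(E) = α_{m,μ}(B(𝐙_E, ℓ(E))) > lam`. -/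
def badCubes (C₀ : ℝ) (m : ℕ) (lam : ℝ) : Set (ℤ × Set (Pt n)) :=
  {p ∈ D.all | ENNReal.ofReal lam < alpha G C₀ k m μ (D.center p.1 p.2) ((2 : ℝ) ^ p.1)}

end DyadicGrid

end HorizGeom

end

/-! The vertical distance from a point `(Y, s)` to the plane over `X₁ + W` is controlled by the
spatial vector `perp W (Y - X₁)` alone, so flatness is measured by the mean square of that vector.
The core is a one-step improvement (`exists_plane_unit`, rescaled in `exists_flatness_decay`). With
an even cutoff `ψ`, put `F(y) = ∫ ψ(y·x⁻¹)(Y - X) dν(x)`; its components are Littlewood–Paley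
averages for the odd kernels `X_i ψ`. Projecting gives `perp W F(y) = g(y) perp W (Y - X₁) - h(y)`,
with `g = ∫ ψ` bounded below and `h = ∫ ψ perp W (X - X₁)` of the size `β` of the deviation of `ν`
from the plane.

Both `g` and `h` are smooth. In the `δ`-ball the `t`-variable has size `δ²`, so each is affine in
`Y` alone up to second order, and `h/g` is an affine function of `Y` of size `O(β)` plus an error
`O(δ²β)`. If `β` is small, `perp W` minus the linear part of that function still cuts out a subspace
of the same dimension (`exists_plane_of_perturbation`). Hence points of the `δ`-ball lie within
`C(|F| + δ²β)` of a new vertical plane. After squaring and renormalising to scale `δ`, the flatness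
becomes at most `C(δ⁻² · mean of |F|² + δ² · old flatness)`, and for small `δ` the last factor is
below `1/2`.

The step needs initial flatness below a threshold. A small `α`-number provides it
(`exists_alpha_threshold`): testing against a truncated distance to the plane of a nearly optimal
model shows that `μ` is close to that plane. Scales where `α` is large receive the trivial bound and
are counted. Summing the decay over scales (`tsum_le_of_decay`) bounds the sum of the flatness
coefficients at a point by a constant, the square function and the number of bad scales.
Integration, the Littlewood–Paley hypothesis and the Carleson packing of bad cubes then give the
estimate. No summability of the `α`-numbers is used. For bounded support, radii comparable to or
beyond the diameter are handled by compactness and `β ≤ 1`. -/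

noncomputable section

namespace HorizGeom

/-! ### Group law, homogeneous norm and quasi-distance -/

namespace Geometry

variable {n : ℕ} (G : Geometry n)

theorem η_add_left (X X' Y : EuclideanSpace ℝ (Fin n)) :
    G.η (X + X') Y = G.η X Y + G.η X' Y := by
  cases G <;> simp [η]; ring

theorem η_smul_left (c : ℝ) (X Y : EuclideanSpace ℝ (Fin n)) :
    G.η (c • X) Y = c * G.η X Y := by
  cases G <;> simp [η]; ring

theorem η_swap (X Y : EuclideanSpace ℝ (Fin n)) : G.η X Y = -G.η Y X := by
  cases G <;> simp [η]; ring

theorem η_add_right (X Y Y' : EuclideanSpace ℝ (Fin n)) :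
    G.η X (Y + Y') = G.η X Y + G.η X Y' := by
  rw [G.η_swap, G.η_add_left, G.η_swap X Y, G.η_swap X Y']; ring

theorem η_smul_right (c : ℝ) (X Y : EuclideanSpace ℝ (Fin n)) :
    G.η X (c • Y) = c * G.η X Y := by
  rw [G.η_swap, G.η_smul_left, G.η_swap X Y]; ring

theorem η_neg_left (X Y : EuclideanSpace ℝ (Fin n)) : G.η (-X) Y = -G.η X Y := by
  simpa using G.η_smul_left (-1) X Y

theorem η_neg_right (X Y : EuclideanSpace ℝ (Fin n)) : G.η X (-Y) = -G.η X Y := by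
  simpa using G.η_smul_right (-1) X Y

theorem η_self (X : EuclideanSpace ℝ (Fin n)) : G.η X X = 0 := by
  have := G.η_swap X X; linarith

theorem abs_η_le (X Y : EuclideanSpace ℝ (Fin n)) : |G.η X Y| ≤ 1 / 2 * (‖X‖ * ‖Y‖) := by
  cases G with
  | parabolic => simp only [η, abs_zero]; positivity
  | heisenberg =>
    simp only [η, abs_mul]
    rw [abs_of_pos (by norm_num : (0 : ℝ) < 1 / 2)]
    gcongr
    refine abs_le_of_sq_le_sq ?_ (by positivity)
    rw [mul_pow, EuclideanSpace.norm_sq_eq, EuclideanSpace.norm_sq_eq]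
    simp only [Fin.sum_univ_two, Real.norm_eq_abs, sq_abs]
    nlinarith [sq_nonneg (X 0 * Y 0 + X 1 * Y 1)]

/-- The twist as a continuous bilinear map, with the two arguments exchanged. -/
def ηL : EuclideanSpace ℝ (Fin n) →L[ℝ] EuclideanSpace ℝ (Fin n) →L[ℝ] ℝ :=
  LinearMap.mkContinuous₂ (LinearMap.mk₂ ℝ (fun X Y => G.η Y X)
    (fun X X' Y => G.η_add_right Y X X') (fun c X Y => G.η_smul_right c Y X)
    (fun X Y Y' => G.η_add_left Y Y' X) (fun c X Y => G.η_smul_left c Y X)) (1 / 2)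
    (fun X Y => by
      have := G.abs_η_le Y X
      simp only [LinearMap.mk₂_apply, Real.norm_eq_abs]
      linarith [mul_comm ‖X‖ ‖Y‖])

theorem contDiff_η : ContDiff ℝ ((⊤ : ℕ∞) : WithTop ℕ∞)
    (fun p : EuclideanSpace ℝ (Fin n) × EuclideanSpace ℝ (Fin n) => G.η p.1 p.2) := by
  have : (fun p : EuclideanSpace ℝ (Fin n) × EuclideanSpace ℝ (Fin n) => G.η p.1 p.2)
      = fun p => G.ηL p.2 p.1 := rfl
  rw [this]
  fun_prop

theorem continuous_op : Continuous (fun p : Pt n × Pt n => G.op p.1 p.2) := by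
  have := G.contDiff_η.continuous
  have h2 : Continuous (fun p : Pt n × Pt n => G.η p.1.1 p.2.1) :=
    this.comp (by fun_prop : Continuous fun p : Pt n × Pt n => (p.1.1, p.2.1))
  unfold op
  fun_prop

theorem continuous_inv : Continuous G.inv := by
  unfold inv; fun_prop

theorem continuous_dil (c : ℝ) : Continuous (G.dil c) := by
  unfold dil; fun_prop

theorem continuous_gauge : Continuous G.gauge := by
  unfold gauge; fun_prop

theorem continuous_op_inv : Continuous (fun p : Pt n × Pt n => G.op p.1 (G.inv p.2)) :=
  G.continuous_op.comp (continuous_fst.prodMk (G.continuous_inv.comp continuous_snd))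

theorem continuous_d : Continuous (fun p : Pt n × Pt n => G.d p.1 p.2) :=
  G.continuous_gauge.comp G.continuous_op_inv

theorem continuous_d_right (x : Pt n) : Continuous (fun y => G.d x y) := by
  have h : Continuous (fun y : Pt n => (x, y)) := by fun_prop
  have h2 := Continuous.comp (g := fun p : Pt n × Pt n => G.d p.1 p.2) G.continuous_d h
  simpa only [Function.comp_def] using h2

theorem isOpen_ball (x : Pt n) (r : ℝ) : IsOpen (G.ball x r) := by
  have h : IsOpen ((fun y => G.d x y) ⁻¹' Iio r) := isOpen_Iio.preimage (G.continuous_d_right x)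
  have e : G.ball x r = (fun y => G.d x y) ⁻¹' Iio r := by
    ext y; simp only [ball, mem_ofPred_eq, mem_preimage, mem_Iio]
  rw [e]; exact h

theorem measurableSet_ball (x : Pt n) (r : ℝ) : MeasurableSet (G.ball x r) :=
  (G.isOpen_ball x r).measurableSet

theorem op_inv_eq (p q : Pt n) :
    G.op p (G.inv q) = (p.1 - q.1, p.2 - q.2 - G.η p.1 q.1) := by
  simp [op, inv, η_neg_right, sub_eq_add_neg]

/-- Right invariance of `d`; with `dil_op_inv` it lets every ball be moved to the unit ball at the
origin. -/
theorem op_inv_op_inv (p q z : Pt n) :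
    G.op (G.op p (G.inv z)) (G.inv (G.op q (G.inv z))) = G.op p (G.inv q) := by
  simp only [op_inv_eq, sub_eq_add_neg, η_add_left, η_add_right, η_neg_left, η_neg_right,
    η_self]
  ext1
  · simp
  · simp only; rw [G.η_swap z.1 q.1]; ring

theorem dil_op_inv (c : ℝ) (p q : Pt n) :
    G.op (G.dil c p) (G.inv (G.dil c q)) = G.dil c (G.op p (G.inv q)) := by
  simp only [op_inv_eq, dil, η_smul_left, η_smul_right]
  ext1
  · simp [smul_sub]
  · simp only; ring

theorem gauge_nonneg (p : Pt n) : 0 ≤ G.gauge p := Real.sqrt_nonneg _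

theorem d_nonneg (p q : Pt n) : 0 ≤ G.d p q := Real.sqrt_nonneg _

theorem gauge_sq (p : Pt n) : G.gauge p ^ 2 = ‖p.1‖ ^ 2 + |p.2| :=
  Real.sq_sqrt (by positivity)

theorem norm_fst_le_gauge (p : Pt n) : ‖p.1‖ ≤ G.gauge p :=
  Real.le_sqrt_of_sq_le (by linarith [abs_nonneg p.2])

theorem abs_snd_le_gauge_sq (p : Pt n) : |p.2| ≤ G.gauge p ^ 2 := by
  rw [gauge_sq]; linarith [sq_nonneg ‖p.1‖]

theorem gauge_dil {c : ℝ} (hc : 0 ≤ c) (p : Pt n) : G.gauge (G.dil c p) = c * G.gauge p := by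
  have h : ‖(G.dil c p).1‖ ^ 2 + |(G.dil c p).2| = c ^ 2 * (‖p.1‖ ^ 2 + |p.2|) := by
    simp only [dil, norm_smul, abs_mul, Real.norm_eq_abs, abs_of_nonneg hc, abs_pow]; ring
  rw [gauge, h, Real.sqrt_mul (by positivity), Real.sqrt_sq hc, gauge]

theorem gauge_inv (p : Pt n) : G.gauge (G.inv p) = G.gauge p := by
  simp [gauge, inv]

/-- One constant serves both geometries: the twist adds at most `‖p.1‖ * ‖q.1‖ / 2`, so the cross
term in the square is at most `5/2` times the product of the gauges, and `5/2 ≤ 2 * (9/8)²`. All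
later ball inclusions leave room for the factor `9/8`. -/
theorem gauge_op_le (p q : Pt n) : G.gauge (G.op p q) ≤ 9 / 8 * (G.gauge p + G.gauge q) := by
  have hp := G.gauge_nonneg p
  have hq := G.gauge_nonneg q
  refine Real.sqrt_le_iff.mpr ⟨by positivity, ?_⟩
  have h1 : ‖(G.op p q).1‖ ≤ ‖p.1‖ + ‖q.1‖ := norm_add_le _ _
  have h2 : |(G.op p q).2| ≤ |p.2| + |q.2| + 1 / 2 * (‖p.1‖ * ‖q.1‖) :=
    (abs_add_le _ _).trans (add_le_add (abs_add_le _ _) (G.abs_η_le _ _))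
  have h3 := G.gauge_sq p
  have h4 := G.gauge_sq q
  have h5 : ‖p.1‖ * ‖q.1‖ ≤ G.gauge p * G.gauge q :=
    mul_le_mul (G.norm_fst_le_gauge p) (G.norm_fst_le_gauge q) (norm_nonneg _) hp
  have h6 : ‖(G.op p q).1‖ ^ 2 ≤ (‖p.1‖ + ‖q.1‖) ^ 2 := by gcongr
  nlinarith [mul_nonneg hp hq, sq_nonneg (G.gauge p), sq_nonneg (G.gauge q)]

theorem d_comm (p q : Pt n) : G.d p q = G.d q p := by
  unfold d
  rw [← G.gauge_inv, op_inv_eq, op_inv_eq]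
  congr 1
  rw [inv, G.η_swap p.1 q.1]
  ext1
  · simp
  · simp only; ring

theorem d_self (p : Pt n) : G.d p p = 0 := by
  unfold d; rw [op_inv]; simp [gauge]

theorem d_triangle (p q z : Pt n) : G.d p z ≤ 9 / 8 * (G.d p q + G.d q z) := by
  have h : G.op p (G.inv z) = G.op (G.op p (G.inv q)) (G.op q (G.inv z)) := by
    simp only [op_inv_eq]
    simp only [op, sub_eq_add_neg, η_add_left, η_add_right, η_neg_left, η_neg_right, η_self]
    ext1
    · simp
    · simp only; ring
  unfold d
  rw [h]
  exact G.gauge_op_le _ _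

theorem norm_sub_le_d (p q : Pt n) : ‖p.1 - q.1‖ ≤ G.d p q := by
  have := G.norm_fst_le_gauge (G.op p (G.inv q))
  unfold d
  rwa [op_inv_eq] at this ⊢

theorem abs_sub_le_d_sq (p q : Pt n) : |p.2 - q.2 - G.η p.1 q.1| ≤ G.d p q ^ 2 := by
  have := G.abs_snd_le_gauge_sq (G.op p (G.inv q))
  unfold d
  rwa [op_inv_eq] at this ⊢

/-- Since `η` vanishes on the diagonal, the twist sees only `p.1 - q.1`. This compares `d` with the
Euclidean metric as long as `q.1` stays bounded. -/
theorem abs_snd_sub_le (p q : Pt n) :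
    |p.2 - q.2| ≤ G.d p q ^ 2 + 1 / 2 * (G.d p q * ‖q.1‖) := by
  have h1 := G.abs_sub_le_d_sq p q
  have h2 : G.η p.1 q.1 = G.η (p.1 - q.1) q.1 := by
    simp [sub_eq_add_neg, η_add_left, η_neg_left, η_self]
  have h3 := G.abs_η_le (p.1 - q.1) q.1
  have h4 := G.norm_sub_le_d p q
  have h5 : ‖p.1 - q.1‖ * ‖q.1‖ ≤ G.d p q * ‖q.1‖ := by gcongr
  calc |p.2 - q.2| = |(p.2 - q.2 - G.η p.1 q.1) + G.η p.1 q.1| := by ring_nf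
    _ ≤ _ := abs_add_le _ _
    _ ≤ _ := by rw [← h2] at h3; linarith

theorem mem_ball {x y : Pt n} {r : ℝ} : y ∈ G.ball x r ↔ G.d x y < r := Iff.rfl

theorem d_zero_left (p : Pt n) : G.d 0 p = G.gauge p := by
  rw [d_comm, d, op_inv_eq]
  congr 1
  have : G.η p.1 0 = 0 := by simpa using G.η_smul_right 0 p.1 0
  ext1 <;> simp [this]

theorem ball_subset_ball (x : Pt n) {r s : ℝ} (h : r ≤ s) : G.ball x r ⊆ G.ball x s :=
  fun _ hy => lt_of_lt_of_le hy h

theorem isBounded_ball (x : Pt n) (r : ℝ) : Bornology.IsBounded (G.ball x r) := by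
  refine (Metric.isBounded_iff_subset_closedBall x).mpr
    ⟨r + (r ^ 2 + 1 / 2 * (r * ‖x.1‖)), fun y hy => ?_⟩
  have hr : G.d y x ≤ r := by rw [d_comm]; exact le_of_lt hy
  have h0 := G.d_nonneg y x
  have h1 := G.norm_sub_le_d y x
  have h2 := G.abs_snd_sub_le y x
  have h3 : G.d y x ^ 2 + 1 / 2 * (G.d y x * ‖x.1‖) ≤ r ^ 2 + 1 / 2 * (r * ‖x.1‖) := by gcongr
  have h4 : 0 ≤ r := h0.trans hr
  rw [Metric.mem_closedBall, Prod.dist_eq, dist_eq_norm, Real.dist_eq]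
  refine max_le ?_ ?_
  · linarith [mul_nonneg h4 (norm_nonneg x.1), sq_nonneg r]
  · linarith

theorem measure_ball_lt_top (μ : Measure (Pt n)) [IsLocallyFiniteMeasure μ] (x : Pt n) (r : ℝ) :
    μ (G.ball x r) < ⊤ :=
  (G.isBounded_ball x r).measure_lt_top

end Geometry

/-! ### The cutoff and the odd test kernels -/

variable {n : ℕ}

/-- A smooth cutoff, even in the spatial variable, equal to one on the gauge ball of radius one
and supported in the gauge ball of radius two. -/
def bump (p : Pt n) : ℝ :=
  Real.smoothTransition (2 - ‖p.1‖ ^ 2) * Real.smoothTransition (2 - p.2 ^ 2)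

theorem contDiff_bump : ContDiff ℝ ((⊤ : ℕ∞) : WithTop ℕ∞) (bump (n := n)) := by
  unfold bump
  have h1 : ContDiff ℝ ((⊤ : ℕ∞) : WithTop ℕ∞) (fun p : Pt n => 2 - ‖p.1‖ ^ 2) :=
    contDiff_const.sub (contDiff_fst.norm_sq ℝ)
  have h2 : ContDiff ℝ ((⊤ : ℕ∞) : WithTop ℕ∞) (fun p : Pt n => 2 - p.2 ^ 2) := by fun_prop
  exact (Real.smoothTransition.contDiff.comp h1).mul (Real.smoothTransition.contDiff.comp h2)

theorem bump_nonneg (p : Pt n) : 0 ≤ bump p :=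
  mul_nonneg (Real.smoothTransition.nonneg _) (Real.smoothTransition.nonneg _)

theorem bump_le_one (p : Pt n) : bump p ≤ 1 :=
  mul_le_one₀ (Real.smoothTransition.le_one _) (Real.smoothTransition.nonneg _)
    (Real.smoothTransition.le_one _)

theorem abs_bump_le_one (p : Pt n) : |bump p| ≤ 1 := by
  rw [abs_of_nonneg (bump_nonneg p)]; exact bump_le_one p

theorem bump_neg (X : EuclideanSpace ℝ (Fin n)) (t : ℝ) : bump (-X, t) = bump (X, t) := by
  simp [bump]

theorem bump_eq_one (G : Geometry n) {p : Pt n} (h : G.gauge p ≤ 1) : bump p = 1 := by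
  have h1 := G.gauge_sq p
  have h0 := G.gauge_nonneg p
  have h2 : G.gauge p ^ 2 ≤ 1 := by nlinarith
  have h3 := abs_nonneg p.2
  have h4 : |p.2| ^ 2 = p.2 ^ 2 := sq_abs _
  have h5 : 0 ≤ ‖p.1‖ ^ 2 := by positivity
  unfold bump
  rw [Real.smoothTransition.one_of_one_le (by linarith),
    Real.smoothTransition.one_of_one_le (by nlinarith), one_mul]

theorem bounds_of_bump_ne_zero {p : Pt n} (h : bump p ≠ 0) : ‖p.1‖ ^ 2 < 2 ∧ p.2 ^ 2 < 2 := by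
  unfold bump at h
  constructor <;> by_contra hc
  · exact h (by rw [Real.smoothTransition.zero_of_nonpos (by linarith), zero_mul])
  · exact h (by rw [Real.smoothTransition.zero_of_nonpos (x := 2 - p.2 ^ 2) (by linarith),
      mul_zero])

/-- The closed region containing the support of `bump`. -/
theorem tsupport_bump_subset :
    tsupport (bump (n := n)) ⊆ {p | ‖p.1‖ ^ 2 ≤ 2 ∧ p.2 ^ 2 ≤ 2} := by
  refine closure_minimal (fun p hp => ?_) ?_
  · exact ⟨(bounds_of_bump_ne_zero hp).1.le, (bounds_of_bump_ne_zero hp).2.le⟩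
  · have h1 : IsClosed {p : Pt n | ‖p.1‖ ^ 2 ≤ 2} := isClosed_le (by fun_prop) continuous_const
    have h2 : IsClosed {p : Pt n | p.2 ^ 2 ≤ 2} := isClosed_le (by fun_prop) continuous_const
    exact h1.inter h2

theorem gauge_lt_of_bounds (G : Geometry n) {p : Pt n} (h : ‖p.1‖ ^ 2 ≤ 2 ∧ p.2 ^ 2 ≤ 2) :
    G.gauge p < 19 / 10 := by
  have h1 := G.gauge_sq p
  have h2 : |p.2| ≤ 3 / 2 := abs_le_of_sq_le_sq (by nlinarith [h.2]) (by norm_num)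
  nlinarith [G.gauge_nonneg p, h.1]

theorem hasCompactSupport_bump : HasCompactSupport (bump (n := n)) := by
  refine HasCompactSupport.of_support_subset_isCompact (K := Metric.closedBall 0 2)
    (isCompact_closedBall _ _) (fun p hp => ?_)
  obtain ⟨h1, h2⟩ := bounds_of_bump_ne_zero hp
  rw [mem_closedBall_zero_iff, Prod.norm_def]
  refine max_le ?_ ?_
  · nlinarith [norm_nonneg p.1]
  · exact abs_le_of_sq_le_sq (by linarith) (by norm_num)

/-- Smooth functions of compact support are Lipschitz with respect to the homogeneous distance. -/
theorem exists_lipBound (G : Geometry n) {φ : Pt n → ℝ}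
    (hφ : ContDiff ℝ ((⊤ : ℕ∞) : WithTop ℕ∞) φ) (hc : HasCompactSupport φ) :
    ∃ C : ℝ, 0 ≤ C ∧ LipBound G C φ := by
  obtain ⟨K, hK⟩ := ContDiff.lipschitzWith_of_hasCompactSupport hc hφ (by simp)
  obtain ⟨M, hM⟩ := hφ.continuous.bounded_above_of_compact_support hc
  obtain ⟨ρ, hρ⟩ := hc.isCompact.isBounded.exists_norm_le
  have hM0 : 0 ≤ M := (norm_nonneg _).trans (hM 0)
  have hK0 : (0 : ℝ) ≤ K := K.2
  -- One point in the support suffices: its spatial part is then bounded, which controls the twist.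
  -- For `d ≥ 1` the sup bound is enough; for `d ≤ 1` the term `d²` is at most `d`.
  have key : ∀ p q : Pt n, q ∈ tsupport φ →
      |φ p - φ q| ≤ (2 * M + K * (2 + |ρ|)) * G.d p q := by
    intro p q hq
    have hd := G.d_nonneg p q
    rcases le_total 1 (G.d p q) with h1 | h1
    · have h2 : |φ p - φ q| ≤ 2 * M := by
        have := hM p; have := hM q
        refine (abs_sub _ _).trans ?_
        simp only [Real.norm_eq_abs] at *
        linarith
      have : 0 ≤ K * (2 + |ρ|) * G.d p q := by positivity
      nlinarith
    · have h2 := hK.dist_le_mul p q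
      have hq1 : ‖q.1‖ ≤ |ρ| := ((norm_fst_le q).trans (hρ q hq)).trans (le_abs_self _)
      have h3 : dist p q ≤ (2 + |ρ|) * G.d p q := by
        rw [Prod.dist_eq, dist_eq_norm, Real.dist_eq]
        have h4 := G.norm_sub_le_d p q
        have h5 := G.abs_snd_sub_le p q
        have h6 : G.d p q * ‖q.1‖ ≤ G.d p q * |ρ| := by gcongr
        have h7 : 0 ≤ G.d p q * |ρ| := by positivity
        refine max_le ?_ ?_ <;> nlinarith
      rw [Real.dist_eq] at h2
      have h4 : (K : ℝ) * dist p q ≤ K * ((2 + |ρ|) * G.d p q) := by gcongr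
      nlinarith [mul_nonneg hM0 hd]
  refine ⟨2 * M + K * (2 + |ρ|), by positivity, fun p q => ?_⟩
  by_cases hq : q ∈ tsupport φ
  · exact key p q hq
  by_cases hp : p ∈ tsupport φ
  · rw [abs_sub_comm, G.d_comm]; exact key q p hp
  · rw [image_eq_zero_of_notMem_tsupport hp, image_eq_zero_of_notMem_tsupport hq]
    have := G.d_nonneg p q
    simp only [sub_zero, abs_zero]
    positivity

/-- The kernel `X_i ψ(X, t)` with `ψ` the even cutoff. -/
def oddKernel (i : Fin n) (p : Pt n) : ℝ := bump p * p.1 i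

theorem isOddTest_oddKernel (G : Geometry n) (i : Fin n) : IsOddTest G (oddKernel i) := by
  have h1 : ContDiff ℝ ((⊤ : ℕ∞) : WithTop ℕ∞) (oddKernel i) := by
    unfold oddKernel
    have : ContDiff ℝ ((⊤ : ℕ∞) : WithTop ℕ∞) (fun p : Pt n => p.1 i) :=
      (contDiff_euclidean.mp contDiff_fst) i
    exact contDiff_bump.mul this
  have h2 : HasCompactSupport (oddKernel i) := hasCompactSupport_bump.mul_right
  refine ⟨h1, h2, ?_, fun X t => ?_⟩
  · obtain ⟨C, -, hC⟩ := exists_lipBound G h1 h2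
    exact ⟨C, hC⟩
  · simp [oddKernel, bump_neg]

/-- First order Taylor expansion of the cutoff, with uniform constants. -/
theorem exists_bump_taylor : ∃ C : ℝ, 0 ≤ C ∧ (∀ p : Pt n, ‖fderiv ℝ bump p‖ ≤ C) ∧
    ∀ p w : Pt n, |bump (p + w) - bump p - fderiv ℝ bump p w| ≤ C * ‖w‖ ^ 2 := by
  have hd : ContDiff ℝ ((⊤ : ℕ∞) : WithTop ℕ∞) (fderiv ℝ (bump (n := n))) :=
    contDiff_bump.fderiv_right (by simp)
  have hc : HasCompactSupport (fderiv ℝ (bump (n := n))) := hasCompactSupport_bump.fderiv ℝ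
  obtain ⟨K, hK⟩ := ContDiff.lipschitzWith_of_hasCompactSupport hc hd (by simp)
  obtain ⟨M, hM⟩ := hd.continuous.bounded_above_of_compact_support hc
  have hM0 : 0 ≤ M := (norm_nonneg _).trans (hM 0)
  have hK0 : (0 : ℝ) ≤ K := K.2
  refine ⟨M + K, by positivity, fun p => (hM p).trans (by linarith), fun p w => ?_⟩
  have hdiff : Differentiable ℝ (bump (n := n)) := contDiff_bump.differentiable (by simp)
  have := (convex_segment p (p + w)).norm_image_sub_le_of_norm_fderiv_le' (𝕜 := ℝ) (f := bump)
    (φ := fderiv ℝ bump p) (C := K * ‖w‖) (fun x _ => hdiff x) (fun x hx => ?_)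
    (left_mem_segment ℝ _ _) (right_mem_segment ℝ _ _)
  · rw [add_sub_cancel_left, Real.norm_eq_abs] at this
    refine this.trans ?_
    nlinarith [mul_nonneg hM0 (sq_nonneg ‖w‖)]
  · rw [← dist_eq_norm]
    refine (hK.dist_le_mul x p).trans ?_
    gcongr
    rw [segment_eq_image'] at hx
    obtain ⟨θ, hθ, rfl⟩ := hx
    simp only [add_sub_cancel_left, dist_eq_norm, norm_smul, Real.norm_eq_abs, abs_of_nonneg hθ.1]
    nlinarith [hθ.2, norm_nonneg w]

/-! ### Planes as zero sets of perturbed projections -/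

/-- The component of `X` orthogonal to the subspace `W`. -/
abbrev perp (W : Submodule ℝ (EuclideanSpace ℝ (Fin n))) :
    EuclideanSpace ℝ (Fin n) →L[ℝ] Wᗮ := Wᗮ.orthogonalProjectionOnto

theorem norm_perp_le (W : Submodule ℝ (EuclideanSpace ℝ (Fin n))) (X : EuclideanSpace ℝ (Fin n)) :
    ‖perp W X‖ ≤ ‖X‖ := by
  have := (perp W).le_opNorm X
  have h := Submodule.orthogonalProjectionOnto_norm_le (𝕜 := ℝ) Wᗮ
  nlinarith [norm_nonneg X]

theorem perp_coe (W : Submodule ℝ (EuclideanSpace ℝ (Fin n))) (v : Wᗮ) : perp W v = v :=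
  Submodule.orthogonalProjectionOnto_mem_subspace_eq_self v

theorem perp_eq_zero {W : Submodule ℝ (EuclideanSpace ℝ (Fin n))} {X : EuclideanSpace ℝ (Fin n)}
    (h : X ∈ W) : perp W X = 0 :=
  Submodule.orthogonalProjectionOnto_orthogonal_apply_eq_zero h

/-- A small perturbation of the orthogonal projection to `Wᗮ` again vanishes, up to a shift, on an
affine plane of the same dimension, and its size controls the distance to that plane. -/
theorem exists_plane_of_perturbation (W : Submodule ℝ (EuclideanSpace ℝ (Fin n)))
    (T : EuclideanSpace ℝ (Fin n) →L[ℝ] Wᗮ) (hT : ‖T‖ ≤ 1 / 2) (q : Wᗮ) :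
    ∃ (W' : Submodule ℝ (EuclideanSpace ℝ (Fin n))) (X' : EuclideanSpace ℝ (Fin n)),
      Module.finrank ℝ W' = Module.finrank ℝ W ∧
      ∀ Y, ‖perp W' (Y - X')‖ ≤ 2 * ‖perp W Y - T Y - q‖ := by
  set S : EuclideanSpace ℝ (Fin n) →ₗ[ℝ] Wᗮ := (perp W - T).toLinearMap with hS
  have hSapp : ∀ Y, S Y = perp W Y - T Y := fun Y => rfl
  -- On `Wᗮ` the map `S` is the identity minus `T`, hence bounded below by `1/2`. This makes `S`
  -- onto, so its kernel has the dimension of `W`.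
  have hlow : ∀ v : Wᗮ, ‖v‖ ≤ 2 * ‖S v‖ := by
    intro v
    have h1 : ‖T v‖ ≤ 1 / 2 * ‖v‖ := by
      refine (T.le_opNorm _).trans ?_
      rw [Submodule.coe_norm]
      gcongr
    have h2 : ‖v‖ ≤ ‖S v‖ + ‖T v‖ := by
      have : v = S v + T v := by rw [hSapp, perp_coe]; abel
      calc ‖v‖ = ‖S v + T v‖ := by rw [← this]
        _ ≤ _ := norm_add_le _ _
    linarith
  have hsurj' : Function.Surjective (S ∘ₗ Wᗮ.subtype) := by
    refine LinearMap.injective_iff_surjective.mp ((injective_iff_map_eq_zero _).mpr fun v hv => ?_)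
    have := hlow v
    have h0 : S v = 0 := hv
    rw [h0, norm_zero, mul_zero] at this
    exact norm_le_zero_iff.mp this
  have hsurj : Function.Surjective S := fun w => by
    obtain ⟨v, hv⟩ := hsurj' w
    exact ⟨v, hv⟩
  obtain ⟨X', hX'⟩ := hsurj q
  refine ⟨LinearMap.ker S, X', ?_, fun Y => ?_⟩
  · have h1 := S.finrank_range_add_finrank_ker
    rw [LinearMap.range_eq_top.mpr hsurj, finrank_top] at h1
    have h2 := W.finrank_add_finrank_orthogonal
    omega
  -- Modulo `ker S`, the vector `Y - X'` is represented by some `v` in `Wᗮ`, where the lower bound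
  -- for `S` applies.
  · obtain ⟨v, hv⟩ := hsurj' (S (Y - X'))
    have hv' : S v = S (Y - X') := hv
    have h1 : perp (LinearMap.ker S) (Y - X') = perp (LinearMap.ker S) v := by
      rw [← sub_eq_zero, ← map_sub]
      refine perp_eq_zero ?_
      rw [LinearMap.mem_ker, map_sub, hv', sub_self]
    rw [h1]
    have h2 : S (Y - X') = perp W Y - T Y - q := by rw [map_sub, hX', hSapp]
    rw [← h2, ← hv']
    exact (norm_perp_le _ _).trans (hlow v)

/-! ### Taylor expansion of averages and improvement at unit scale -/

/-- Expansion of the translated cutoff `y ↦ ψ(y · x⁻¹)` at the origin, to first order in the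
spatial variable. -/
theorem exists_kernel_expansion (G : Geometry n) :
    ∃ (C : ℝ) (Λ : Pt n → EuclideanSpace ℝ (Fin n) →L[ℝ] ℝ), 0 ≤ C ∧ Continuous Λ ∧
      (∀ x, G.gauge x < 4 → ‖Λ x‖ ≤ C) ∧
      ∀ x y δ, G.gauge x < 4 → δ ≤ 1 → G.gauge y ≤ δ →
        |bump (G.op y (G.inv x)) - bump (G.inv x) - Λ x y.1| ≤ C * δ ^ 2 := by
  obtain ⟨C, hC0, hC1, hC2⟩ := exists_bump_taylor (n := n)
  have hη : ∀ x Y, G.gauge x < 4 → |G.η Y x.1| ≤ 2 * ‖Y‖ := by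
    intro x Y hx
    have h1 := G.abs_η_le Y x.1
    have h2 : ‖x.1‖ ≤ 4 := (G.norm_fst_le_gauge x).trans hx.le
    have h3 : ‖Y‖ * ‖x.1‖ ≤ ‖Y‖ * 4 := by gcongr
    linarith
  -- Here `y · x⁻¹ = x⁻¹ + (Y, t - η(Y, x.1))`. Only the part linear in `Y` enters `Λ`; the
  -- derivative in the direction `(0, t)` is `O(δ²)` and joins the error.
  let Λ : Pt n → EuclideanSpace ℝ (Fin n) →L[ℝ] ℝ := fun x =>
    (fderiv ℝ bump (-x)).comp ((ContinuousLinearMap.id ℝ _).prod (-(G.ηL x.1)))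
  have hΛ : ∀ x Y, Λ x Y = fderiv ℝ bump (-x) (Y, -G.η Y x.1) := fun x Y => rfl
  -- The increment has norm at most `3δ`, so the Taylor remainder gives `9C` and the vertical
  -- derivative one more `C`.
  refine ⟨10 * C, Λ, by positivity, ?_, ?_, ?_⟩
  · have h1 : Continuous (fun x : Pt n => fderiv ℝ bump (-x)) :=
      (contDiff_bump.continuous_fderiv (by simp)).comp continuous_neg
    have h2 : Continuous (fun x : Pt n =>
        (ContinuousLinearMap.id ℝ (EuclideanSpace ℝ (Fin n))).prod (-(G.ηL x.1))) := by
      have : Continuous (fun x : Pt n => ((ContinuousLinearMap.id ℝ (EuclideanSpace ℝ (Fin n))),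
        (-(G.ηL x.1)))) := by fun_prop
      exact (ContinuousLinearMap.prodₗᵢ ℝ (𝕜 := ℝ)).continuous.comp this
    exact h1.clm_comp h2
  · intro x hx
    refine ContinuousLinearMap.opNorm_le_bound _ (by positivity) fun Y => ?_
    rw [hΛ]
    refine (ContinuousLinearMap.le_opNorm _ _).trans ?_
    have h1 : ‖((Y, -G.η Y x.1) : Pt n)‖ ≤ 2 * ‖Y‖ := by
      rw [Prod.norm_def]
      refine max_le (by simp only; linarith [norm_nonneg Y]) ?_
      simp only [norm_neg, Real.norm_eq_abs]
      exact hη x Y hx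
    calc _ ≤ C * (2 * ‖Y‖) := mul_le_mul (hC1 _) h1 (norm_nonneg _) hC0
      _ ≤ _ := by nlinarith [mul_nonneg hC0 (norm_nonneg Y)]
  · intro x y δ hx hδ hy
    have hδ0 : 0 ≤ δ := (G.gauge_nonneg y).trans hy
    have hY : ‖y.1‖ ≤ δ := (G.norm_fst_le_gauge y).trans hy
    have ht : |y.2| ≤ δ ^ 2 := (G.abs_snd_le_gauge_sq y).trans
      (pow_le_pow_left₀ (G.gauge_nonneg y) hy 2)
    have e1 : G.op y (G.inv x) = G.inv x + (y.1, y.2 - G.η y.1 x.1) := by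
      rw [G.op_inv_eq]
      ext1
      · simp [Geometry.inv, sub_eq_neg_add]
      · simp only [Geometry.inv, Prod.snd_add]; ring
    have e2 : G.inv x = -x := rfl
    have e3 : fderiv ℝ bump (-x) (y.1, y.2 - G.η y.1 x.1)
        = Λ x y.1 + fderiv ℝ bump (-x) ((0, y.2) : Pt n) := by
      rw [hΛ, ← map_add]
      congr 1
      ext1 <;> simp [sub_eq_neg_add]
    have h1 := hC2 (-x) (y.1, y.2 - G.η y.1 x.1)
    have h2 : ‖((y.1, y.2 - G.η y.1 x.1) : Pt n)‖ ≤ 3 * δ := by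
      rw [Prod.norm_def]
      refine max_le (by simp only; linarith) ?_
      simp only [Real.norm_eq_abs]
      refine (abs_sub _ _).trans ?_
      have := hη x y.1 hx
      nlinarith
    have h3 : |fderiv ℝ bump (-x) ((0, y.2) : Pt n)| ≤ C * δ ^ 2 := by
      rw [← Real.norm_eq_abs]
      refine (ContinuousLinearMap.le_opNorm _ _).trans ?_
      refine mul_le_mul (hC1 _) ?_ (norm_nonneg _) hC0
      rw [Prod.norm_def]
      refine max_le (by simp only [norm_zero]; positivity) ht
    rw [e1, e2]
    have h4 : bump (-x + (y.1, y.2 - G.η y.1 x.1)) - bump (-x) - Λ x y.1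
        = (bump (-x + (y.1, y.2 - G.η y.1 x.1)) - bump (-x)
          - fderiv ℝ bump (-x) (y.1, y.2 - G.η y.1 x.1))
          + fderiv ℝ bump (-x) ((0, y.2) : Pt n) := by rw [e3]; ring
    rw [h4]
    refine (abs_add_le _ _).trans ?_
    have h5 : C * ‖((y.1, y.2 - G.η y.1 x.1) : Pt n)‖ ^ 2 ≤ C * (3 * δ) ^ 2 := by gcongr
    linarith [h1, h3]

theorem continuous_bump_op_inv (G : Geometry n) :
    Continuous (fun p : Pt n × Pt n => bump (G.op p.1 (G.inv p.2))) := by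
  have h := Continuous.comp (g := bump (n := n)) contDiff_bump.continuous G.continuous_op_inv
  simpa only [Function.comp_def] using h

theorem continuous_bump_op_inv_right (G : Geometry n) (y : Pt n) :
    Continuous (fun x : Pt n => bump (G.op y (G.inv x))) := by
  have h : Continuous (fun x : Pt n => (y, x)) := by fun_prop
  have h2 := Continuous.comp (g := fun p : Pt n × Pt n => bump (G.op p.1 (G.inv p.2)))
    (continuous_bump_op_inv G) h
  simpa only [Function.comp_def] using h2

theorem integrable_bump_smul {H : Type*} [NormedAddCommGroup H] [NormedSpace ℝ H]
    (G : Geometry n) {ν : Measure (Pt n)} {u : Pt n → H} (hu : Integrable u ν) (y : Pt n) :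
    Integrable (fun x => bump (G.op y (G.inv x)) • u x) ν := by
  refine hu.norm.mono' ((continuous_bump_op_inv_right G y).aestronglyMeasurable.smul
    hu.aestronglyMeasurable) (Filter.Eventually.of_forall fun x => ?_)
  rw [norm_smul, Real.norm_eq_abs]
  exact mul_le_of_le_one_left (norm_nonneg _) (abs_bump_le_one _)

/-- The averages `∫ ψ(y · x⁻¹) u(x) dν(x)` are affine in the spatial part of `y` up to a second
order error controlled by the `L¹` norm of `u`. -/
theorem exists_average_expansion (G : Geometry n) :
    ∃ C : ℝ, 0 ≤ C ∧ ∀ (H : Type) [NormedAddCommGroup H] [NormedSpace ℝ H] [CompleteSpace H]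
      (ν : Measure (Pt n)) [IsFiniteMeasure ν] (_ : ∀ᵐ x ∂ν, G.gauge x < 4)
      (u : Pt n → H) (_ : Integrable u ν) (β : ℝ) (_ : ∫ x, ‖u x‖ ∂ν ≤ β),
      ∃ (h₀ : H) (h₁ : EuclideanSpace ℝ (Fin n) →L[ℝ] H), ‖h₀‖ ≤ β ∧ ‖h₁‖ ≤ C * β ∧
        ∀ y δ, δ ≤ 1 → G.gauge y ≤ δ →
          ‖(∫ x, bump (G.op y (G.inv x)) • u x ∂ν) - h₀ - h₁ y.1‖ ≤ C * δ ^ 2 * β := by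
  obtain ⟨C, Λ, hC0, hΛc, hΛ, hexp⟩ := exists_kernel_expansion G
  refine ⟨C, hC0, fun H _ _ _ ν _ hν u hu β hβ => ?_⟩
  have hI0 : Integrable (fun x => bump (G.inv x) • u x) ν := by
    have hcont : Continuous (fun x : Pt n => bump (G.inv x)) :=
      contDiff_bump.continuous.comp G.continuous_inv
    refine hu.norm.mono' (hcont.aestronglyMeasurable.smul hu.aestronglyMeasurable)
      (Filter.Eventually.of_forall fun x => ?_)
    rw [norm_smul, Real.norm_eq_abs]
    exact mul_le_of_le_one_left (norm_nonneg _) (abs_bump_le_one _)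
  have hI1 : Integrable (fun x => (Λ x).smulRight (u x)) ν := by
    refine (hu.norm.const_mul C).mono' ?_ ?_
    · have h := (ContinuousLinearMap.smulRightL ℝ (EuclideanSpace ℝ (Fin n)) H).continuous₂
      exact h.comp_aestronglyMeasurable (hΛc.aestronglyMeasurable.prodMk hu.aestronglyMeasurable)
    · filter_upwards [hν] with x hx
      rw [ContinuousLinearMap.norm_smulRight_apply]
      exact mul_le_mul_of_nonneg_right (hΛ x hx) (norm_nonneg _)
  -- The kernel expansion is integrated term by term against `u`.
  refine ⟨∫ x, bump (G.inv x) • u x ∂ν, ∫ x, (Λ x).smulRight (u x) ∂ν, ?_, ?_, ?_⟩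
  · refine (norm_integral_le_of_norm_le hu.norm (Filter.Eventually.of_forall fun x => ?_)).trans hβ
    rw [norm_smul, Real.norm_eq_abs]
    exact mul_le_of_le_one_left (norm_nonneg _) (abs_bump_le_one _)
  · refine (norm_integral_le_of_norm_le (hu.norm.const_mul C) ?_).trans ?_
    · filter_upwards [hν] with x hx
      rw [ContinuousLinearMap.norm_smulRight_apply]
      exact mul_le_mul_of_nonneg_right (hΛ x hx) (norm_nonneg _)
    · rw [integral_const_mul]; gcongr
  · intro y δ hδ hy
    have e1 : (∫ x, (Λ x).smulRight (u x) ∂ν) y.1 = ∫ x, Λ x y.1 • u x ∂ν := by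
      rw [ContinuousLinearMap.integral_apply hI1]; rfl
    have hI2 : Integrable (fun x => Λ x y.1 • u x) ν := hI1.apply_continuousLinearMap y.1
    have hI3 := integrable_bump_smul G hu y
    rw [e1, ← integral_sub hI3 hI0]
    have hI4 : Integrable (fun x => bump (G.op y (G.inv x)) • u x - bump (G.inv x) • u x) ν :=
      hI3.sub hI0
    rw [← integral_sub hI4 hI2]
    refine (norm_integral_le_of_norm_le (hu.norm.const_mul (C * δ ^ 2)) ?_).trans ?_
    · filter_upwards [hν] with x hx
      rw [← sub_smul, ← sub_smul, norm_smul, Real.norm_eq_abs]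
      exact mul_le_mul_of_nonneg_right (hexp x y δ hx hδ hy) (norm_nonneg _)
    · rw [integral_const_mul]; gcongr

/-- The vector valued convolution whose components are the odd kernels, at unit scale. -/
def oddAverage (G : Geometry n) (ν : Measure (Pt n)) (y : Pt n) : EuclideanSpace ℝ (Fin n) :=
  ∫ x, bump (G.op y (G.inv x)) • (y.1 - x.1) ∂ν

/-- For `y` in the quarter ball and `x` in the half ball the distance is at most `9/8 * 3/4 < 1`,
where the cutoff equals one. -/
theorem le_integral_bump (G : Geometry n) {ν : Measure (Pt n)} [IsFiniteMeasure ν] {c : ℝ}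
    (hc : c ≤ ν.real (G.ball 0 (1 / 2))) {y : Pt n} (hy : G.gauge y ≤ 1 / 4) :
    c ≤ ∫ x, bump (G.op y (G.inv x)) ∂ν := by
  refine hc.trans ?_
  rw [← integral_indicator_one (G.measurableSet_ball 0 (1 / 2))]
  have hI : Integrable (fun x => bump (G.op y (G.inv x))) ν := by
    simpa using integrable_bump_smul G (integrable_const (1 : ℝ)) y
  refine integral_mono ((integrable_const 1).indicator (G.measurableSet_ball 0 (1 / 2))) hI
    fun x => ?_
  by_cases hx : x ∈ G.ball 0 (1 / 2)
  · rw [indicator_of_mem hx, bump_eq_one G]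
    · rfl
    · have h1 := G.d_triangle y 0 x
      rw [G.d_comm y 0, G.d_zero_left] at h1
      have h2 : G.d 0 x < 1 / 2 := hx
      have h3 : G.d y x = G.gauge (G.op y (G.inv x)) := rfl
      linarith
  · rw [indicator_of_notMem hx]; exact bump_nonneg _

-- The improvement step in normalised form: `β` bounds the `L¹` deviation from the old plane, and
-- the new plane is the zero set of `perp W (Y - X₁)` minus the first-order Taylor polynomial of
-- `h/g`. What remains is the odd average and a second-order error still proportional to `β`.
set_option maxHeartbeats 1000000 in
theorem exists_plane_unit (G : Geometry n) {K : ℝ} (hK : 0 < K) :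
    ∃ (C ε : ℝ), 0 < C ∧ 0 < ε ∧ ∀ (ν : Measure (Pt n)) [IsFiniteMeasure ν]
      (_ : ∀ᵐ x ∂ν, G.gauge x < 4) (_ : ν.real univ ≤ K) (_ : K⁻¹ ≤ ν.real (G.ball 0 (1 / 2)))
      (W : Submodule ℝ (EuclideanSpace ℝ (Fin n))) (X₁ : EuclideanSpace ℝ (Fin n)) (β : ℝ)
      (_ : ∫ x, ‖perp W (x.1 - X₁)‖ ∂ν ≤ β) (_ : β ≤ ε),
      ∃ (W' : Submodule ℝ (EuclideanSpace ℝ (Fin n))) (X' : EuclideanSpace ℝ (Fin n)),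
        Module.finrank ℝ W' = Module.finrank ℝ W ∧
        ∀ y δ, δ ≤ 1 / 4 → G.gauge y ≤ δ →
          ‖perp W' (y.1 - X')‖ ≤ C * (‖oddAverage G ν y‖ + δ ^ 2 * β) := by
  obtain ⟨C, hC0, hC⟩ := exists_average_expansion G
  -- `CT * β` will bound the linear part `T` of `h/g`, and `C'` the coefficient of `δ²β` in the
  -- remainder. The threshold `1 / (2(1 + CT))` forces `‖T‖ ≤ 1/2`.
  set CT : ℝ := K * C + K ^ 3 * C with hCT
  have hCT0 : 0 ≤ CT := by positivity
  set C' : ℝ := C + C * K * (K + CT) + C * K * CT with hC'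
  have hC'0 : 0 ≤ C' := by positivity
  refine ⟨2 * K * (1 + C'), 1 / (2 * (1 + CT)), by positivity, by positivity,
    fun ν _ hν hνK hνl W X₁ β hβ hβε => ?_⟩
  have hβ0 : 0 ≤ β := (integral_nonneg fun _ => norm_nonneg _).trans hβ
  have hIX : Integrable (fun x : Pt n => x.1) ν := by
    refine Integrable.of_bound (C := 4) (by fun_prop) ?_
    filter_upwards [hν] with x hx
    exact (G.norm_fst_le_gauge x).trans hx.le
  have hu : Integrable (fun x : Pt n => perp W (x.1 - X₁)) ν :=
    (perp W).integrable_comp (hIX.sub (integrable_const X₁))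
  have : CompleteSpace Wᗮ := FiniteDimensional.complete ℝ _
  -- The same expansion is used twice: with values in `Wᗮ` for the numerator `h`, and with the
  -- constant function one for the weight `g`.
  obtain ⟨h₀, h₁, hh₀, hh₁, hh⟩ := hC Wᗮ ν hν (fun x => perp W (x.1 - X₁)) hu β hβ
  obtain ⟨g₀, g₁, hg₀, hg₁, hg⟩ := hC ℝ ν hν (fun _ => (1 : ℝ)) (integrable_const 1) K
    (by simpa using hνK)
  simp only [smul_eq_mul, mul_one] at hg
  have hg₀l : K⁻¹ ≤ g₀ := by
    have h1 := hg 0 0 (by norm_num) (by simp [Geometry.gauge])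
    have h2 := le_integral_bump G hνl (y := 0) (by simp [Geometry.gauge])
    simp only [Prod.fst_zero, map_zero, sub_zero, Real.norm_eq_abs] at h1
    have h3 := (abs_le.mp h1).2
    have h4 : C * 0 ^ 2 * K = 0 := by ring
    linarith
  have hg₀p : 0 < g₀ := (by positivity : 0 < K⁻¹).trans_le hg₀l
  have hg₀i : |g₀⁻¹| ≤ K := by
    rw [abs_of_pos (by positivity)]
    exact inv_le_of_inv_le₀ hK hg₀l
  -- The linear term of `(h₀ + h₁ Y) / (g₀ + g₁ Y)` at `Y = 0`.
  set T : EuclideanSpace ℝ (Fin n) →L[ℝ] Wᗮ := g₀⁻¹ • h₁ - g₁.smulRight ((g₀⁻¹ ^ 2) • h₀)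
    with hT
  have hTn : ‖T‖ ≤ CT * β := by
    have e0 : ‖T‖ ≤ ‖g₀⁻¹ • h₁‖ + ‖g₁.smulRight ((g₀⁻¹ ^ 2) • h₀)‖ := by
      exact norm_sub_le (g₀⁻¹ • h₁) (g₁.smulRight ((g₀⁻¹ ^ 2) • h₀))
    rw [norm_smul, ContinuousLinearMap.norm_smulRight_apply, norm_smul, norm_pow,
      Real.norm_eq_abs] at e0
    refine e0.trans ?_
    have e1 : |g₀⁻¹| * ‖h₁‖ ≤ K * (C * β) := by gcongr
    have e2 : ‖g₁‖ * (|g₀⁻¹| ^ 2 * ‖h₀‖) ≤ (C * K) * (K ^ 2 * β) := by gcongr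
    calc _ ≤ K * (C * β) + (C * K) * (K ^ 2 * β) := add_le_add e1 e2
      _ = CT * β := by rw [hCT]; ring
  have hT2 : ‖T‖ ≤ 1 / 2 := by
    refine hTn.trans ?_
    have h1 : β * (2 * (1 + CT)) ≤ 1 := by
      rwa [le_div_iff₀ (by positivity)] at hβε
    nlinarith
  obtain ⟨W', X', hW', hX'⟩ :=
    exists_plane_of_perturbation W T hT2 (perp W X₁ + g₀⁻¹ • h₀)
  refine ⟨W', X', hW', fun y δ hδ hy => ?_⟩
  have hδ0 : 0 ≤ δ := (G.gauge_nonneg y).trans hy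
  have hY : ‖y.1‖ ≤ δ := (G.norm_fst_le_gauge y).trans hy
  set g := ∫ x, bump (G.op y (G.inv x)) ∂ν with hgdef
  set h := ∫ x, bump (G.op y (G.inv x)) • perp W (x.1 - X₁) ∂ν with hhdef
  have hgl : K⁻¹ ≤ g := le_integral_bump G hνl (hy.trans hδ)
  have hgp : 0 < g := (by positivity : 0 < K⁻¹).trans_le hgl
  have eg := hg y δ (by linarith) hy
  have eh := hh y δ (by linarith) hy
  rw [← hgdef] at eg
  rw [← hhdef] at eh
  have hF : perp W (oddAverage G ν y) = g • perp W (y.1 - X₁) - h := by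
    have hIy : Integrable (fun x => bump (G.op y (G.inv x)) • (y.1 - x.1)) ν :=
      integrable_bump_smul G ((integrable_const y.1).sub hIX) y
    have hI1 : Integrable (fun x => bump (G.op y (G.inv x))) ν := by
      simpa using integrable_bump_smul G (integrable_const (1 : ℝ)) y
    rw [oddAverage, ← (perp W).integral_comp_comm hIy, hgdef, hhdef, ← integral_smul_const,
      ← integral_sub (hI1.smul_const _) (integrable_bump_smul G hu y)]
    refine integral_congr_ae (Filter.Eventually.of_forall fun x => ?_)
    simp only [map_smul, map_sub, ← smul_sub]
    congr 1
    abel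
  set a : Wᗮ := g₀⁻¹ • h₀ + T y.1 with ha
  have hTy : ‖T y.1‖ ≤ CT * β * δ := (T.le_opNorm _).trans (by gcongr)
  have han : ‖a‖ ≤ (K + CT) * β := by
    refine (norm_add_le _ _).trans ?_
    rw [norm_smul, Real.norm_eq_abs]
    have e1 : |g₀⁻¹| * ‖h₀‖ ≤ K * β := by gcongr
    have e2 : CT * β * δ ≤ CT * β * 1 := by gcongr; linarith
    linarith
  have hrem : ‖h - g • a‖ ≤ C' * δ ^ 2 * β := by
    -- Instead of dividing by `g`, the product of the two expansions is compared with `h`: zeroth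
    -- and first-order terms cancel, leaving two Taylor errors and the quadratic term `g₁ Y • T Y`,
    -- each `O(δ²β)`.
    have e : h - g • a = (h - h₀ - h₁ y.1) - (g - g₀ - g₁ y.1) • a - g₁ y.1 • T y.1 := by
      have e1 : h₁ y.1 = g₀ • T y.1 + g₁ y.1 • g₀⁻¹ • h₀ := by
        simp only [hT, sub_apply, smul_apply,
          ContinuousLinearMap.smulRight_apply, smul_sub, smul_smul]
        rw [mul_inv_cancel₀ hg₀p.ne', one_smul,
          show g₀ * (g₁ y.1 * g₀⁻¹ ^ 2) = g₁ y.1 * g₀⁻¹ by field_simp]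
        abel
      have e2 : h₀ = g₀ • g₀⁻¹ • h₀ := by rw [smul_smul, mul_inv_cancel₀ hg₀p.ne', one_smul]
      rw [e1, ha]
      nth_rewrite 2 [e2]
      module
    rw [e]
    refine (norm_sub_le _ _).trans ?_
    refine (add_le_add (norm_sub_le _ _) le_rfl).trans ?_
    rw [norm_smul, norm_smul]
    have e3 : ‖g - g₀ - g₁ y.1‖ * ‖a‖ ≤ (C * δ ^ 2 * K) * ((K + CT) * β) := by gcongr
    have e4 : ‖g₁ y.1‖ ≤ C * K * δ := (g₁.le_opNorm _).trans (by gcongr)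
    have e5 : ‖g₁ y.1‖ * ‖T y.1‖ ≤ (C * K * δ) * (CT * β * δ) := by gcongr
    calc _ ≤ C * δ ^ 2 * β + (C * δ ^ 2 * K) * ((K + CT) * β) + (C * K * δ) * (CT * β * δ) :=
          add_le_add (add_le_add eh e3) e5
      _ = C' * δ ^ 2 * β := by rw [hC']; ring
  have hmain : ‖perp W (y.1 - X₁) - a‖ ≤ K * (‖oddAverage G ν y‖ + C' * δ ^ 2 * β) := by
    have e1 : g • (perp W (y.1 - X₁) - a) = perp W (oddAverage G ν y) + (h - g • a) := by
      rw [hF]; module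
    have e2 : g * ‖perp W (y.1 - X₁) - a‖ ≤ ‖oddAverage G ν y‖ + C' * δ ^ 2 * β := by
      rw [← abs_of_pos hgp, ← Real.norm_eq_abs, ← norm_smul, e1]
      exact (norm_add_le _ _).trans (add_le_add (norm_perp_le _ _) hrem)
    calc ‖perp W (y.1 - X₁) - a‖ = K * (K⁻¹ * ‖perp W (y.1 - X₁) - a‖) := by
          rw [← mul_assoc, mul_inv_cancel₀ hK.ne', one_mul]
      _ ≤ K * (g * ‖perp W (y.1 - X₁) - a‖) := by gcongr
      _ ≤ _ := by gcongr
  refine (hX' y.1).trans ?_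
  have e : perp W y.1 - T y.1 - (perp W X₁ + g₀⁻¹ • h₀) = perp W (y.1 - X₁) - a := by
    rw [ha, map_sub]; abel
  rw [e]
  have e1 : 0 ≤ ‖oddAverage G ν y‖ := norm_nonneg _
  have e2 : 0 ≤ δ ^ 2 * β := by positivity
  calc 2 * ‖perp W (y.1 - X₁) - a‖ ≤ 2 * (K * (‖oddAverage G ν y‖ + C' * δ ^ 2 * β)) := by
        gcongr
    _ ≤ _ := by
        have : 0 ≤ K * (C' * ‖oddAverage G ν y‖ + δ ^ 2 * β) := by positivity
        nlinarith

/-! ### Flatness coefficients and blow-ups -/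

/-- The normalised `L²` deviation of `μ` in `B_s(y)` from the vertical plane over `X₁ + W`. -/
def planeDefect (G : Geometry n) (k : ℕ) (μ : Measure (Pt n)) (y : Pt n) (s : ℝ)
    (W : Submodule ℝ (EuclideanSpace ℝ (Fin n))) (X₁ : EuclideanSpace ℝ (Fin n)) : ℝ≥0∞ :=
  (∫⁻ z in G.ball y s, ENNReal.ofReal (‖perp W (z.1 - X₁)‖ ^ 2) ∂μ) / ENNReal.ofReal (s ^ (k + 4))

/-- The smallest deviation from a vertical plane of dimension `k + 2`. -/
def flatness (G : Geometry n) (k : ℕ) (μ : Measure (Pt n)) (y : Pt n) (s : ℝ) : ℝ≥0∞ :=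
  ⨅ (W : Submodule ℝ (EuclideanSpace ℝ (Fin n))) (X₁ : EuclideanSpace ℝ (Fin n))
    (_ : Module.finrank ℝ W = k), planeDefect G k μ y s W X₁

theorem flatness_le (G : Geometry n) {k : ℕ} (μ : Measure (Pt n)) (y : Pt n) (s : ℝ)
    {W : Submodule ℝ (EuclideanSpace ℝ (Fin n))} (hW : Module.finrank ℝ W = k)
    (X₁ : EuclideanSpace ℝ (Fin n)) : flatness G k μ y s ≤ planeDefect G k μ y s W X₁ :=
  iInf_le_of_le W (iInf_le_of_le X₁ (iInf_le _ hW))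

theorem exists_of_flatness_lt (G : Geometry n) {k : ℕ} {μ : Measure (Pt n)} {y : Pt n} {s : ℝ}
    {a : ℝ≥0∞} (h : flatness G k μ y s < a) :
    ∃ (W : Submodule ℝ (EuclideanSpace ℝ (Fin n))) (X₁ : EuclideanSpace ℝ (Fin n)),
      Module.finrank ℝ W = k ∧ planeDefect G k μ y s W X₁ < a := by
  simp only [flatness, iInf_lt_iff] at h
  obtain ⟨W, X₁, hW, h⟩ := h
  exact ⟨W, X₁, hW, h⟩

/-- The chart `z ↦ δ_{1/ℓ}(z · y⁻¹)` mapping `B_ℓ(y)` to the unit ball. -/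
def chart (G : Geometry n) (y : Pt n) (ℓ : ℝ) (z : Pt n) : Pt n := G.dil ℓ⁻¹ (G.op z (G.inv y))

theorem continuous_chart (G : Geometry n) (y : Pt n) (ℓ : ℝ) : Continuous (chart G y ℓ) := by
  have h : Continuous (fun z : Pt n => (z, y)) := by fun_prop
  have h2 := Continuous.comp (g := fun p : Pt n × Pt n => G.op p.1 (G.inv p.2))
    G.continuous_op_inv h
  exact (G.continuous_dil ℓ⁻¹).comp h2

theorem chart_fst (G : Geometry n) (y : Pt n) (ℓ : ℝ) (z : Pt n) :
    (chart G y ℓ z).1 = ℓ⁻¹ • (z.1 - y.1) := by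
  rw [chart, G.op_inv_eq]; rfl

theorem gauge_chart (G : Geometry n) (y : Pt n) {ℓ : ℝ} (hℓ : 0 < ℓ) (z : Pt n) :
    G.gauge (chart G y ℓ z) = G.d y z / ℓ := by
  rw [chart, G.gauge_dil (by positivity), G.d_comm, div_eq_inv_mul]; rfl

theorem chart_op_inv (G : Geometry n) (y : Pt n) (ℓ : ℝ) (z x : Pt n) :
    G.op (chart G y ℓ z) (G.inv (chart G y ℓ x)) = G.dil ℓ⁻¹ (G.op z (G.inv x)) := by
  rw [chart, chart, G.dil_op_inv, G.op_inv_op_inv]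

/-- The restriction of `μ` to `B_{4ℓ}(y)`, rescaled to unit size. -/
def blowUp (G : Geometry n) (k : ℕ) (μ : Measure (Pt n)) (y : Pt n) (ℓ : ℝ) : Measure (Pt n) :=
  ENNReal.ofReal (ℓ ^ (k + 2))⁻¹ • (μ.restrict (G.ball y (4 * ℓ))).map (chart G y ℓ)

instance isFiniteMeasure_blowUp (G : Geometry n) (k : ℕ) (μ : Measure (Pt n))
    [IsLocallyFiniteMeasure μ] (y : Pt n)
    (ℓ : ℝ) : IsFiniteMeasure (blowUp G k μ y ℓ) := by
  have : IsFiniteMeasure (μ.restrict (G.ball y (4 * ℓ))) :=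
    isFiniteMeasure_restrict.mpr (G.measure_ball_lt_top μ y _).ne
  refine ⟨?_⟩
  rw [blowUp, Measure.smul_apply, smul_eq_mul]
  exact ENNReal.mul_lt_top ENNReal.ofReal_lt_top (measure_lt_top _ _)

theorem ae_blowUp_gauge_lt (G : Geometry n) (k : ℕ) (μ : Measure (Pt n)) (y : Pt n) {ℓ : ℝ}
    (hℓ : 0 < ℓ) : ∀ᵐ x ∂(blowUp G k μ y ℓ), G.gauge x < 4 := by
  refine Measure.ae_smul_measure ?_ _
  have hm : MeasurableSet {x : Pt n | G.gauge x < 4} :=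
    (isOpen_Iio.preimage G.continuous_gauge).measurableSet
  rw [ae_map_iff (continuous_chart G y ℓ).measurable.aemeasurable hm]
  filter_upwards [ae_restrict_mem (G.measurableSet_ball y (4 * ℓ))] with x hx
  rw [gauge_chart G y hℓ, div_lt_iff₀ hℓ]
  exact hx

theorem integral_blowUp (G : Geometry n) (k : ℕ) (μ : Measure (Pt n)) (y : Pt n) {ℓ : ℝ}
    (hℓ : 0 < ℓ) {H : Type*} [NormedAddCommGroup H] [NormedSpace ℝ H] {f : Pt n → H}
    (hf : Continuous f) :
    ∫ x, f x ∂(blowUp G k μ y ℓ)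
      = (ℓ ^ (k + 2))⁻¹ • ∫ x in G.ball y (4 * ℓ), f (chart G y ℓ x) ∂μ := by
  rw [blowUp, integral_smul_measure, integral_map (continuous_chart G y ℓ).measurable.aemeasurable
    hf.aestronglyMeasurable, ENNReal.toReal_ofReal (by positivity)]

theorem measure_blowUp (G : Geometry n) (k : ℕ) (μ : Measure (Pt n)) (y : Pt n) (ℓ : ℝ)
    {s : Set (Pt n)} (hs : MeasurableSet s) :
    blowUp G k μ y ℓ s
      = ENNReal.ofReal (ℓ ^ (k + 2))⁻¹ * μ (chart G y ℓ ⁻¹' s ∩ G.ball y (4 * ℓ)) := by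
  rw [blowUp, Measure.smul_apply, Measure.map_apply (continuous_chart G y ℓ).measurable hs,
    Measure.restrict_apply ((continuous_chart G y ℓ).measurable hs), smul_eq_mul]

/-- The kernel centred at `z` reaches less than `19/10 * ℓ`, and `9/8 * (1/4 + 19/10) < 4`. Hence
the truncation to `B_{4ℓ}(y)` in `blowUp` is invisible to the odd averages. -/
theorem bump_eq_zero_of_far (G : Geometry n) {y z x : Pt n} {ℓ : ℝ} (hℓ : 0 < ℓ)
    (hz : G.d y z ≤ ℓ / 4) (hx : x ∉ G.ball y (4 * ℓ)) :
    bump (G.dil ℓ⁻¹ (G.op z (G.inv x))) = 0 := by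
  by_contra h
  have h1 := gauge_lt_of_bounds G
    ⟨(bounds_of_bump_ne_zero h).1.le, (bounds_of_bump_ne_zero h).2.le⟩
  rw [G.gauge_dil (by positivity), ← div_eq_inv_mul, div_lt_iff₀ hℓ] at h1
  have h2 : 4 * ℓ ≤ G.d y x := not_lt.mp hx
  have h3 := G.d_triangle y z x
  have h4 : G.d z x = G.gauge (G.op z (G.inv x)) := rfl
  linarith

/-- By right invariance and homogeneity the unit-scale average of the blow-up is the
Littlewood–Paley average of `μ` at scale `ℓ`; this is where the hypothesis on `μ` enters the
improvement step. -/
theorem oddAverage_blowUp (G : Geometry n) (k : ℕ) (μ : Measure (Pt n)) [IsLocallyFiniteMeasure μ]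
    {y z : Pt n} {ℓ : ℝ} (hℓ : 0 < ℓ) (hz : G.d y z ≤ ℓ / 4) (i : Fin n) :
    oddAverage G (blowUp G k μ y ℓ) (chart G y ℓ z) i = lpConv G k (oddKernel i) μ ℓ z := by
  have hc : Continuous (fun x : Pt n => bump (G.op (chart G y ℓ z) (G.inv x)) •
      ((chart G y ℓ z).1 - x.1)) :=
    (continuous_bump_op_inv_right G _).smul (by fun_prop)
  have : IsFiniteMeasure (μ.restrict (G.ball y (4 * ℓ))) :=
    isFiniteMeasure_restrict.mpr (G.measure_ball_lt_top μ y _).ne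
  have hI : Integrable (fun x => bump (G.op (chart G y ℓ z) (G.inv (chart G y ℓ x))) •
      ((chart G y ℓ z).1 - (chart G y ℓ x).1)) (μ.restrict (G.ball y (4 * ℓ))) := by
    refine Integrable.of_bound (C := 8)
      (hc.comp (continuous_chart G y ℓ)).aestronglyMeasurable ?_
    filter_upwards [ae_restrict_mem (G.measurableSet_ball y (4 * ℓ))] with x hx
    have h1 := G.norm_fst_le_gauge (chart G y ℓ x)
    have h2 := G.norm_fst_le_gauge (chart G y ℓ z)
    rw [gauge_chart G y hℓ] at h1 h2
    have h3 : G.d y x / ℓ ≤ 4 := (div_le_iff₀ hℓ).mpr (le_of_lt hx)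
    have h4 : G.d y z / ℓ ≤ 4 := (div_le_iff₀ hℓ).mpr (by linarith)
    rw [norm_smul, Real.norm_eq_abs]
    refine (mul_le_of_le_one_left (norm_nonneg _) (abs_bump_le_one _)).trans ?_
    exact (norm_sub_le _ _).trans (by linarith)
  rw [oddAverage, integral_blowUp G k μ y hℓ hc, lpConv]
  have hproj : ∀ v : EuclideanSpace ℝ (Fin n), v i = EuclideanSpace.proj (𝕜 := ℝ) i v :=
    fun _ => rfl
  rw [hproj, map_smul, ← ContinuousLinearMap.integral_comp_comm _ hI, smul_eq_mul]
  congr 1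
  have e : ∀ x, EuclideanSpace.proj (𝕜 := ℝ) i
      (bump (G.op (chart G y ℓ z) (G.inv (chart G y ℓ x))) •
        ((chart G y ℓ z).1 - (chart G y ℓ x).1))
      = oddKernel i (G.dil ℓ⁻¹ (G.op z (G.inv x))) := by
    intro x
    have e1 : (chart G y ℓ z).1 - (chart G y ℓ x).1
        = (G.dil ℓ⁻¹ (G.op z (G.inv x))).1 := by
      rw [← chart_op_inv G y ℓ z x, G.op_inv_eq]
    rw [chart_op_inv, e1, map_smul]
    rfl
  simp only [e]
  refine setIntegral_eq_integral_of_forall_compl_eq_zero fun x hx => ?_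
  rw [oddKernel, bump_eq_zero_of_far G hℓ hz hx, zero_mul]

/-! ### One-step decay of flatness at scale `ℓ` -/

/-- Cauchy--Schwarz on a finite measure space of mass at most `K`. -/
theorem integral_le_sqrt {α : Type*} [MeasurableSpace α] {ν : Measure α} [IsFiniteMeasure ν]
    {K Q : ℝ} (hK : 0 < K) (hν : ν.real univ ≤ K) {f : α → ℝ} (hf : Integrable f ν)
    (hf2 : Integrable (fun x => f x ^ 2) ν) (hQ : ∫ x, f x ^ 2 ∂ν ≤ Q) :
    ∫ x, f x ∂ν ≤ Real.sqrt (K * Q) := by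
  refine Real.le_sqrt_of_sq_le ?_
  set I := ∫ x, f x ∂ν
  -- Subtracting `I / K` rather than the mean avoids dividing by the mass, which may vanish.
  have h1 : 0 ≤ ∫ x, (f x - I / K) ^ 2 ∂ν := integral_nonneg fun x => sq_nonneg _
  have h2 : ∫ x, (f x - I / K) ^ 2 ∂ν
      = ∫ x, f x ^ 2 ∂ν - 2 * (I / K) * I + (I / K) ^ 2 * ν.real univ := by
    have e : ∀ x, (f x - I / K) ^ 2 = f x ^ 2 - 2 * (I / K) * f x + (I / K) ^ 2 := fun x => by ring
    simp only [e]
    have hI : Integrable (fun x => f x ^ 2 - 2 * (I / K) * f x) ν := hf2.sub (hf.const_mul _)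
    rw [integral_add hI (integrable_const _), integral_sub hf2 (hf.const_mul _),
      integral_const_mul, integral_const, smul_eq_mul]
    ring
  rw [h2] at h1
  have h3 : (I / K) ^ 2 * ν.real univ ≤ (I / K) ^ 2 * K := by gcongr
  have h4 : (I / K) ^ 2 * K = I ^ 2 / K := by field_simp
  have h5 : 2 * (I / K) * I = 2 * (I ^ 2 / K) := by ring
  have h6 : I ^ 2 / K ≤ Q := by linarith
  rwa [div_le_iff₀ hK, mul_comm] at h6

/-- At a location where `μ` is flat, the flatness improves when passing to a smaller scale, up to
an error given by the Littlewood--Paley square function. -/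
theorem exists_flatness_decay (G : Geometry n) (k : ℕ) {K : ℝ} (hK : 0 < K) :
    ∃ C ε : ℝ, 0 < C ∧ 0 < ε ∧ ∀ (μ : Measure (Pt n)) [IsLocallyFiniteMeasure μ] (y : Pt n)
      (ℓ δ D : ℝ) (_ : 0 < ℓ) (_ : 0 < δ) (_ : δ ≤ 1 / 4)
      (_ : μ (G.ball y (4 * ℓ)) ≤ ENNReal.ofReal (K * ℓ ^ (k + 2)))
      (_ : ENNReal.ofReal (K⁻¹ * ℓ ^ (k + 2)) ≤ μ (G.ball y (ℓ / 2)))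
      (_ : μ (G.ball y (δ * ℓ)) ≤ ENNReal.ofReal (K * (δ * ℓ) ^ (k + 2)))
      (_ : flatness G k μ y (4 * ℓ) < ENNReal.ofReal D) (_ : D ≤ ε),
      flatness G k μ y (δ * ℓ) ≤ ENNReal.ofReal C *
        ((∫⁻ z in G.ball y (δ * ℓ), ∑ i, ENNReal.ofReal (lpConv G k (oddKernel i) μ ℓ z ^ 2) ∂μ) /
          ENNReal.ofReal (δ ^ (k + 4) * ℓ ^ (k + 2)) + ENNReal.ofReal (δ ^ 2 * D)) := by
  obtain ⟨C, ε, hC, hε, hunit⟩ := exists_plane_unit G hK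
  set M : ℝ := K * 4 ^ (k + 4) with hM
  have hM0 : 0 < M := by positivity
  -- `β² = M * D`, so `D ≤ ε² / M` is exactly `β ≤ ε`. The factor `4 ^ (k + 4)` in `M` comes from
  -- normalising flatness at radius `4ℓ` while the blow-up uses `ℓ`.
  refine ⟨2 * C ^ 2 * (1 + M * K), ε ^ 2 / M, by positivity, by positivity, ?_⟩
  intro μ _ y ℓ δ D hℓ hδ hδ4 hup hlow hupδ hflat hD
  obtain ⟨W, X₁, hW, hdef⟩ := exists_of_flatness_lt G hflat
  have hD0 : 0 < D := ENNReal.ofReal_pos.mp (pos_of_gt hflat)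
  set ν := blowUp G k μ y ℓ with hν
  have hfin : IsFiniteMeasure (μ.restrict (G.ball y (4 * ℓ))) :=
    isFiniteMeasure_restrict.mpr (G.measure_ball_lt_top μ y _).ne
  have hcancel : (ℓ ^ (k + 2))⁻¹ * ℓ ^ (k + 2) = 1 := inv_mul_cancel₀ (by positivity)
  have hνu : ν.real univ ≤ K := by
    refine ENNReal.toReal_le_of_le_ofReal hK.le ?_
    rw [hν, measure_blowUp G k μ y ℓ MeasurableSet.univ, preimage_univ, univ_inter]
    refine (mul_le_mul_right hup _).trans ?_
    rw [← ENNReal.ofReal_mul (by positivity)]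
    refine ENNReal.ofReal_le_ofReal (le_of_eq ?_)
    rw [mul_left_comm, hcancel, mul_one]
  have hνl : K⁻¹ ≤ ν.real (G.ball 0 (1 / 2)) := by
    refine (ENNReal.ofReal_le_iff_le_toReal (measure_ne_top _ _)).mp ?_
    rw [hν, measure_blowUp G k μ y ℓ (G.measurableSet_ball _ _)]
    have hsub : G.ball y (ℓ / 2) ⊆ chart G y ℓ ⁻¹' G.ball 0 (1 / 2) ∩ G.ball y (4 * ℓ) := by
      intro x hx
      have hx' : G.d y x < ℓ / 2 := hx
      refine ⟨?_, ?_⟩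
      · rw [mem_preimage, G.mem_ball, G.d_zero_left, gauge_chart G y hℓ, div_lt_iff₀ hℓ]
        linarith
      · rw [G.mem_ball]; linarith
    refine le_trans ?_ (mul_le_mul_right (hlow.trans (measure_mono hsub)) _)
    rw [← ENNReal.ofReal_mul (by positivity)]
    refine ENNReal.ofReal_le_ofReal (le_of_eq ?_)
    rw [mul_left_comm, hcancel, mul_one]
  set X₁' : EuclideanSpace ℝ (Fin n) := ℓ⁻¹ • (X₁ - y.1) with hX₁'
  have hperp : ∀ x : Pt n, ‖perp W ((chart G y ℓ x).1 - X₁')‖ = ℓ⁻¹ * ‖perp W (x.1 - X₁)‖ := by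
    intro x
    rw [chart_fst, hX₁', ← smul_sub, map_smul, norm_smul, Real.norm_eq_abs,
      abs_of_pos (by positivity)]
    congr 3
    abel
  have hc : Continuous (fun x : Pt n => ‖perp W (x.1 - X₁')‖) := by fun_prop
  have hbd : ∀ᵐ x ∂ν, ‖‖perp W (x.1 - X₁')‖‖ ≤ 4 + ‖X₁'‖ := by
    filter_upwards [ae_blowUp_gauge_lt G k μ y hℓ] with x hx
    rw [norm_norm]
    refine (norm_perp_le _ _).trans ((norm_sub_le _ _).trans ?_)
    linarith [G.norm_fst_le_gauge x]
  have hI1 : Integrable (fun x : Pt n => ‖perp W (x.1 - X₁')‖) ν :=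
    Integrable.of_bound hc.aestronglyMeasurable _ hbd
  have hI2 : Integrable (fun x : Pt n => ‖perp W (x.1 - X₁')‖ ^ 2) ν := by
    refine Integrable.of_bound (C := (4 + ‖X₁'‖) ^ 2) (hc.pow 2).aestronglyMeasurable ?_
    filter_upwards [hbd] with x hx
    rw [norm_pow]
    gcongr
  have hQ : ∫ x, ‖perp W (x.1 - X₁')‖ ^ 2 ∂ν ≤ 4 ^ (k + 4) * D := by
    have hc2 : Continuous (fun x : Pt n => ‖perp W (x.1 - X₁')‖ ^ 2) := hc.pow 2
    rw [hν, integral_blowUp G k μ y hℓ hc2]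
    simp only [hperp, mul_pow]
    rw [integral_const_mul, smul_eq_mul]
    have h1 : ∫ x in G.ball y (4 * ℓ), ‖perp W (x.1 - X₁)‖ ^ 2 ∂μ ≤ D * (4 * ℓ) ^ (k + 4) := by
      rw [integral_eq_lintegral_of_nonneg_ae (Filter.Eventually.of_forall fun x => sq_nonneg _)
        (by fun_prop)]
      refine ENNReal.toReal_le_of_le_ofReal (by positivity) ?_
      have h2 := hdef.le
      rw [planeDefect, ENNReal.div_le_iff (ENNReal.ofReal_pos.mpr (by positivity)).ne'
        ENNReal.ofReal_ne_top, ← ENNReal.ofReal_mul hD0.le] at h2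
      exact h2
    calc _ ≤ (ℓ ^ (k + 2))⁻¹ * (ℓ⁻¹ ^ 2 * (D * (4 * ℓ) ^ (k + 4))) := by gcongr
      _ = 4 ^ (k + 4) * D := by
        rw [mul_pow, show k + 4 = (k + 2) + 2 by ring, pow_add ℓ (k + 2) 2]
        field_simp
  set β := Real.sqrt (K * (4 ^ (k + 4) * D)) with hβ
  have hβ0 : 0 ≤ β := Real.sqrt_nonneg _
  have hβ2 : β ^ 2 = M * D := by rw [hβ, Real.sq_sqrt (by positivity), hM]; ring
  have hβε : β ≤ ε := by
    refine abs_le_of_sq_le_sq' ?_ hε.le |>.2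
    rw [hβ2]
    rw [le_div_iff₀ hM0] at hD
    linarith
  obtain ⟨W', X', hW', hX'⟩ := hunit ν (ae_blowUp_gauge_lt G k μ y hℓ) hνu hνl W X₁' β
    (integral_le_sqrt hK hνu hI1 hI2 hQ) hβε
  -- The new plane is carried back by the chart: its base point becomes `y.1 + ℓ • X'`, and
  -- distances scale by `ℓ`.
  have hpt : ∀ z ∈ G.ball y (δ * ℓ), ENNReal.ofReal (‖perp W' (z.1 - (y.1 + ℓ • X'))‖ ^ 2) ≤
      ENNReal.ofReal (2 * C ^ 2 * ℓ ^ 2) *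
        (∑ i, ENNReal.ofReal (lpConv G k (oddKernel i) μ ℓ z ^ 2)
          + ENNReal.ofReal (δ ^ 4 * β ^ 2)) := by
    intro z hz
    have hz' : G.d y z < δ * ℓ := hz
    have h1 := hX' (chart G y ℓ z) δ hδ4 (by
      rw [gauge_chart G y hℓ, div_le_iff₀ hℓ]; exact hz'.le)
    have h2 : ‖perp W' ((chart G y ℓ z).1 - X')‖ = ℓ⁻¹ * ‖perp W' (z.1 - (y.1 + ℓ • X'))‖ := by
      have : (chart G y ℓ z).1 - X' = ℓ⁻¹ • (z.1 - (y.1 + ℓ • X')) := by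
        rw [chart_fst, smul_sub, smul_sub, smul_add, smul_smul, inv_mul_cancel₀ hℓ.ne', one_smul]
        abel
      rw [this, map_smul, norm_smul, Real.norm_eq_abs, abs_of_pos (by positivity)]
    rw [h2] at h1
    set F := ‖oddAverage G ν (chart G y ℓ z)‖ with hF
    have hF2 : F ^ 2 = ∑ i, lpConv G k (oddKernel i) μ ℓ z ^ 2 := by
      rw [hF, EuclideanSpace.norm_sq_eq]
      refine Finset.sum_congr rfl fun i _ => ?_
      rw [Real.norm_eq_abs, sq_abs, hν, oddAverage_blowUp G k μ hℓ]
      exact hz'.le.trans (by nlinarith)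
    have h3 : ‖perp W' (z.1 - (y.1 + ℓ • X'))‖ ≤ ℓ * (C * (F + δ ^ 2 * β)) := by
      rwa [inv_mul_le_iff₀ hℓ] at h1
    rw [← ENNReal.ofReal_sum_of_nonneg (fun i _ => sq_nonneg _), ← hF2,
      ← ENNReal.ofReal_add (by positivity) (by positivity), ← ENNReal.ofReal_mul (by positivity)]
    refine ENNReal.ofReal_le_ofReal ?_
    calc _ ≤ (ℓ * (C * (F + δ ^ 2 * β))) ^ 2 := by gcongr
      _ = C ^ 2 * ℓ ^ 2 * (F + δ ^ 2 * β) ^ 2 := by ring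
      _ ≤ C ^ 2 * ℓ ^ 2 * (2 * (F ^ 2 + (δ ^ 2 * β) ^ 2)) := by
        gcongr; nlinarith [sq_nonneg (F - δ ^ 2 * β)]
      _ = _ := by ring
  refine (flatness_le G μ y (δ * ℓ) (hW'.trans hW) (y.1 + ℓ • X')).trans ?_
  have hρ : 0 < (δ * ℓ) ^ (k + 4) := by positivity
  rw [planeDefect, ENNReal.div_le_iff (ENNReal.ofReal_pos.mpr hρ).ne' ENNReal.ofReal_ne_top]
  refine (setLIntegral_mono' (G.measurableSet_ball _ _) hpt).trans ?_
  rw [lintegral_const_mul' _ _ ENNReal.ofReal_ne_top, lintegral_add_right _ measurable_const,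
    lintegral_const, Measure.restrict_apply_univ]
  set S := ∫⁻ z in G.ball y (δ * ℓ), ∑ i, ENNReal.ofReal (lpConv G k (oddKernel i) μ ℓ z ^ 2) ∂μ
  have hmass : ENNReal.ofReal (δ ^ 4 * β ^ 2) * μ (G.ball y (δ * ℓ)) ≤
      ENNReal.ofReal (δ ^ 4 * (M * D) * (K * (δ * ℓ) ^ (k + 2))) := by
    rw [ENNReal.ofReal_mul (by positivity : 0 ≤ δ ^ 4 * (M * D)), hβ2]
    gcongr
  have hq : 0 < δ ^ (k + 4) * ℓ ^ (k + 2) := by positivity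
  have hS : S = S / ENNReal.ofReal (δ ^ (k + 4) * ℓ ^ (k + 2)) *
      ENNReal.ofReal (δ ^ (k + 4) * ℓ ^ (k + 2)) :=
    (ENNReal.div_mul_cancel (ENNReal.ofReal_pos.mpr hq).ne' ENNReal.ofReal_ne_top).symm
  set S' := S / ENNReal.ofReal (δ ^ (k + 4) * ℓ ^ (k + 2))
  calc _ ≤ ENNReal.ofReal (2 * C ^ 2 * ℓ ^ 2) * (S' * ENNReal.ofReal (δ ^ (k + 4) * ℓ ^ (k + 2)) +
        ENNReal.ofReal (δ ^ 4 * (M * D) * (K * (δ * ℓ) ^ (k + 2)))) := by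
        rw [← hS]; gcongr
    _ = ENNReal.ofReal (2 * C ^ 2) * S' * ENNReal.ofReal ((δ * ℓ) ^ (k + 4))
        + ENNReal.ofReal (2 * C ^ 2 * (M * K)) * ENNReal.ofReal (δ ^ 2 * D)
          * ENNReal.ofReal ((δ * ℓ) ^ (k + 4)) := by
        -- Bookkeeping of powers: `δ⁴` from the squared Taylor error, less `δ²` from renormalising
        -- squared distance to radius `δℓ`, leaves the gain `δ²`.
        have e1 : (2 * C ^ 2 * ℓ ^ 2) * (δ ^ (k + 4) * ℓ ^ (k + 2))
            = (2 * C ^ 2) * (δ * ℓ) ^ (k + 4) := by ring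
        have e2 : (2 * C ^ 2 * ℓ ^ 2) * (δ ^ 4 * (M * D) * (K * (δ * ℓ) ^ (k + 2)))
            = (2 * C ^ 2 * (M * K)) * (δ ^ 2 * D) * (δ * ℓ) ^ (k + 4) := by ring
        have e3 : ENNReal.ofReal (2 * C ^ 2 * ℓ ^ 2) * ENNReal.ofReal (δ ^ (k + 4) * ℓ ^ (k + 2))
            = ENNReal.ofReal (2 * C ^ 2) * ENNReal.ofReal ((δ * ℓ) ^ (k + 4)) := by
          rw [← ENNReal.ofReal_mul (by positivity), e1, ENNReal.ofReal_mul (by positivity)]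
        have e4 : ENNReal.ofReal (2 * C ^ 2 * ℓ ^ 2)
              * ENNReal.ofReal (δ ^ 4 * (M * D) * (K * (δ * ℓ) ^ (k + 2)))
            = ENNReal.ofReal (2 * C ^ 2 * (M * K)) * ENNReal.ofReal (δ ^ 2 * D)
              * ENNReal.ofReal ((δ * ℓ) ^ (k + 4)) := by
          rw [← ENNReal.ofReal_mul (by positivity), e2, ENNReal.ofReal_mul (by positivity),
            ENNReal.ofReal_mul (by positivity)]
        rw [mul_add, e4, mul_left_comm, e3]
        ring
    _ ≤ ENNReal.ofReal (2 * C ^ 2 * (1 + M * K)) * S' * ENNReal.ofReal ((δ * ℓ) ^ (k + 4))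
        + ENNReal.ofReal (2 * C ^ 2 * (1 + M * K)) * ENNReal.ofReal (δ ^ 2 * D)
          * ENNReal.ofReal ((δ * ℓ) ^ (k + 4)) := by
        have : 0 < M * K := by positivity
        have h1 : 2 * C ^ 2 ≤ 2 * C ^ 2 * (1 + M * K) :=
          le_mul_of_one_le_right (by positivity) (by linarith)
        have h2 : 2 * C ^ 2 * (M * K) ≤ 2 * C ^ 2 * (1 + M * K) :=
          mul_le_mul_of_nonneg_left (by linarith) (by positivity)
        exact add_le_add
          (mul_le_mul_left (mul_le_mul_left (ENNReal.ofReal_le_ofReal h1) _) _)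
          (mul_le_mul_left (mul_le_mul_left (ENNReal.ofReal_le_ofReal h2) _) _)
    _ = _ := by ring

/-! ### Small `α`-numbers give flatness -/

/-- A model measure is carried by a vertical plane. -/
theorem exists_ae_perp_eq_zero_of_mem_models {G : Geometry n} {C₀ : ℝ} {k m : ℕ}
    {ω : Measure (Pt n)} (hω : ω ∈ models G C₀ k m) :
    ∃ (W : Submodule ℝ (EuclideanSpace ℝ (Fin n))) (X₁ : EuclideanSpace ℝ (Fin n)),
      Module.finrank ℝ W = m ∧ ∀ᵐ x ∂ω, perp W (x.1 - X₁) = 0 := by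
  obtain ⟨σ, ⟨-, -, L, ν, hL, hν, rfl⟩, z, rfl⟩ := hω
  -- Right translation by `z⁻¹` shifts the spatial part by `-z.1`; the twist moves only `t`, which a
  -- vertical plane ignores.
  refine ⟨L, -z.1, hL, ?_⟩
  have hc : Continuous (fun y : Pt n => G.op y (G.inv z)) := by
    have h : Continuous (fun y : Pt n => (y, z)) := by fun_prop
    have h2 := Continuous.comp (g := fun p : Pt n × Pt n => G.op p.1 (G.inv p.2))
      G.continuous_op_inv h
    simpa only [Function.comp_def] using h2
  have hm : MeasurableSet {x : Pt n | perp L (x.1 - -z.1) = 0} := by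
    have : Continuous (fun x : Pt n => perp L (x.1 - -z.1)) := by fun_prop
    exact (isClosed_singleton.preimage this).measurableSet
  rw [ae_map_iff hc.measurable.aemeasurable hm]
  have hnull : ((Measure.hausdorffMeasure (m : ℝ)).restrict
      (L : Set (EuclideanSpace ℝ (Fin n)))).prod ν ((L : Set _)ᶜ ×ˢ univ) = 0 := by
    rw [Measure.prod_prod, Measure.restrict_apply
      (Submodule.closed_of_finiteDimensional L).measurableSet.compl, compl_inter_self,
      measure_empty, zero_mul]
  refine measure_mono_null (fun y hy => ?_) hnull
  refine ⟨fun hyL => hy ?_, mem_univ _⟩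
  rw [mem_ofPred_eq, G.op_inv_eq]
  refine perp_eq_zero ?_
  simpa using hyL

theorem tsupport_bump_chart_subset (G : Geometry n) (z : Pt n) {s : ℝ} (hs : 0 < s) :
    tsupport (fun x => bump (chart G z s x)) ⊆ G.ball z (2 * s) := by
  intro x hx
  have h1 := tsupport_comp_subset_preimage bump (continuous_chart G z s) hx
  have h2 := gauge_lt_of_bounds G (tsupport_bump_subset h1)
  rw [gauge_chart G z hs, div_lt_iff₀ hs] at h2
  rw [G.mem_ball]
  linarith

/-- The function `min(|Q(X - X₁)|, r)`, the truncated distance to a vertical plane. -/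
def truncDist (W : Submodule ℝ (EuclideanSpace ℝ (Fin n))) (X₁ : EuclideanSpace ℝ (Fin n)) (r : ℝ)
    (x : Pt n) : ℝ := min ‖perp W (x.1 - X₁)‖ r

theorem continuous_truncDist (W : Submodule ℝ (EuclideanSpace ℝ (Fin n)))
    (X₁ : EuclideanSpace ℝ (Fin n)) (r : ℝ) : Continuous (truncDist W X₁ r) := by
  unfold truncDist; fun_prop

theorem truncDist_nonneg (W : Submodule ℝ (EuclideanSpace ℝ (Fin n)))
    (X₁ : EuclideanSpace ℝ (Fin n)) {r : ℝ} (hr : 0 < r) (x : Pt n) : 0 ≤ truncDist W X₁ r x :=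
  le_min (norm_nonneg _) hr.le

theorem norm_perp_sub_le (G : Geometry n) (W : Submodule ℝ (EuclideanSpace ℝ (Fin n)))
    (X₁ : EuclideanSpace ℝ (Fin n)) (x y : Pt n) :
    ‖perp W (x.1 - X₁)‖ ≤ ‖perp W (y.1 - X₁)‖ + G.d x y := by
  have e : perp W (x.1 - X₁) = perp W (y.1 - X₁) + perp W (x.1 - y.1) := by
    rw [← map_add]; congr 1; abel
  rw [e]
  exact (norm_add_le _ _).trans
    (add_le_add le_rfl ((norm_perp_le _ _).trans (G.norm_sub_le_d x y)))

/-- Truncating the distance at `r` balances the Lipschitz constant `O(1/r)` of the cutoff, so the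
bound does not depend on `r` or on how far the plane lies. The cutoff at scale `3r/2` equals one on
`B_{3r/2}(z)` and is supported in `B_{3r}(z)`. -/
theorem lipBound_truncDist_mul_bump {G : Geometry n} {C : ℝ} (hC0 : 0 ≤ C)
    (hC : LipBound G C bump) (W : Submodule ℝ (EuclideanSpace ℝ (Fin n)))
    (X₁ : EuclideanSpace ℝ (Fin n)) {r : ℝ} (hr : 0 < r) (z : Pt n) :
    LipBound G (1 + C) (fun x => truncDist W X₁ r x * bump (chart G z (3 / 2 * r) x)) := by
  intro x y
  have hd := G.d_nonneg x y
  have h1 : |truncDist W X₁ r x - truncDist W X₁ r y| ≤ G.d x y := by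
    have h2 := norm_perp_sub_le G W X₁ x y
    have h3 := norm_perp_sub_le G W X₁ y x
    rw [G.d_comm y x] at h3
    have h4 := abs_min_sub_min_le_max ‖perp W (x.1 - X₁)‖ r ‖perp W (y.1 - X₁)‖ r
    refine h4.trans (max_le (abs_le.mpr ⟨by linarith, by linarith⟩) ?_)
    simpa using hd
  have h2 : |bump (chart G z (3 / 2 * r) x) - bump (chart G z (3 / 2 * r) y)|
      ≤ C * (G.d x y / r) := by
    refine (hC _ _).trans ?_
    have : G.d (chart G z (3 / 2 * r) x) (chart G z (3 / 2 * r) y) = G.d x y / (3 / 2 * r) := by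
      rw [Geometry.d, chart_op_inv, G.gauge_dil (by positivity), ← div_eq_inv_mul]; rfl
    rw [this]
    gcongr
    linarith
  have h3 : |truncDist W X₁ r y| ≤ r := by
    rw [abs_of_nonneg (truncDist_nonneg W X₁ hr y)]; exact min_le_right _ _
  have e : truncDist W X₁ r x * bump (chart G z (3 / 2 * r) x)
      - truncDist W X₁ r y * bump (chart G z (3 / 2 * r) y)
      = (truncDist W X₁ r x - truncDist W X₁ r y) * bump (chart G z (3 / 2 * r) x)
      + truncDist W X₁ r y * (bump (chart G z (3 / 2 * r) x) - bump (chart G z (3 / 2 * r) y)) := by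
    ring
  simp only [e]
  refine (abs_add_le _ _).trans ?_
  rw [abs_mul, abs_mul]
  have h4 : |truncDist W X₁ r x - truncDist W X₁ r y| * |bump (chart G z (3 / 2 * r) x)|
      ≤ G.d x y * 1 := mul_le_mul h1 (abs_bump_le_one _) (abs_nonneg _) hd
  have h5 : |truncDist W X₁ r y| *
      |bump (chart G z (3 / 2 * r) x) - bump (chart G z (3 / 2 * r) y)|
      ≤ r * (C * (G.d x y / r)) := mul_le_mul h3 h2 (abs_nonneg _) hr.le
  have h6 : r * (C * (G.d x y / r)) = C * G.d x y := by field_simp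
  linarith

/-- Small `α`-numbers force flatness. -/
theorem exists_alpha_threshold (G : Geometry n) (k : ℕ) (C₀ : ℝ) {K ε : ℝ} (hK : 0 < K)
    (hε : 0 < ε) :
    ∃ lam : ℝ, 0 < lam ∧ ∀ (μ : Measure (Pt n)) [IsLocallyFiniteMeasure μ] (z y : Pt n) (r : ℝ)
      (_ : 0 < r) (_ : G.d z y ≤ r / 4)
      (_ : ENNReal.ofReal (K⁻¹ * r ^ (k + 2)) ≤ μ (G.ball y r))
      (_ : alpha G C₀ k k μ z r ≤ ENNReal.ofReal lam),
      flatness G k μ y r < ENNReal.ofReal ε := by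
  obtain ⟨C, hC0, hC⟩ := exists_lipBound G (contDiff_bump (n := n)) hasCompactSupport_bump
  set B : ℝ := 2 * (1 + C) with hB
  have hB0 : 0 < B := by positivity
  -- The first entry yields the final bound `9 * B * lam < ε`; the second excludes that all of
  -- `B_r(y)` lies farther than `r` from the plane.
  set lam : ℝ := min (ε / (18 * B)) (K⁻¹ / (2 * B)) with hlam
  have hlam0 : 0 < lam := by positivity
  have hl1 : 9 * (B * lam) < ε := by
    have : lam ≤ ε / (18 * B) := min_le_left _ _
    rw [le_div_iff₀ (by positivity)] at this
    linarith
  have hl2 : B * lam < K⁻¹ := by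
    have : lam ≤ K⁻¹ / (2 * B) := min_le_right _ _
    rw [le_div_iff₀ (by positivity)] at this
    nlinarith [mul_pos hB0 hlam0]
  refine ⟨lam, hlam0, fun μ _ z y r hr hzy hlow hα => ?_⟩
  have hsub : ∀ x ∈ G.ball y r, G.d z x ≤ 3 / 2 * r := by
    intro x hx
    have h1 := G.d_triangle z y x
    have h2 : G.d y x < r := hx
    linarith
  rw [alpha, ENNReal.div_le_iff (ENNReal.ofReal_pos.mpr (by positivity)).ne'
    ENNReal.ofReal_ne_top, ← ENNReal.ofReal_mul hlam0.le] at hα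
  -- The infimum need not be attained; doubling the bound makes it strict and selects a model.
  have hα2 : ⨅ ω ∈ models G C₀ k k, measDist G μ ω z r
      < ENNReal.ofReal (2 * (lam * r ^ (k + 3))) := by
    refine hα.trans_lt ((ENNReal.ofReal_lt_ofReal_iff (by positivity)).mpr ?_)
    have : 0 < lam * r ^ (k + 3) := by positivity
    linarith
  simp only [iInf_lt_iff] at hα2
  obtain ⟨ω, hω, hdist⟩ := hα2
  obtain ⟨W, X₁, hW, hae⟩ := exists_ae_perp_eq_zero_of_mem_models hω
  set f : Pt n → ℝ := fun x => truncDist W X₁ r x * bump (chart G z (3 / 2 * r) x) with hf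
  have hfc : Continuous f :=
    (continuous_truncDist W X₁ r).mul (contDiff_bump.continuous.comp (continuous_chart G z _))
  have hf0 : ∀ x, 0 ≤ f x := fun x => mul_nonneg (truncDist_nonneg W X₁ hr x) (bump_nonneg _)
  have hfs : tsupport f ⊆ G.ball z (3 * r) := by
    refine (tsupport_mul_subset_right (f := truncDist W X₁ r)).trans ?_
    refine (tsupport_bump_chart_subset G z (by positivity)).trans ?_
    exact G.ball_subset_ball z (by linarith)
  have hfcs : HasCompactSupport f :=
    Metric.isCompact_of_isClosed_isBounded (isClosed_tsupport f)
      ((G.isBounded_ball z (3 * r)).subset hfs)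
  have hfi : Integrable f μ := hfc.integrable_of_hasCompactSupport hfcs
  have hfω : ∫ x, f x ∂ω = 0 := by
    refine integral_eq_zero_of_ae ?_
    filter_upwards [hae] with x hx
    simp only [hf, truncDist, hx, norm_zero, min_eq_left hr.le, zero_mul, Pi.zero_apply]
  have hint : ∫ x, f x ∂μ ≤ B * (lam * r ^ (k + 3)) := by
    have h1 : ENNReal.ofReal |(∫ x, (1 + C)⁻¹ * f x ∂μ) - ∫ x, (1 + C)⁻¹ * f x ∂ω|
        ≤ measDist G μ ω z r := by
      refine le_iSup_of_le (fun x => (1 + C)⁻¹ * f x) (le_iSup_of_le ?_ (le_iSup_of_le ?_ le_rfl))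
      · exact (tsupport_mul_subset_right (f := fun _ => (1 + C)⁻¹)).trans hfs
      · intro x y
        rw [← mul_sub, abs_mul, abs_of_pos (by positivity), inv_mul_le_iff₀ (by positivity),
          one_mul]
        exact lipBound_truncDist_mul_bump hC0 hC W X₁ hr z x y
    rw [integral_const_mul, integral_const_mul, hfω, mul_zero, sub_zero] at h1
    have h2 := (ENNReal.ofReal_lt_ofReal_iff (by positivity)).mp (h1.trans_lt hdist)
    have h3 := (le_abs_self _).trans h2.le
    rw [inv_mul_le_iff₀ (by positivity)] at h3
    linarith
  have hlint : ∫⁻ x in G.ball y r, ENNReal.ofReal (truncDist W X₁ r x) ∂μ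
      ≤ ENNReal.ofReal (B * (lam * r ^ (k + 3))) := by
    calc _ ≤ ∫⁻ x in G.ball y r, ENNReal.ofReal (f x) ∂μ := by
          refine setLIntegral_mono' (G.measurableSet_ball _ _) fun x hx => ?_
          have : bump (chart G z (3 / 2 * r) x) = 1 := by
            refine bump_eq_one G ?_
            rw [gauge_chart G z (by positivity), div_le_one (by positivity)]
            exact hsub x hx
          simp only [hf, this, mul_one, le_refl]
      _ ≤ ∫⁻ x, ENNReal.ofReal (f x) ∂μ := setLIntegral_le_lintegral _ _
      _ = ENNReal.ofReal (∫ x, f x ∂μ) :=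
          (ofReal_integral_eq_lintegral_ofReal hfi (Filter.Eventually.of_forall hf0)).symm
      _ ≤ _ := ENNReal.ofReal_le_ofReal hint
  -- Otherwise the truncated distance equals `r` throughout the ball, contradicting its small
  -- integral. Given one point within `r` of the plane, all points are within `3r`, so removing the
  -- truncation costs a factor `3`.
  obtain ⟨x₀, hx₀, hx₀r⟩ : ∃ x₀ ∈ G.ball y r, ‖perp W (x₀.1 - X₁)‖ ≤ r := by
    by_contra! hcon
    have h1 : ENNReal.ofReal r * μ (G.ball y r)
        ≤ ∫⁻ x in G.ball y r, ENNReal.ofReal (truncDist W X₁ r x) ∂μ := by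
      rw [← setLIntegral_const]
      refine setLIntegral_mono' (G.measurableSet_ball _ _) fun x hx => ?_
      rw [truncDist, min_eq_right (hcon x hx).le]
    have h2 := ((mul_le_mul_right hlow (ENNReal.ofReal r)).trans h1).trans hlint
    rw [← ENNReal.ofReal_mul hr.le, ENNReal.ofReal_le_ofReal_iff (by positivity)] at h2
    have h3 : r * (K⁻¹ * r ^ (k + 2)) = K⁻¹ * r ^ (k + 3) := by ring
    rw [h3, ← mul_assoc] at h2
    exact absurd (le_of_mul_le_mul_right h2 (by positivity)) (not_le.mpr hl2)
  refine (flatness_le G μ y r hW X₁).trans_lt ?_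
  have hmain : ∫⁻ x in G.ball y r, ENNReal.ofReal (‖perp W (x.1 - X₁)‖ ^ 2) ∂μ
      ≤ ENNReal.ofReal (9 * (B * lam)) * ENNReal.ofReal (r ^ (k + 4)) := by
    calc _ ≤ ∫⁻ x in G.ball y r,
          ENNReal.ofReal (9 * r) * ENNReal.ofReal (truncDist W X₁ r x) ∂μ := by
          refine setLIntegral_mono' (G.measurableSet_ball _ _) fun x hx => ?_
          rw [← ENNReal.ofReal_mul (by positivity)]
          refine ENNReal.ofReal_le_ofReal ?_
          have h1 := norm_perp_sub_le G W X₁ x x₀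
          have h2 : ‖x.1 - x₀.1‖ ≤ 2 * r := by
            have e : x.1 - x₀.1 = (x.1 - y.1) - (x₀.1 - y.1) := by abel
            have h3 := G.norm_sub_le_d x y
            have h4 := G.norm_sub_le_d x₀ y
            have h5 : G.d x y < r := by rw [G.d_comm]; exact hx
            have h6 : G.d x₀ y < r := by rw [G.d_comm]; exact hx₀
            rw [e]
            exact (norm_sub_le _ _).trans (by linarith)
          have h7 : ‖perp W (x.1 - X₁)‖ ≤ 3 * r := by
            have e : perp W (x.1 - X₁) = perp W (x₀.1 - X₁) + perp W (x.1 - x₀.1) := by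
              rw [← map_add]; congr 1; abel
            rw [e]
            refine (norm_add_le _ _).trans ?_
            linarith [norm_perp_le W (x.1 - x₀.1)]
          have h8 : ‖perp W (x.1 - X₁)‖ ≤ 3 * truncDist W X₁ r x := by
            rw [truncDist]
            rcases min_choice ‖perp W (x.1 - X₁)‖ r with h | h <;> rw [h]
            · linarith [norm_nonneg (perp W (x.1 - X₁))]
            · exact h7
          nlinarith [norm_nonneg (perp W (x.1 - X₁))]
      _ = ENNReal.ofReal (9 * r) *
          ∫⁻ x in G.ball y r, ENNReal.ofReal (truncDist W X₁ r x) ∂μ :=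
          lintegral_const_mul' _ _ ENNReal.ofReal_ne_top
      _ ≤ ENNReal.ofReal (9 * r) * ENNReal.ofReal (B * (lam * r ^ (k + 3))) := by gcongr
      _ = _ := by
          rw [← ENNReal.ofReal_mul (by positivity), ← ENNReal.ofReal_mul (by positivity)]
          congr 1
          ring
  have h1 : planeDefect G k μ y r W X₁ ≤ ENNReal.ofReal (9 * (B * lam)) := by
    rw [planeDefect]
    exact ENNReal.div_le_of_le_mul hmain
  exact h1.trans_lt ((ENNReal.ofReal_lt_ofReal_iff hε).mpr hl1)

/-! ### Vertical `β`-numbers versus flatness -/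

theorem norm_perp_eq (W : Submodule ℝ (EuclideanSpace ℝ (Fin n))) (X : EuclideanSpace ℝ (Fin n)) :
    ‖perp W X‖ = ‖X - W.starProjection X‖ := by
  simp [perp]

/-- The vertical plane over `X₁ + W`. -/
theorem exists_isVerticalPlane (G : Geometry n) {k : ℕ}
    {W : Submodule ℝ (EuclideanSpace ℝ (Fin n))} (hW : Module.finrank ℝ W = k)
    (X₁ : EuclideanSpace ℝ (Fin n)) :
    ∃ L : AffineSubspace ℝ (Pt n), IsVerticalPlane k L ∧
      ∀ x : Pt n, distTo G x L ≤ ENNReal.ofReal ‖perp W (x.1 - X₁)‖ := by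
  have hmem : ∀ p : Pt n, p ∈ AffineSubspace.mk' ((X₁, 0) : Pt n) (W.prod ⊤) ↔ p.1 - X₁ ∈ W := by
    intro p
    rw [AffineSubspace.mem_mk', Submodule.mem_prod]
    simp
  refine ⟨AffineSubspace.mk' (X₁, 0) (W.prod ⊤), ⟨?_, X₁, fun t => ?_⟩, fun x => ?_⟩
  · have e : (W.prod (⊤ : Submodule ℝ ℝ)).map (LinearMap.fst ℝ _ ℝ) = W := by
      ext v
      simp
    rw [AffineSubspace.direction_mk', e, hW]
  · rw [hmem]; simp
  · set v := x.1 - X₁ with hv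
    set Z := X₁ + W.starProjection v with hZ
    -- The comparison point has the projected spatial part and a height chosen to cancel the twist,
    -- so its distance to `x` is purely spatial.
    have hz : ((Z, x.2 - G.η x.1 Z) : Pt n) ∈ AffineSubspace.mk' ((X₁, 0) : Pt n) (W.prod ⊤) := by
      rw [hmem, hZ]
      simp
    refine iInf₂_le_of_le _ hz (ENNReal.ofReal_le_ofReal (le_of_eq ?_))
    rw [norm_perp_eq, Geometry.d, G.op_inv_eq, Geometry.gauge]
    have e1 : x.2 - (x.2 - G.η x.1 Z) - G.η x.1 Z = 0 := by ring
    have e2 : x.1 - Z = v - W.starProjection v := by rw [hZ, hv]; abel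
    simp only [e1, e2, abs_zero, add_zero]
    exact Real.sqrt_sq (norm_nonneg _)

/-- The two quantities differ in normalisation, by `μ(B_r)` or by `r^(k+2)`; the lower regularity
bound exchanges them. -/
theorem betaSq_le_mul_flatness (G : Geometry n) {k : ℕ} {μ : Measure (Pt n)} {y : Pt n} {r K : ℝ}
    (hr : 0 < r) (hK : 0 < K) (hlow : ENNReal.ofReal (K⁻¹ * r ^ (k + 2)) ≤ μ (G.ball y r)) :
    betaSq G k μ y r ≤ ENNReal.ofReal K * flatness G k μ y r := by
  have hK0 : ENNReal.ofReal K ≠ 0 := (ENNReal.ofReal_pos.mpr hK).ne'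
  simp only [flatness, ENNReal.mul_iInf_of_ne hK0 ENNReal.ofReal_ne_top]
  refine le_iInf fun W => le_iInf fun X₁ => le_iInf fun hW => ?_
  obtain ⟨L, hL, hdist⟩ := exists_isVerticalPlane G hW X₁
  refine (iInf₂_le L hL).trans ?_
  have hr2 : ENNReal.ofReal (r ^ 2) ≠ 0 := (ENNReal.ofReal_pos.mpr (by positivity)).ne'
  have h1 : ∫⁻ z in G.ball y r, (distTo G z L / ENNReal.ofReal r) ^ 2 ∂μ
      ≤ (∫⁻ z in G.ball y r, ENNReal.ofReal (‖perp W (z.1 - X₁)‖ ^ 2) ∂μ)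
        * (ENNReal.ofReal (r ^ 2))⁻¹ := by
    rw [← lintegral_mul_const' _ _ (ENNReal.inv_ne_top.mpr hr2)]
    refine lintegral_mono fun z => ?_
    rw [ENNReal.ofReal_pow hr.le, ENNReal.ofReal_pow (norm_nonneg _), ENNReal.inv_pow,
      ← mul_pow, ← div_eq_mul_inv]
    gcongr
    exact hdist z
  calc _ ≤ ((∫⁻ z in G.ball y r, ENNReal.ofReal (‖perp W (z.1 - X₁)‖ ^ 2) ∂μ)
        * (ENNReal.ofReal (r ^ 2))⁻¹) / ENNReal.ofReal (K⁻¹ * r ^ (k + 2)) :=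
        ENNReal.div_le_div h1 hlow
    _ = ENNReal.ofReal K * planeDefect G k μ y r W X₁ := by
        rw [planeDefect, div_eq_mul_inv, div_eq_mul_inv, mul_assoc,
          mul_left_comm (ENNReal.ofReal K)]
        congr 1
        rw [← ENNReal.ofReal_inv_of_pos (by positivity),
          ← ENNReal.ofReal_inv_of_pos (by positivity),
          ← ENNReal.ofReal_inv_of_pos (by positivity), ← ENNReal.ofReal_mul (by positivity),
          ← ENNReal.ofReal_mul (by positivity)]
        congr 1
        rw [show k + 4 = 2 + (k + 2) by ring, pow_add r 2]
        field_simp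

theorem exists_finrank_eq {k : ℕ} (hk : k ≤ n) :
    ∃ W : Submodule ℝ (EuclideanSpace ℝ (Fin n)), Module.finrank ℝ W = k := by
  obtain ⟨f, hf⟩ := exists_linearIndependent_of_le_finrank (R := ℝ)
    (M := EuclideanSpace ℝ (Fin n)) (n := k) (by simpa using hk)
  exact ⟨Submodule.span ℝ (range f), by simpa using finrank_span_eq_card hf⟩

/-- A plane through the centre already gives this. No regularity of `μ` enters, so it remains
available at scales beyond the diameter. -/
theorem betaSq_le_one (G : Geometry n) {k : ℕ} (hk : k ≤ n) (μ : Measure (Pt n)) (y : Pt n)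
    (r : ℝ) :
    betaSq G k μ y r ≤ 1 := by
  obtain ⟨W, hW⟩ := exists_finrank_eq hk
  obtain ⟨L, hL, hdist⟩ := exists_isVerticalPlane G hW y.1
  refine (iInf₂_le L hL).trans ?_
  refine ENNReal.div_le_of_le_mul ?_
  rw [← setLIntegral_const]
  refine setLIntegral_mono' (G.measurableSet_ball y r) fun z hz => ?_
  have h1 : distTo G z L ≤ ENNReal.ofReal r := by
    refine (hdist z).trans (ENNReal.ofReal_le_ofReal ?_)
    refine (norm_perp_le _ _).trans ((G.norm_sub_le_d z y).trans ?_)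
    rw [G.d_comm]; exact le_of_lt hz
  have h2 : distTo G z L / ENNReal.ofReal r ≤ 1 := ENNReal.div_le_of_le_mul (by simpa using h1)
  exact pow_le_one₀ zero_le h2

/-- Serves the degenerate support of diameter zero, where the regularity condition is vacuous. -/
theorem betaSq_eq_zero (G : Geometry n) {k : ℕ} (hk : k ≤ n) {μ : Measure (Pt n)} {y : Pt n}
    (r : ℝ) (h : ∀ᵐ z ∂μ, G.d y z = 0) : betaSq G k μ y r = 0 := by
  obtain ⟨W, hW⟩ := exists_finrank_eq hk
  obtain ⟨L, hL, hdist⟩ := exists_isVerticalPlane G hW y.1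
  refine le_antisymm ((iInf₂_le L hL).trans ?_) zero_le
  have h1 : ∫⁻ z in G.ball y r, (distTo G z L / ENNReal.ofReal r) ^ 2 ∂μ = 0 := by
    refine lintegral_eq_zero_of_ae_eq_zero (ae_restrict_of_ae ?_)
    filter_upwards [h] with z hz
    have h2 : ‖perp W (z.1 - y.1)‖ ≤ 0 := by
      refine (norm_perp_le _ _).trans ((G.norm_sub_le_d z y).trans ?_)
      rw [G.d_comm, hz]
    have h3 : distTo G z L = 0 := le_antisymm
      ((hdist z).trans (by rw [ENNReal.ofReal_of_nonpos h2])) zero_le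
    simp [h3]
  rw [h1, ENNReal.zero_div]

theorem flatness_le_mul (G : Geometry n) (k : ℕ) (μ : Measure (Pt n)) (y : Pt n) {r s : ℝ}
    (hr : 0 < r) (hrs : r ≤ s) (hs : s ≤ 2 * r) :
    flatness G k μ y r ≤ ENNReal.ofReal (2 ^ (k + 4)) * flatness G k μ y s := by
  have h0 : ENNReal.ofReal (2 ^ (k + 4) : ℝ) ≠ 0 := (ENNReal.ofReal_pos.mpr (by positivity)).ne'
  simp only [flatness, ENNReal.mul_iInf_of_ne h0 ENNReal.ofReal_ne_top]
  refine iInf_mono fun W => iInf_mono fun X₁ => iInf_mono fun hW => ?_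
  have hs0 : 0 < s := hr.trans_le hrs
  rw [planeDefect, planeDefect]
  refine ENNReal.div_le_of_le_mul ?_
  have h1 : ENNReal.ofReal (s ^ (k + 4)) ≤
      ENNReal.ofReal (2 ^ (k + 4)) * ENNReal.ofReal (r ^ (k + 4)) := by
    rw [← ENNReal.ofReal_mul (by positivity), ← mul_pow]
    gcongr
  calc _ ≤ ∫⁻ z in G.ball y s, ENNReal.ofReal (‖perp W (z.1 - X₁)‖ ^ 2) ∂μ :=
        lintegral_mono_set (G.ball_subset_ball y hrs)
    _ = (∫⁻ z in G.ball y s, ENNReal.ofReal (‖perp W (z.1 - X₁)‖ ^ 2) ∂μ) /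
          ENNReal.ofReal (s ^ (k + 4)) * ENNReal.ofReal (s ^ (k + 4)) :=
        (ENNReal.div_mul_cancel (ENNReal.ofReal_pos.mpr (by positivity)).ne'
          ENNReal.ofReal_ne_top).symm
    _ ≤ _ := by
        refine (mul_le_mul_right h1 _).trans (le_of_eq ?_)
        ring

/-- A plane through `y` gives the trivial bound. It pays for bad scales and provides the finiteness
that absorption needs. -/
theorem flatness_le_const (G : Geometry n) {k : ℕ} (hk : k ≤ n) {μ : Measure (Pt n)} {y : Pt n}
    {s K : ℝ} (hs : 0 < s) (hK : 0 < K) (hup : μ (G.ball y s) ≤ ENNReal.ofReal (K * s ^ (k + 2))) :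
    flatness G k μ y s ≤ ENNReal.ofReal K := by
  obtain ⟨W, hW⟩ := exists_finrank_eq hk
  refine (flatness_le G μ y s hW y.1).trans ?_
  rw [planeDefect]
  refine ENNReal.div_le_of_le_mul ?_
  calc _ ≤ ∫⁻ z in G.ball y s, ENNReal.ofReal (s ^ 2) ∂μ := by
        refine setLIntegral_mono' (G.measurableSet_ball y s) fun z hz => ?_
        refine ENNReal.ofReal_le_ofReal ?_
        have : ‖perp W (z.1 - y.1)‖ ≤ s := by
          refine (norm_perp_le _ _).trans ((G.norm_sub_le_d z y).trans ?_)
          rw [G.d_comm]; exact le_of_lt hz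
        gcongr
    _ = ENNReal.ofReal (s ^ 2) * μ (G.ball y s) := setLIntegral_const _ _
    _ ≤ ENNReal.ofReal (s ^ 2) * ENNReal.ofReal (K * s ^ (k + 2)) := by gcongr
    _ = _ := by
        rw [← ENNReal.ofReal_mul (by positivity), ← ENNReal.ofReal_mul (by positivity)]
        congr 1
        ring

/-! ### Summation over scales at a point -/

/-- A bounded sequence which decays by a factor two over `m` steps, up to errors, is summable with
sum controlled by the errors. -/
theorem tsum_le_of_decay {a g : ℕ → ℝ≥0∞} {m : ℕ} {K : ℝ≥0∞} (hK : K ≠ ⊤) (ha : ∀ i, a i ≤ K)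
    (h : ∀ i, a (i + m) ≤ 2⁻¹ * a i + g i) : ∑' i, a i ≤ 2 * (m * K + ∑' i, g i) := by
  refine ENNReal.tsum_le_of_sum_range_le fun N => ?_
  set A := ∑ i ∈ Finset.range N, a i with hA
  have hAfin : A ≠ ⊤ := by
    refine ENNReal.sum_ne_top.mpr fun i _ => ?_
    exact ne_top_of_le_ne_top hK (ha i)
  -- The first `m` terms are bounded trivially; the recursion applies to the others after a shift by
  -- `m`.
  have h1 : A ≤ m * K + (2⁻¹ * A + ∑' i, g i) := by
    calc A ≤ ∑ i ∈ Finset.range (m + N), a i :=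
          Finset.sum_le_sum_of_subset (Finset.range_mono (by omega))
      _ = ∑ i ∈ Finset.range m, a i + ∑ i ∈ Finset.range N, a (m + i) :=
          Finset.sum_range_add _ _ _
      _ ≤ ∑ _i ∈ Finset.range m, K + ∑ i ∈ Finset.range N, (2⁻¹ * a i + g i) := by
          gcongr with i _ i _
          · exact ha i
          · rw [add_comm m i]; exact h i
      _ ≤ _ := by
          rw [Finset.sum_const, Finset.card_range, nsmul_eq_mul, Finset.sum_add_distrib,
            ← Finset.mul_sum]
          gcongr
          exact ENNReal.sum_le_tsum _
  have h2 : 2⁻¹ * A + 2⁻¹ * A = A := by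
    rw [← add_mul, ENNReal.inv_two_add_inv_two, one_mul]
  have hfin : 2⁻¹ * A ≠ ⊤ := ENNReal.mul_ne_top (by simp) hAfin
  -- Half of `A` is absorbed; this is legitimate because partial sums, unlike the full series, are
  -- known to be finite.
  have h3 : 2⁻¹ * A ≤ m * K + ∑' i, g i := by
    refine (ENNReal.add_le_add_iff_left hfin).mp ?_
    rw [h2]
    refine h1.trans (le_of_eq ?_)
    ring
  calc A = 2 * (2⁻¹ * A) := by
        rw [← mul_assoc, ENNReal.mul_inv_cancel (by simp) (by simp), one_mul]
    _ ≤ _ := by gcongr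

/-- Superadditivity of the lower integral gives this direction without measurability, which is not
established for `flatness`, an infimum over all planes. -/
theorem tsum_lintegral_le {α : Type*} [MeasurableSpace α] (μ : Measure α) (f : ℕ → α → ℝ≥0∞) :
    ∑' i, ∫⁻ x, f i x ∂μ ≤ ∫⁻ x, ∑' i, f i x ∂μ := by
  refine ENNReal.tsum_le_of_sum_range_le fun N => ?_
  have h : ∑ i ∈ Finset.range N, ∫⁻ x, f i x ∂μ ≤ ∫⁻ x, ∑ i ∈ Finset.range N, f i x ∂μ := by
    induction N with
    | zero => simp
    | succ N ih =>
      simp only [Finset.sum_range_succ]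
      exact (add_le_add ih le_rfl).trans (le_lintegral_add _ _)
  exact h.trans (lintegral_mono fun x => ENNReal.sum_le_tsum _)

namespace DyadicGrid

variable {G : Geometry n} {k : ℕ} {μ : Measure (Pt n)} (D : DyadicGrid G k μ)

/-- The union of the cubes of generation `q` with `α`-number larger than `lam`. -/
def badSet (C₀ lam : ℝ) (q : ℤ) : Set (Pt n) :=
  {y | ∃ E, (q, E) ∈ D.badCubes C₀ k lam ∧ y ∈ E}

theorem subset_support {q : ℤ} {E : Set (Pt n)} (hE : E ∈ D.cubes q) : E ⊆ μ.support := by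
  rw [← D.sUnion_eq q (D.generation_le q ⟨E, hE⟩)]
  exact subset_sUnion_of_mem hE

theorem d_le_of_mem {q : ℤ} {E : Set (Pt n)} (hE : E ∈ D.cubes q) {x y : Pt n} (hx : x ∈ E)
    (hy : y ∈ E) : G.d x y ≤ (2 : ℝ) ^ q / 4 := by
  have h1 : ENNReal.ofReal (G.d x y) ≤ G.ediam E :=
    le_iSup₂_of_le x hx (le_iSup₂_of_le y hy le_rfl)
  exact (ENNReal.ofReal_le_ofReal_iff (by positivity)).mp (h1.trans (D.diam_le q E hE))

/-- Disjoint sets of positive measure are countably many; measurability of the bad sets rests on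
this. -/
theorem countable_cubes [IsLocallyFiniteMeasure μ] (q : ℤ) : (D.cubes q).Countable := by
  have h := Measure.countable_meas_pos_of_disjoint_iUnion (μ := μ)
    (As := fun E : D.cubes q => (E : Set (Pt n))) (fun E => D.measurableSet q E E.2)
    (fun E E' hne => D.disjoint q E E.2 E' E'.2 fun h => hne (Subtype.ext h))
  have hA := D.A_pos
  have huniv : {i : D.cubes q | 0 < μ (i : Set (Pt n))} = univ := by
    refine eq_univ_of_forall fun E => ?_
    exact lt_of_lt_of_le (ENNReal.ofReal_pos.mpr (by positivity)) (D.le_measure q E E.2)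
  rw [huniv, countable_univ_iff] at h
  exact h

theorem measurableSet_badSet [IsLocallyFiniteMeasure μ] (C₀ lam : ℝ) (q : ℤ) :
    MeasurableSet (D.badSet C₀ lam q) := by
  have e : D.badSet C₀ lam q = ⋃ E ∈ {E | (q, E) ∈ D.badCubes C₀ k lam}, E := by
    ext y; simp [badSet]
  rw [e]
  refine MeasurableSet.biUnion ((D.countable_cubes q).mono fun E hE => hE.1) fun E hE => ?_
  exact D.measurableSet q E hE.1

end DyadicGrid

/-- The Littlewood--Paley contribution at the point `y` and scale `ℓ`, averaged over a ball of
radius `s`. -/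
def lpAverage (G : Geometry n) (k : ℕ) (μ : Measure (Pt n)) (ℓ s : ℝ) (y : Pt n) : ℝ≥0∞ :=
  (∫⁻ z in G.ball y s, ∑ i, ENNReal.ofReal (lpConv G k (oddKernel i) μ ℓ z ^ 2) ∂μ) /
    ENNReal.ofReal (s ^ (k + 2))

/-- Along the scales at `y`, either the cube containing `y` has small `α`, so the decay step applies
with `ℓ = r/4`, or the scale is bad and the trivial bound is charged to the indicator of `badSet`.
-/
theorem exists_tsum_flatness_le (G : Geometry n) {k : ℕ} (hk : k ≤ n) {C₀ : ℝ} (hC₀ : 0 < C₀)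
    {μ : Measure (Pt n)} [IsLocallyFiniteMeasure μ] (hμ : IsADR G k C₀ μ) (D : DyadicGrid G k μ) :
    ∃ (C lam : ℝ) (m : ℕ), 0 < C ∧ 0 < lam ∧ 4 ≤ m ∧ ∀ y ∈ μ.support, ∀ p : ℤ,
      ENNReal.ofReal ((2 : ℝ) ^ p) < G.ediam μ.support →
      ∑' i : ℕ, flatness G k μ y ((2 : ℝ) ^ (p - i)) ≤ ENNReal.ofReal C *
        (1 + ∑' i : ℕ, (lpAverage G k μ ((2 : ℝ) ^ (p - 2 - i)) ((2 : ℝ) ^ (p - i - m)) y +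
          (D.badSet C₀ lam (p - i)).indicator 1 y)) := by
  -- Large enough that regularity at radii `4ℓ`, `ℓ/2` and `δℓ` yields the three mass hypotheses of
  -- the decay step.
  set K : ℝ := C₀ * 4 ^ (k + 2) with hK
  have hK0 : 0 < K := by positivity
  have hC₀K : C₀ ≤ K := le_mul_of_one_le_right hC₀.le (one_le_pow₀ (by norm_num))
  obtain ⟨C₁, ε, hC₁, hε, hdecay⟩ := exists_flatness_decay G k hK0
  obtain ⟨lam, hlam, hthr⟩ := exists_alpha_threshold G k C₀ hK0 hε
  obtain ⟨m₀, hm₀⟩ := exists_pow_lt_of_lt_one (show 0 < 1 / (32 * (C₁ + 1)) by positivity)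
    (by norm_num : (1 / 2 : ℝ) < 1)
  set m := m₀ + 4 with hm
  have hpow : (1 / 2 : ℝ) ^ m ≤ 1 / 16 := by
    have h1 : (1 / 2 : ℝ) ^ m₀ ≤ 1 := pow_le_one₀ (by norm_num) (by norm_num)
    rw [hm, pow_add]
    norm_num at h1 ⊢
    linarith
  have hpow2 : (1 / 2 : ℝ) ^ m ≤ 1 / (32 * (C₁ + 1)) :=
    (pow_le_pow_of_le_one (by norm_num) (by norm_num) (by omega)).trans hm₀.le
  -- With `ℓ = r/4` this makes `δℓ = 2⁻ᵐ r`, so one decay step descends exactly `m` dyadic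
  -- generations; `m ≥ 4` gives `δ ≤ 1/4`.
  set δ : ℝ := 4 * (1 / 2) ^ m with hδ
  have hδ0 : 0 < δ := by positivity
  have hδ4 : δ ≤ 1 / 4 := by rw [hδ]; linarith
  have hCδ : C₁ * δ ^ 2 ≤ 1 / 2 := by
    rw [le_div_iff₀ (by positivity)] at hpow2
    have h1 : C₁ * δ ≤ 1 := by
      rw [hδ]; nlinarith [pow_pos (by norm_num : (0 : ℝ) < 1 / 2) m]
    nlinarith
  set C₂ : ℝ := C₁ / δ ^ 2 with hC₂
  have hC₂0 : 0 < C₂ := by positivity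
  refine ⟨2 * (m * K + C₂ + K), lam, m, by positivity, hlam, by omega, fun y hy p hp => ?_⟩
  set a : ℕ → ℝ≥0∞ := fun i => flatness G k μ y ((2 : ℝ) ^ (p - i)) with ha
  set A : ℕ → ℝ≥0∞ := fun i => lpAverage G k μ ((2 : ℝ) ^ (p - 2 - i)) ((2 : ℝ) ^ (p - i - m)) y
    with hA
  set I : ℕ → ℝ≥0∞ := fun i => (D.badSet C₀ lam (p - i)).indicator 1 y with hI
  have hrp : ∀ i : ℕ, (2 : ℝ) ^ (p - (i : ℤ)) ≤ (2 : ℝ) ^ p := fun i =>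
    zpow_le_zpow_right₀ (by norm_num) (by omega)
  have hadr : ∀ s : ℝ, 0 < s → s ≤ (2 : ℝ) ^ p →
      ENNReal.ofReal (C₀⁻¹ * s ^ (k + 2)) ≤ μ (G.ball y s) ∧
      μ (G.ball y s) ≤ ENNReal.ofReal (C₀ * s ^ (k + 2)) := fun s hs hsp =>
    hμ y hy s hs ((ENNReal.ofReal_le_ofReal hsp).trans_lt hp)
  have haK : ∀ i, a i ≤ ENNReal.ofReal K := fun i => by
    refine flatness_le_const G hk (by positivity) hK0 ?_
    refine (hadr _ (by positivity) (hrp i)).2.trans (ENNReal.ofReal_le_ofReal ?_)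
    gcongr
  have hstep : ∀ i, a (i + m) ≤ 2⁻¹ * a i + (ENNReal.ofReal C₂ * A i + ENNReal.ofReal K * I i) := by
    intro i
    by_cases hbad : y ∈ D.badSet C₀ lam (p - i)
    · have : I i = 1 := by simp only [hI, indicator_of_mem hbad, Pi.one_apply]
      rw [this, mul_one]
      exact (haK _).trans (le_add_left (le_add_left le_rfl))
    set r : ℝ := (2 : ℝ) ^ (p - (i : ℤ)) with hr
    have hr0 : 0 < r := by positivity
    have hrle : r ≤ (2 : ℝ) ^ p := hrp i
    have e1 : (2 : ℝ) ^ (p - 2 - (i : ℤ)) = r / 4 := by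
      rw [hr, show p - 2 - (i : ℤ) = (p - i) - 2 by ring, zpow_sub₀ (by norm_num)]
      norm_num
    have e2 : (2 : ℝ) ^ (p - (i : ℤ) - m) = δ * (r / 4) := by
      rw [zpow_sub₀ (by norm_num), ← hr, hδ, zpow_natCast, one_div, inv_pow]
      ring
    have e3 : (2 : ℝ) ^ (p - ((i + m : ℕ) : ℤ)) = δ * (r / 4) := by
      rw [← e2]; congr 1; push_cast; ring
    have hflat : flatness G k μ y r < ENNReal.ofReal ε := by
      have hgen : ENNReal.ofReal ((2 : ℝ) ^ (p - (i : ℤ))) ≤ G.ediam μ.support :=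
        (ENNReal.ofReal_le_ofReal hrle).trans hp.le
      have hyU : y ∈ ⋃₀ D.cubes (p - i) := by rw [D.sUnion_eq _ hgen]; exact hy
      obtain ⟨E, hE, hyE⟩ := hyU
      refine hthr μ (D.center (p - i) E) y r hr0
        (D.d_le_of_mem hE (D.center_mem _ E hE) hyE) ?_ ?_
      · refine le_trans (ENNReal.ofReal_le_ofReal ?_) (hadr r hr0 hrle).1
        gcongr
      · by_contra hcon
        exact hbad ⟨E, ⟨hE, not_le.mp hcon⟩, hyE⟩
    have hane : a i ≠ ⊤ := ne_top_of_le_ne_top ENNReal.ofReal_ne_top (haK i)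
    have hai : flatness G k μ y r = a i := rfl
    refine ENNReal.le_of_forall_pos_le_add fun η hη _ => ?_
    -- The decay step needs a real bound strictly above the flatness and at most `ε`; the slack `η`
    -- is arbitrary and disappears at the end.
    set D' : ℝ := min ((a i).toReal + η) ε with hD'
    have hD'1 : flatness G k μ y (4 * (r / 4)) < ENNReal.ofReal D' := by
      rw [show 4 * (r / 4) = r by ring, hD', ENNReal.ofReal_min]
      refine lt_min ?_ hflat
      rw [hai]
      exact (ENNReal.lt_ofReal_iff_toReal_lt hane).mpr (by simpa using hη)
    have h4 : 4 * (r / 4) = r := by ring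
    have hmain := hdecay μ y (r / 4) δ D' (by positivity) hδ0 hδ4
      (by
        rw [h4]
        refine (hadr r hr0 hrle).2.trans (ENNReal.ofReal_le_ofReal (le_of_eq ?_))
        rw [hK, div_pow]; field_simp)
      (by
        refine le_trans (ENNReal.ofReal_le_ofReal ?_)
          (hadr (r / 4 / 2) (by positivity) (by linarith)).1
        rw [hK, mul_inv, mul_assoc, ← inv_pow, ← mul_pow]
        gcongr
        linarith)
      (by
        refine (hadr (δ * (r / 4)) (by positivity) (by nlinarith)).2.trans
          (ENNReal.ofReal_le_ofReal ?_)
        gcongr)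
      hD'1 (min_le_right _ _)
    have hA' : A i = (∫⁻ z in G.ball y (δ * (r / 4)),
        ∑ j, ENNReal.ofReal (lpConv G k (oddKernel j) μ (r / 4) z ^ 2) ∂μ) /
          ENNReal.ofReal ((δ * (r / 4)) ^ (k + 2)) := by
      simp only [hA, lpAverage, e1, e2]
    have hLP : ENNReal.ofReal C₁ * ((∫⁻ z in G.ball y (δ * (r / 4)),
        ∑ j, ENNReal.ofReal (lpConv G k (oddKernel j) μ (r / 4) z ^ 2) ∂μ) /
          ENNReal.ofReal (δ ^ (k + 4) * (r / 4) ^ (k + 2))) = ENNReal.ofReal C₂ * A i := by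
      rw [hA', show δ ^ (k + 4) * (r / 4) ^ (k + 2) = δ ^ 2 * (δ * (r / 4)) ^ (k + 2) by
        rw [mul_pow δ (r / 4), show k + 4 = 2 + (k + 2) by ring, pow_add δ 2, mul_assoc]]
      generalize (∫⁻ z in G.ball y (δ * (r / 4)),
        ∑ j, ENNReal.ofReal (lpConv G k (oddKernel j) μ (r / 4) z ^ 2) ∂μ) = S
      rw [div_eq_mul_inv S, div_eq_mul_inv S, mul_left_comm, mul_left_comm (ENNReal.ofReal C₂)]
      congr 1
      rw [← ENNReal.ofReal_inv_of_pos (by positivity), ← ENNReal.ofReal_inv_of_pos (by positivity),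
        ← ENNReal.ofReal_mul (by positivity), ← ENNReal.ofReal_mul (by positivity), hC₂]
      congr 1
      field_simp
    have hlin : ENNReal.ofReal C₁ * ENNReal.ofReal (δ ^ 2 * D') ≤ 2⁻¹ * a i + η := by
      rw [← ENNReal.ofReal_mul hC₁.le]
      have h5 : C₁ * (δ ^ 2 * D') ≤ 2⁻¹ * (a i).toReal + η := by
        have h6 : D' ≤ (a i).toReal + η := min_le_left _ _
        have h7 : 0 ≤ (a i).toReal + η := by positivity
        have h8 : (0 : ℝ) ≤ η := η.2
        calc C₁ * (δ ^ 2 * D') = (C₁ * δ ^ 2) * D' := by ring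
          _ ≤ (C₁ * δ ^ 2) * ((a i).toReal + η) := by gcongr
          _ ≤ 1 / 2 * ((a i).toReal + η) := by gcongr
          _ ≤ _ := by linarith
      refine (ENNReal.ofReal_le_ofReal h5).trans (le_of_eq ?_)
      rw [ENNReal.ofReal_add (by positivity) (NNReal.coe_nonneg η),
        ENNReal.ofReal_mul (by positivity),
        ENNReal.ofReal_toReal hane, ENNReal.ofReal_coe_nnreal,
        ENNReal.ofReal_inv_of_pos (by norm_num)]
      norm_num
    have hfin : a (i + m) = flatness G k μ y (δ * (r / 4)) := by simp only [ha, e3]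
    rw [hfin]
    refine hmain.trans ?_
    rw [mul_add, hLP]
    calc _ ≤ ENNReal.ofReal C₂ * A i + (2⁻¹ * a i + η) := by gcongr
      _ ≤ ENNReal.ofReal C₂ * A i + (2⁻¹ * a i + η) + ENNReal.ofReal K * I i := le_self_add
      _ = _ := by ring
  refine (tsum_le_of_decay ENNReal.ofReal_ne_top haK hstep).trans ?_
  have h1 : ∑' i, (ENNReal.ofReal C₂ * A i + ENNReal.ofReal K * I i)
      ≤ ENNReal.ofReal (C₂ + K) * ∑' i, (A i + I i) := by
    rw [← ENNReal.tsum_mul_left]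
    refine ENNReal.tsum_le_tsum fun i => ?_
    rw [mul_add]
    gcongr
    · linarith
    · linarith
  calc _ ≤ 2 * (m * ENNReal.ofReal K + ENNReal.ofReal (C₂ + K) * ∑' i, (A i + I i)) := by gcongr
    _ ≤ 2 * (ENNReal.ofReal (m * K + C₂ + K) * 1
          + ENNReal.ofReal (m * K + C₂ + K) * ∑' i, (A i + I i)) := by
        have hmK : 0 ≤ m * K := by positivity
        have h2 : (m : ℝ≥0∞) * ENNReal.ofReal K ≤ ENNReal.ofReal (m * K + C₂ + K) * 1 := by
          rw [mul_one, ← ENNReal.ofReal_natCast, ← ENNReal.ofReal_mul (by positivity)]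
          exact ENNReal.ofReal_le_ofReal (by linarith)
        have h3 : ENNReal.ofReal (C₂ + K) ≤ ENNReal.ofReal (m * K + C₂ + K) :=
          ENNReal.ofReal_le_ofReal (by linarith)
        gcongr
    _ = _ := by
        rw [← mul_add, ← mul_assoc, ENNReal.ofReal_mul (by norm_num), ENNReal.ofReal_ofNat]

/-! ### Integration over balls: square function and packing -/

theorem measurable_lpConv (G : Geometry n) (k : ℕ) {φ : Pt n → ℝ} (hφ : Continuous φ)
    (μ : Measure (Pt n)) [IsLocallyFiniteMeasure μ] (ℓ : ℝ) : Measurable (lpConv G k φ μ ℓ) := by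
  have hc : Continuous (fun p : Pt n × Pt n => φ (G.dil ℓ⁻¹ (G.op p.1 (G.inv p.2)))) := by
    have h := Continuous.comp (g := φ) hφ
      (Continuous.comp (g := G.dil ℓ⁻¹) (G.continuous_dil ℓ⁻¹) G.continuous_op_inv)
    simpa only [Function.comp_def] using h
  have h := (hc.stronglyMeasurable.integral_prod_right' (ν := μ)).measurable
  exact h.const_mul _

/-- Averaging over small balls is bounded on `L¹(μ)`, locally. -/
theorem lintegral_ball_average_le (G : Geometry n) (k : ℕ) {μ : Measure (Pt n)}
    [IsLocallyFiniteMeasure μ] {Φ : Pt n → ℝ≥0∞} (hΦ : Measurable Φ) {x : Pt n} {R s K : ℝ}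
    (hs : 0 < s) (hsR : s ≤ R / 2) (hK : 0 < K)
    (hup : ∀ᵐ z ∂μ, μ (G.ball z s) ≤ ENNReal.ofReal (K * s ^ (k + 2))) :
    ∫⁻ y in G.ball x R, (∫⁻ z in G.ball y s, Φ z ∂μ) / ENNReal.ofReal (s ^ (k + 2)) ∂μ
      ≤ ENNReal.ofReal K * ∫⁻ z in G.ball x (2 * R), Φ z ∂μ := by
  set F : Pt n → Pt n → ℝ≥0∞ := fun y z =>
    {p : Pt n × Pt n | G.d p.1 p.2 < s}.indicator (fun p => Φ p.2) (y, z) with hF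
  have hmeas : MeasurableSet {p : Pt n × Pt n | G.d p.1 p.2 < s} :=
    (isOpen_Iio.preimage G.continuous_d).measurableSet
  have hFm : Measurable (Function.uncurry F) := (hΦ.comp measurable_snd).indicator hmeas
  have hs0 : ENNReal.ofReal (s ^ (k + 2)) ≠ 0 := (ENNReal.ofReal_pos.mpr (by positivity)).ne'
  have h1 : ∀ y ∈ G.ball x R, ∫⁻ z in G.ball y s, Φ z ∂μ
      ≤ ∫⁻ z in G.ball x (2 * R), F y z ∂μ := by
    intro y hy
    have hsub : G.ball y s ⊆ G.ball x (2 * R) := by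
      intro z hz
      have h2 := G.d_triangle x y z
      have h3 : G.d x y < R := hy
      have h4 : G.d y z < s := hz
      rw [G.mem_ball]
      linarith
    calc ∫⁻ z in G.ball y s, Φ z ∂μ ≤ ∫⁻ z in G.ball y s, F y z ∂μ := by
          refine setLIntegral_mono' (G.measurableSet_ball y s) fun z hz => ?_
          simp only [hF]
          rw [indicator_of_mem (show (y, z) ∈ {p : Pt n × Pt n | G.d p.1 p.2 < s} from hz)]
      _ ≤ _ := lintegral_mono_set hsub
  have h2 : ∀ z, ∫⁻ y, F y z ∂μ = Φ z * μ (G.ball z s) := by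
    intro z
    have e : ∀ y, F y z = (G.ball z s).indicator (fun _ => Φ z) y := by
      intro y
      simp only [hF, indicator, mem_ofPred_eq, G.mem_ball, G.d_comm z y]
    simp only [e]
    rw [lintegral_indicator (G.measurableSet_ball z s), setLIntegral_const]
  calc _ ≤ ∫⁻ y in G.ball x R, (∫⁻ z in G.ball x (2 * R), F y z ∂μ) *
        (ENNReal.ofReal (s ^ (k + 2)))⁻¹ ∂μ := by
        refine setLIntegral_mono' (G.measurableSet_ball x R) fun y hy => ?_
        rw [div_eq_mul_inv]
        exact mul_le_mul_left (h1 y hy) _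
    _ ≤ ∫⁻ y, (∫⁻ z in G.ball x (2 * R), F y z ∂μ) * (ENNReal.ofReal (s ^ (k + 2)))⁻¹ ∂μ :=
        setLIntegral_le_lintegral _ _
    _ = (∫⁻ y, ∫⁻ z in G.ball x (2 * R), F y z ∂μ ∂μ) * (ENNReal.ofReal (s ^ (k + 2)))⁻¹ :=
        lintegral_mul_const' _ _ (ENNReal.inv_ne_top.mpr hs0)
    -- Tonelli and the symmetry of `d`: integrating the indicator in `y` leaves `μ(B_s(z))`, which
    -- cancels the normalisation.
    _ = (∫⁻ z in G.ball x (2 * R), ∫⁻ y, F y z ∂μ ∂μ) * (ENNReal.ofReal (s ^ (k + 2)))⁻¹ := by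
        rw [lintegral_lintegral_swap hFm.aemeasurable]
    _ ≤ (∫⁻ z in G.ball x (2 * R), Φ z * ENNReal.ofReal (K * s ^ (k + 2)) ∂μ) *
          (ENNReal.ofReal (s ^ (k + 2)))⁻¹ := by
        gcongr ?_ * _
        simp only [h2]
        refine lintegral_mono_ae (ae_restrict_of_ae ?_)
        filter_upwards [hup] with z hz
        gcongr
    _ = _ := by
        rw [lintegral_mul_const' _ _ ENNReal.ofReal_ne_top, mul_assoc, ENNReal.ofReal_mul hK.le,
          mul_assoc, ENNReal.mul_inv_cancel hs0 ENNReal.ofReal_ne_top, mul_one, mul_comm]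

theorem measurable_sum_lpConv (G : Geometry n) (k : ℕ) (μ : Measure (Pt n))
    [IsLocallyFiniteMeasure μ] (ℓ : ℝ) :
    Measurable (fun z => ∑ c : Fin n, ENNReal.ofReal (lpConv G k (oddKernel c) μ ℓ z ^ 2)) := by
  refine Finset.measurable_sum _ fun c _ => ?_
  have h := measurable_lpConv G k (isOddTest_oddKernel G c).1.continuous μ ℓ
  exact (h.pow_const 2).ennreal_ofReal

/-- The square function of all components of the odd kernel. -/
theorem exists_tsum_lintegral_lpConv_le {G : Geometry n} {k : ℕ} {μ : Measure (Pt n)}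
    [IsLocallyFiniteMeasure μ] (hgood : GoodForLP G k μ) :
    ∃ C : ℝ, 0 < C ∧ ∀ x ∈ μ.support, ∀ R : ℝ, 0 < R → ENNReal.ofReal R < G.ediam μ.support →
      ∀ q : ℤ, (2 : ℝ) ^ q ≤ R →
      ∑' i : ℕ, ∫⁻ z in G.ball x R,
          ∑ c : Fin n, ENNReal.ofReal (lpConv G k (oddKernel c) μ ((2 : ℝ) ^ (q - i)) z ^ 2) ∂μ
        ≤ ENNReal.ofReal (C * R ^ (k + 2)) := by
  choose C hC0 hC using fun c : Fin n => hgood (oddKernel c) (isOddTest_oddKernel G c)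
  have hsum : 0 ≤ ∑ c, C c := Finset.sum_nonneg fun c _ => (hC0 c).le
  refine ⟨1 + ∑ c, C c, by positivity, fun x hx R hR hRd q hq => ?_⟩
  have hm : ∀ c : Fin n, ∀ ℓ : ℝ,
      Measurable (fun z => ENNReal.ofReal (lpConv G k (oddKernel c) μ ℓ z ^ 2)) := fun c ℓ =>
    ((measurable_lpConv G k (isOddTest_oddKernel G c).1.continuous μ ℓ).pow_const 2).ennreal_ofReal
  have e : ∀ i : ℕ, ∫⁻ z in G.ball x R,
      ∑ c : Fin n, ENNReal.ofReal (lpConv G k (oddKernel c) μ ((2 : ℝ) ^ (q - i)) z ^ 2) ∂μ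
      = ∑ c : Fin n, ∫⁻ z in G.ball x R,
        ENNReal.ofReal (lpConv G k (oddKernel c) μ ((2 : ℝ) ^ (q - i)) z ^ 2) ∂μ := fun i =>
    lintegral_finsetSum _ fun c _ => hm c _
  simp only [e]
  rw [Summable.tsum_finsetSum fun c _ => ENNReal.summable]
  have hone : ∀ c : Fin n, ∑' i : ℕ, ∫⁻ z in G.ball x R,
      ENNReal.ofReal (lpConv G k (oddKernel c) μ ((2 : ℝ) ^ (q - i)) z ^ 2) ∂μ
      ≤ ENNReal.ofReal (C c * R ^ (k + 2)) := by
    intro c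
    refine le_trans ?_ (hC c x hx R hR hRd)
    let f : ℕ → {j : ℤ // (2 : ℝ) ^ (-j) ≤ R} := fun i => ⟨i - q, by
      refine le_trans (zpow_le_zpow_right₀ (by norm_num) ?_) hq
      omega⟩
    have hf : Function.Injective f := by
      intro i j hij
      have : (i : ℤ) - q = j - q := congrArg Subtype.val hij
      omega
    refine le_trans (le_of_eq ?_) (ENNReal.tsum_comp_le_tsum_of_injective hf _)
    refine tsum_congr fun i => ?_
    have : (2 : ℝ) ^ (-((f i : ℤ))) = (2 : ℝ) ^ (q - i) := by
      congr 1; simp only [f]; ring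
    rw [this]
  calc _ ≤ ∑ c : Fin n, ENNReal.ofReal (C c * R ^ (k + 2)) := Finset.sum_le_sum fun c _ => hone c
    _ = ENNReal.ofReal (∑ c : Fin n, C c * R ^ (k + 2)) :=
        (ENNReal.ofReal_sum_of_nonneg fun c _ => mul_nonneg (hC0 c).le (by positivity)).symm
    _ ≤ _ := by
        refine ENNReal.ofReal_le_ofReal ?_
        rw [← Finset.sum_mul]
        gcongr
        linarith

/-- The Carleson condition, summed over all bad cubes meeting a ball. -/
theorem exists_tsum_badSet_le {G : Geometry n} {k : ℕ} {μ : Measure (Pt n)}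
    [IsLocallyFiniteMeasure μ] (D : DyadicGrid G k μ) {C₀ lam : ℝ}
    (hcar : D.IsCarleson (D.badCubes C₀ k lam)) :
    ∃ C : ℝ≥0, ∀ x : Pt n, ∀ R : ℝ, ∀ p : ℤ, (2 : ℝ) ^ p ≤ 2 * R →
      ENNReal.ofReal ((2 : ℝ) ^ p) ≤ G.ediam μ.support →
      ∑' i : ℕ, μ (D.badSet C₀ lam (p - i) ∩ G.ball x R) ≤ C * μ (G.ball x (2 * R)) := by
  obtain ⟨-, C, hC⟩ := hcar
  refine ⟨C, fun x R p hpR hpd => ?_⟩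
  set Q := D.badCubes C₀ k lam with hQ
  -- Cubes of generation `p` meeting `B_R(x)`. By nesting they contain every smaller bad cube that
  -- meets the ball, so the Carleson condition is applied in each; they are disjoint and lie in
  -- `B_{2R}(x)`.
  set T : Set (Set (Pt n)) := {E₀ | E₀ ∈ D.cubes p ∧ (E₀ ∩ G.ball x R).Nonempty} with hT
  have hTc : T.Countable := (D.countable_cubes p).mono fun E hE => hE.1
  have hTcount : Countable T := hTc.to_subtype
  let S : ℕ → Set (Pt n) → Set (Set (Pt n)) := fun i E₀ => {E | (p - (i : ℤ), E) ∈ Q ∧ E ⊆ E₀}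
  have hS : ∀ i E₀, (S i E₀).Countable := fun i E₀ =>
    (D.countable_cubes (p - i)).mono fun E hE => hE.1.1
  have hcover : ∀ i : ℕ, D.badSet C₀ lam (p - i) ∩ G.ball x R ⊆
      ⋃ E₀ : T, ⋃ E : S i E₀, (E : Set (Pt n)) := by
    rintro i y ⟨⟨E, hE, hyE⟩, hyR⟩
    have hysupp : y ∈ ⋃₀ D.cubes p := by
      rw [D.sUnion_eq p hpd]; exact D.subset_support hE.1 hyE
    obtain ⟨E₀, hE₀, hyE₀⟩ := hysupp
    refine mem_iUnion.mpr ⟨⟨E₀, hE₀, y, hyE₀, hyR⟩, mem_iUnion.mpr ⟨⟨E, hE, ?_⟩, hyE⟩⟩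
    rcases D.nested (p - i) p (by omega) E hE.1 E₀ hE₀ with h | h
    · exact h
    · exact absurd hyE₀ (disjoint_left.mp h hyE)
  have hone : ∀ i : ℕ, μ (D.badSet C₀ lam (p - i) ∩ G.ball x R)
      ≤ ∑' E₀ : T, ∑' E : S i E₀, μ (E : Set (Pt n)) := by
    intro i
    refine (measure_mono (hcover i)).trans ((measure_iUnion_le _).trans ?_)
    refine ENNReal.tsum_le_tsum fun E₀ => ?_
    have : Countable (S i E₀) := (hS i E₀).to_subtype
    exact measure_iUnion_le _
  have htop : ∀ E₀ : T, ∑' i : ℕ, ∑' E : S i E₀, μ (E : Set (Pt n)) ≤ C * μ (E₀ : Set (Pt n)) := by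
    intro E₀
    refine le_trans ?_ (hC (p, E₀) E₀.2.1)
    rw [← ENNReal.tsum_sigma' (fun q : (i : ℕ) × S i E₀ => μ (q.2 : Set (Pt n)))]
    -- Keeping the generation in the pair makes the map injective even when one set is a cube of
    -- several generations.
    let f : ((i : ℕ) × S i E₀) → {q : ℤ × Set (Pt n) // q ∈ Q ∧ q.2 ⊆ (p, (E₀ : Set (Pt n))).2} :=
      fun q => ⟨(p - (q.1 : ℤ), q.2), q.2.2⟩
    have hf : Function.Injective f := by
      rintro ⟨i, E, hE⟩ ⟨j, E', hE'⟩ h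
      have h1 : (p - (i : ℤ), E) = (p - (j : ℤ), E') := congrArg Subtype.val h
      obtain ⟨h2, rfl⟩ := Prod.mk.injEq _ _ _ _ ▸ h1
      obtain rfl : i = j := by omega
      rfl
    exact ENNReal.tsum_comp_le_tsum_of_injective hf
      (fun q : {q : ℤ × Set (Pt n) // q ∈ Q ∧ q.2 ⊆ (p, (E₀ : Set (Pt n))).2} => μ q.1.2)
  calc _ ≤ ∑' i : ℕ, ∑' E₀ : T, ∑' E : S i E₀, μ (E : Set (Pt n)) := ENNReal.tsum_le_tsum hone
    _ = ∑' E₀ : T, ∑' i : ℕ, ∑' E : S i E₀, μ (E : Set (Pt n)) := ENNReal.tsum_comm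
    _ ≤ ∑' E₀ : T, C * μ (E₀ : Set (Pt n)) := ENNReal.tsum_le_tsum htop
    _ = C * ∑' E₀ : T, μ (E₀ : Set (Pt n)) := ENNReal.tsum_mul_left
    _ ≤ C * μ (⋃ E₀ : T, (E₀ : Set (Pt n))) := by
        gcongr
        refine tsum_meas_le_meas_iUnion_of_disjoint μ (fun E₀ => D.measurableSet p E₀ E₀.2.1) ?_
        exact fun E E' hne => D.disjoint p E E.2.1 E' E'.2.1 fun h => hne (Subtype.ext h)
    _ ≤ C * μ (G.ball x (2 * R)) := by
        gcongr
        refine iUnion_subset fun E₀ y hy => ?_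
        obtain ⟨hE₀, w, hwE, hwR⟩ := E₀.2
        have h1 := G.d_triangle x w y
        have h2 := D.d_le_of_mem hE₀ hwE hy
        have h3 : G.d x w < R := hwR
        have h4 : (0 : ℝ) < 2 ^ p := by positivity
        rw [G.mem_ball]
        linarith

theorem measurable_lpAverage (G : Geometry n) (k : ℕ) (μ : Measure (Pt n))
    [IsLocallyFiniteMeasure μ] (ℓ s : ℝ) : Measurable (lpAverage G k μ ℓ s) := by
  have hmeas : MeasurableSet {p : Pt n × Pt n | G.d p.1 p.2 < s} :=
    (isOpen_Iio.preimage G.continuous_d).measurableSet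
  have hF : Measurable ({p : Pt n × Pt n | G.d p.1 p.2 < s}.indicator (fun p =>
      ∑ c : Fin n, ENNReal.ofReal (lpConv G k (oddKernel c) μ ℓ p.2 ^ 2))) :=
    ((measurable_sum_lpConv G k μ ℓ).comp measurable_snd).indicator hmeas
  have h := (hF.lintegral_prod_right' (ν := μ)).div_const (ENNReal.ofReal (s ^ (k + 2)))
  have e : lpAverage G k μ ℓ s = fun y => (∫⁻ z, {p : Pt n × Pt n | G.d p.1 p.2 < s}.indicator
      (fun p => ∑ c : Fin n, ENNReal.ofReal (lpConv G k (oddKernel c) μ ℓ p.2 ^ 2)) (y, z) ∂μ) /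
        ENNReal.ofReal (s ^ (k + 2)) := by
    funext y
    rw [lpAverage, ← lintegral_indicator (G.measurableSet_ball y s)]
    rfl
  rw [e]
  exact h

/-- The discrete square function of the flatness coefficients obeys the Carleson estimate. -/
theorem exists_lintegral_tsum_flatness_le {G : Geometry n} {k : ℕ} (hk : k ≤ n) {C₀ : ℝ}
    (hC₀ : 0 < C₀) {μ : Measure (Pt n)} [IsLocallyFiniteMeasure μ] (hμ : IsADR G k C₀ μ)
    (hgood : GoodForLP G k μ) (D : DyadicGrid G k μ)
    (hα : ∀ lam : ℝ, 0 < lam → D.IsCarleson (D.badCubes C₀ k lam)) :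
    ∃ C : ℝ, 0 < C ∧ ∀ x ∈ μ.support, ∀ R : ℝ, 0 < R → ENNReal.ofReal (8 * R) < G.ediam μ.support →
      ∀ p : ℤ, (2 : ℝ) ^ p ≤ 2 * R →
      ∫⁻ y in G.ball x R, ∑' i : ℕ, flatness G k μ y ((2 : ℝ) ^ (p - i)) ∂μ
        ≤ ENNReal.ofReal (C * R ^ (k + 2)) := by
  obtain ⟨C₁, lam, m, hC₁, hlam, hm, hpt⟩ := exists_tsum_flatness_le G hk hC₀ hμ D
  obtain ⟨C₂, hC₂, hLP⟩ := exists_tsum_lintegral_lpConv_le hgood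
  obtain ⟨C₃, hbad⟩ := exists_tsum_badSet_le D (hα lam hlam)
  have hC₃ : (0 : ℝ) ≤ C₃ := C₃.2
  refine ⟨C₁ * (C₀ + (C₀ * (C₂ * 2 ^ (k + 2)) + C₃ * (C₀ * 2 ^ (k + 2)))), by positivity,
    fun x hx R hR hRd p hp => ?_⟩
  have hdiam : ∀ s : ℝ, s ≤ 8 * R → ENNReal.ofReal s < G.ediam μ.support := fun s hs =>
    (ENNReal.ofReal_le_ofReal hs).trans_lt hRd
  have hup : ∀ z ∈ μ.support, ∀ s : ℝ, 0 < s → s ≤ 8 * R →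
      μ (G.ball z s) ≤ ENNReal.ofReal (C₀ * s ^ (k + 2)) := fun z hz s hs hs8 =>
    (hμ z hz s hs (hdiam s hs8)).2
  have hsupp : ∀ᵐ y ∂μ, y ∈ μ.support := Measure.support_mem_ae
  have hzp : ∀ j : ℤ, j ≤ p → (2 : ℝ) ^ j ≤ 2 * R := fun j hj =>
    (zpow_le_zpow_right₀ (by norm_num) hj).trans hp
  set A : ℕ → Pt n → ℝ≥0∞ := fun i =>
    lpAverage G k μ ((2 : ℝ) ^ (p - 2 - i)) ((2 : ℝ) ^ (p - i - m)) with hA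
  set I : ℕ → Pt n → ℝ≥0∞ := fun i => (D.badSet C₀ lam (p - i)).indicator 1 with hI
  have hAm : ∀ i, Measurable (A i) := fun i => measurable_lpAverage G k μ _ _
  have hIm : ∀ i, Measurable (I i) := fun i =>
    measurable_one.indicator (D.measurableSet_badSet C₀ lam _)
  have hAsum : ∑' i, ∫⁻ y in G.ball x R, A i y ∂μ
      ≤ ENNReal.ofReal (C₀ * (C₂ * 2 ^ (k + 2)) * R ^ (k + 2)) := by
    have h1 : ∀ i : ℕ, ∫⁻ y in G.ball x R, A i y ∂μ ≤ ENNReal.ofReal C₀ *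
        ∫⁻ z in G.ball x (2 * R), ∑ c : Fin n,
          ENNReal.ofReal (lpConv G k (oddKernel c) μ ((2 : ℝ) ^ (p - 2 - i)) z ^ 2) ∂μ := by
      intro i
      have hs : (2 : ℝ) ^ (p - i - m) ≤ R / 2 := by
        have h2 : (2 : ℝ) ^ (p - i - m) ≤ (2 : ℝ) ^ (p - 2) :=
          zpow_le_zpow_right₀ (by norm_num) (by omega)
        have h3 : (2 : ℝ) ^ (p - 2) = 2 ^ p / 4 := by rw [zpow_sub₀ (by norm_num)]; norm_num
        linarith
      refine lintegral_ball_average_le G k (measurable_sum_lpConv G k μ _) (by positivity) hs hC₀ ?_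
      filter_upwards [hsupp] with z hz
      exact hup z hz _ (by positivity) (by linarith)
    calc _ ≤ ∑' i : ℕ, ENNReal.ofReal C₀ * ∫⁻ z in G.ball x (2 * R), ∑ c : Fin n,
          ENNReal.ofReal (lpConv G k (oddKernel c) μ ((2 : ℝ) ^ (p - 2 - i)) z ^ 2) ∂μ :=
          ENNReal.tsum_le_tsum h1
      _ = ENNReal.ofReal C₀ * ∑' i : ℕ, ∫⁻ z in G.ball x (2 * R), ∑ c : Fin n,
          ENNReal.ofReal (lpConv G k (oddKernel c) μ ((2 : ℝ) ^ (p - 2 - i)) z ^ 2) ∂μ :=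
          ENNReal.tsum_mul_left
      _ ≤ ENNReal.ofReal C₀ * ENNReal.ofReal (C₂ * (2 * R) ^ (k + 2)) := by
          gcongr
          exact hLP x hx (2 * R) (by positivity) (hdiam _ (by linarith)) (p - 2)
            (hzp _ (by omega))
      _ = _ := by
          rw [← ENNReal.ofReal_mul hC₀.le, mul_pow]
          congr 1
          ring
  have hIsum : ∑' i, ∫⁻ y in G.ball x R, I i y ∂μ
      ≤ ENNReal.ofReal (C₃ * (C₀ * 2 ^ (k + 2)) * R ^ (k + 2)) := by
    have h1 : ∀ i : ℕ, ∫⁻ y in G.ball x R, I i y ∂μ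
        = μ (D.badSet C₀ lam (p - i) ∩ G.ball x R) := by
      intro i
      simp only [hI]
      rw [lintegral_indicator_one (D.measurableSet_badSet C₀ lam _),
        Measure.restrict_apply (D.measurableSet_badSet C₀ lam _)]
    simp only [h1]
    refine (hbad x R p hp (hdiam _ (by linarith)).le).trans ?_
    calc (C₃ : ℝ≥0∞) * μ (G.ball x (2 * R))
        ≤ C₃ * ENNReal.ofReal (C₀ * (2 * R) ^ (k + 2)) := by
          gcongr
          exact hup x hx _ (by positivity) (by linarith)
      _ = _ := by
          rw [← ENNReal.ofReal_coe_nnreal, ← ENNReal.ofReal_mul hC₃, mul_pow]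
          congr 1
          ring
  have hAI : ∀ i, AEMeasurable (fun y => A i y + I i y) (μ.restrict (G.ball x R)) := fun i =>
    ((hAm i).add (hIm i)).aemeasurable
  calc _ ≤ ∫⁻ y in G.ball x R, ENNReal.ofReal C₁ * (1 + ∑' i, (A i y + I i y)) ∂μ := by
        -- The pointwise bound holds on the support, which has full measure. Its right side is
        -- measurable, so sum and integral may now be exchanged.
        refine lintegral_mono_ae (ae_restrict_of_ae ?_)
        filter_upwards [hsupp] with y hy
        exact hpt y hy p (hdiam _ (by linarith))
    _ = ENNReal.ofReal C₁ * (μ (G.ball x R)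
          + (∑' i, ∫⁻ y in G.ball x R, A i y ∂μ + ∑' i, ∫⁻ y in G.ball x R, I i y ∂μ)) := by
        rw [lintegral_const_mul' _ _ ENNReal.ofReal_ne_top, lintegral_add_left measurable_const,
          setLIntegral_one, lintegral_tsum hAI,
          ← ENNReal.tsum_add]
        congr 3
        funext i
        exact lintegral_add_left (hAm i) _
    _ ≤ ENNReal.ofReal C₁ * (ENNReal.ofReal (C₀ * R ^ (k + 2))
          + (ENNReal.ofReal (C₀ * (C₂ * 2 ^ (k + 2)) * R ^ (k + 2))
            + ENNReal.ofReal (C₃ * (C₀ * 2 ^ (k + 2)) * R ^ (k + 2)))) := by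
        gcongr
        exact hup x hx R hR (by linarith)
    _ = _ := by
        rw [← ENNReal.ofReal_add (by positivity) (by positivity),
          ← ENNReal.ofReal_add (by positivity) (by positivity), ← ENNReal.ofReal_mul hC₁.le]
        congr 1
        ring

/-! ### From dyadic to continuous scales -/

/-- The continuous square function of the `β`-numbers is dominated by the discrete one. -/
theorem lintegral_betaSq_le {G : Geometry n} {k : ℕ} {C₀ : ℝ} (hC₀ : 0 < C₀) {μ : Measure (Pt n)}
    (hμ : IsADR G k C₀ μ) {p : ℤ} (hp : ENNReal.ofReal ((2 : ℝ) ^ p) < G.ediam μ.support)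
    (S : Set (Pt n)) :
    ∫⁻ r in Ioo (0 : ℝ) (2 ^ p), (∫⁻ y in S, betaSq G k μ y r ∂μ) / ENNReal.ofReal r
      ≤ ENNReal.ofReal (C₀ * 2 ^ (k + 4)) *
        ∫⁻ y in S, ∑' i : ℕ, flatness G k μ y ((2 : ℝ) ^ (p - i)) ∂μ := by
  set c := ENNReal.ofReal (C₀ * 2 ^ (k + 4)) with hc
  have hcover : Ioo (0 : ℝ) (2 ^ p) ⊆
      ⋃ i : ℕ, Ioc ((2 : ℝ) ^ (p - (i : ℤ)) / 2) ((2 : ℝ) ^ (p - (i : ℤ))) := by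
    intro r hr
    obtain ⟨j, hj1, hj2⟩ := exists_mem_Ioc_zpow hr.1 (by norm_num : (1 : ℝ) < 2)
    have hjp : j < p := (zpow_lt_zpow_iff_right₀ (by norm_num : (1 : ℝ) < 2)).mp (hj1.trans hr.2)
    refine mem_iUnion.mpr ⟨(p - 1 - j).toNat, ?_⟩
    have e : p - ((p - 1 - j).toNat : ℤ) = j + 1 := by
      rw [Int.toNat_of_nonneg (by omega)]; ring
    rw [e]
    refine ⟨?_, hj2⟩
    rw [zpow_add₀ (by norm_num), zpow_one, mul_div_assoc]
    simpa using hj1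
  have hpiece : ∀ i : ℕ, ∫⁻ r in Ioc ((2 : ℝ) ^ (p - (i : ℤ)) / 2) ((2 : ℝ) ^ (p - (i : ℤ))),
      (∫⁻ y in S, betaSq G k μ y r ∂μ) / ENNReal.ofReal r
      ≤ c * ∫⁻ y in S, flatness G k μ y ((2 : ℝ) ^ (p - (i : ℤ))) ∂μ := by
    intro i
    set s : ℝ := (2 : ℝ) ^ (p - (i : ℤ)) with hs
    have hs0 : 0 < s := by positivity
    have hsp : s ≤ 2 ^ p := zpow_le_zpow_right₀ (by norm_num) (by omega)
    -- The majorant is constant in `r`, so no measurability in `r` is needed; the interval length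
    -- `s/2` cancels its denominator.
    have h1 : ∀ r ∈ Ioc (s / 2) s, (∫⁻ y in S, betaSq G k μ y r ∂μ) / ENNReal.ofReal r
        ≤ (c * ∫⁻ y in S, flatness G k μ y s ∂μ) / ENNReal.ofReal (s / 2) := by
      intro r hr
      have hr0 : 0 < r := by linarith [hr.1]
      refine ENNReal.div_le_div ?_ (ENNReal.ofReal_le_ofReal hr.1.le)
      rw [← lintegral_const_mul' _ _ ENNReal.ofReal_ne_top]
      refine lintegral_mono_ae (ae_restrict_of_ae ?_)
      filter_upwards [Measure.support_mem_ae (μ := μ)] with y hy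
      have hrd : ENNReal.ofReal r < G.ediam μ.support :=
        (ENNReal.ofReal_le_ofReal (hr.2.trans hsp)).trans_lt hp
      refine (betaSq_le_mul_flatness G hr0 hC₀ (hμ y hy r hr0 hrd).1).trans ?_
      rw [ENNReal.ofReal_mul hC₀.le, mul_assoc]
      gcongr
      exact flatness_le_mul G k μ y hr0 hr.2 (by linarith [hr.1])
    refine (setLIntegral_mono' measurableSet_Ioc h1).trans (le_of_eq ?_)
    rw [setLIntegral_const, Real.volume_Ioc, show s - s / 2 = s / 2 by ring]
    exact ENNReal.div_mul_cancel (ENNReal.ofReal_pos.mpr (by positivity)).ne' ENNReal.ofReal_ne_top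
  calc _ ≤ ∫⁻ r in ⋃ i : ℕ, Ioc ((2 : ℝ) ^ (p - (i : ℤ)) / 2) ((2 : ℝ) ^ (p - (i : ℤ))),
        (∫⁻ y in S, betaSq G k μ y r ∂μ) / ENNReal.ofReal r := lintegral_mono_set hcover
    _ ≤ ∑' i : ℕ, ∫⁻ r in Ioc ((2 : ℝ) ^ (p - (i : ℤ)) / 2) ((2 : ℝ) ^ (p - (i : ℤ))),
        (∫⁻ y in S, betaSq G k μ y r ∂μ) / ENNReal.ofReal r := lintegral_iUnion_le _ _
    _ ≤ ∑' i : ℕ, c * ∫⁻ y in S, flatness G k μ y ((2 : ℝ) ^ (p - (i : ℤ))) ∂μ :=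
        ENNReal.tsum_le_tsum hpiece
    _ = c * ∑' i : ℕ, ∫⁻ y in S, flatness G k μ y ((2 : ℝ) ^ (p - (i : ℤ))) ∂μ :=
        ENNReal.tsum_mul_left
    _ ≤ _ := by
        gcongr
        exact tsum_lintegral_le (μ.restrict S) _

/-! ### Bounded support and conclusion -/

theorem d_le_ediam (G : Geometry n) {S : Set (Pt n)} {x y : Pt n} (hx : x ∈ S) (hy : y ∈ S) :
    ENNReal.ofReal (G.d x y) ≤ G.ediam S :=
  le_iSup₂_of_le x hx (le_iSup₂_of_le y hy le_rfl)

theorem exists_zpow_between {R : ℝ} (hR : 0 < R) :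
    ∃ p : ℤ, R < (2 : ℝ) ^ p ∧ (2 : ℝ) ^ p ≤ 2 * R := by
  obtain ⟨j, hj1, hj2⟩ := exists_mem_Ico_zpow hR (by norm_num : (1 : ℝ) < 2)
  refine ⟨j + 1, hj2, ?_⟩
  rw [zpow_add₀ (by norm_num), zpow_one]
  linarith

theorem isCompact_support {G : Geometry n} {μ : Measure (Pt n)} (h : G.ediam μ.support ≠ ⊤) :
    IsCompact μ.support := by
  rcases μ.support.eq_empty_or_nonempty with he | ⟨x, hx⟩
  · rw [he]; exact isCompact_empty
  refine Metric.isCompact_of_isClosed_isBounded Measure.isClosed_support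
    ((G.isBounded_ball x ((G.ediam μ.support).toReal + 1)).subset fun y hy => ?_)
  have h1 := (ENNReal.ofReal_le_iff_le_toReal h).mp (d_le_ediam G hx hy)
  rw [G.mem_ball]
  linarith

/-- The square function estimate at the large scales of a measure with bounded support. -/
theorem exists_lintegral_betaSq_large_le {G : Geometry n} {k : ℕ} (hk : k ≤ n) {C₀ : ℝ}
    (hC₀ : 0 < C₀) {μ : Measure (Pt n)} [IsLocallyFiniteMeasure μ] (hμ : IsADR G k C₀ μ)
    (hgood : GoodForLP G k μ) (D : DyadicGrid G k μ)
    (hα : ∀ lam : ℝ, 0 < lam → D.IsCarleson (D.badCubes C₀ k lam)) {R₀ : ℝ} (hR₀ : 0 < R₀)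
    (hR₀d : ENNReal.ofReal (8 * R₀) < G.ediam μ.support) (hfin : G.ediam μ.support ≠ ⊤) :
    ∃ C : ℝ, 0 < C ∧ ∀ (x : Pt n) (R : ℝ), R₀ ≤ R →
      ∫⁻ r in Ioo (0 : ℝ) R, (∫⁻ y in G.ball x R, betaSq G k μ y r ∂μ) / ENNReal.ofReal r
        ≤ ENNReal.ofReal (C * R ^ (k + 2)) := by
  obtain ⟨C₁, hC₁, hflat⟩ := exists_lintegral_tsum_flatness_le hk hC₀ hμ hgood D hα
  obtain ⟨p, hp1, hp2⟩ := exists_zpow_between hR₀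
  have hcomp := isCompact_support hfin
  -- Finitely many balls of radius `R₀` cover the support and each obeys the small-radius estimate.
  -- The resulting constant `M` depends on their number, which is harmless for fixed `μ`.
  obtain ⟨t, ht, hcov⟩ := hcomp.elim_nhds_subcover (fun z => G.ball z R₀) fun z _ =>
    (G.isOpen_ball z R₀).mem_nhds (by rw [G.mem_ball, G.d_self]; exact hR₀)
  set U : Set (Pt n) := ⋃ z ∈ t, G.ball z R₀ with hU
  have hUae : ∀ᵐ y ∂μ, y ∈ U := by
    filter_upwards [Measure.support_mem_ae (μ := μ)] with y hy using hcov hy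
  have hUfin : μ univ < ⊤ := by
    have h1 : μ univ ≤ μ μ.support :=
      measure_mono_ae (by filter_upwards [Measure.support_mem_ae (μ := μ)] with y hy _ using hy)
    exact h1.trans_lt hcomp.measure_lt_top
  set M : ℝ≥0∞ := ENNReal.ofReal (C₀ * 2 ^ (k + 4)) *
    ∫⁻ y in U, ∑' i : ℕ, flatness G k μ y ((2 : ℝ) ^ (p - i)) ∂μ with hM
  have hMfin : M ≠ ⊤ := by
    refine ENNReal.mul_ne_top ENNReal.ofReal_ne_top ?_
    have h1 : ∫⁻ y in U, ∑' i : ℕ, flatness G k μ y ((2 : ℝ) ^ (p - i)) ∂μ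
        ≤ ∑' z : t, ∫⁻ y in G.ball z R₀, ∑' i : ℕ, flatness G k μ y ((2 : ℝ) ^ (p - i)) ∂μ := by
      have e : U = ⋃ z : t, G.ball (z : Pt n) R₀ := by rw [hU, iUnion_subtype]
      rw [e]
      exact lintegral_iUnion_le _ _
    refine ne_top_of_le_ne_top ?_ h1
    rw [tsum_fintype]
    refine ENNReal.sum_ne_top.mpr fun z _ => ?_
    exact ne_top_of_le_ne_top ENNReal.ofReal_ne_top (hflat z (ht z z.2) R₀ hR₀ hR₀d p hp2)
  set N : ℝ≥0∞ := μ univ / ENNReal.ofReal R₀ with hN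
  have hNfin : N ≠ ⊤ := ENNReal.div_ne_top hUfin.ne (ENNReal.ofReal_pos.mpr hR₀).ne'
  -- Scales below `2 ^ p` contribute `M` and larger ones at most `N * R`; since `R ≥ R₀`, both are
  -- dominated by multiples of `R ^ (k + 2)`.
  refine ⟨M.toReal / R₀ ^ (k + 2) + N.toReal / R₀ ^ (k + 1) + 1, by positivity,
    fun x R hR => ?_⟩
  have hR0 : 0 < R := hR₀.trans_le hR
  have hsub : Ioo (0 : ℝ) R ⊆ Ioo (0 : ℝ) (2 ^ p) ∪ Ico (2 ^ p) R := by
    intro r hr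
    rcases lt_or_ge r (2 ^ p) with h | h
    · exact Or.inl ⟨hr.1, h⟩
    · exact Or.inr ⟨h, hr.2⟩
  have hsmall : ∫⁻ r in Ioo (0 : ℝ) (2 ^ p),
      (∫⁻ y in G.ball x R, betaSq G k μ y r ∂μ) / ENNReal.ofReal r ≤ M := by
    refine le_trans (lintegral_mono fun r => ?_) (lintegral_betaSq_le hC₀ hμ
      ((ENNReal.ofReal_le_ofReal (by linarith : (2 : ℝ) ^ p ≤ 8 * R₀)).trans_lt hR₀d) U)
    gcongr ?_ / _
    refine lintegral_mono_set' ?_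
    filter_upwards [hUae] with y hy _ using hy
  have hlarge : ∫⁻ r in Ico ((2 : ℝ) ^ p) R,
      (∫⁻ y in G.ball x R, betaSq G k μ y r ∂μ) / ENNReal.ofReal r ≤ N * ENNReal.ofReal R := by
    calc _ ≤ ∫⁻ _r in Ico ((2 : ℝ) ^ p) R, N := by
          refine setLIntegral_mono' measurableSet_Ico fun r hr => ?_
          refine ENNReal.div_le_div ?_ (ENNReal.ofReal_le_ofReal (hp1.le.trans hr.1))
          refine (setLIntegral_le_lintegral _ _).trans ?_
          refine (lintegral_mono fun y => betaSq_le_one G hk μ y r).trans (le_of_eq ?_)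
          rw [lintegral_one]
      _ = N * ENNReal.ofReal (R - 2 ^ p) := by rw [setLIntegral_const, Real.volume_Ico]
      _ ≤ _ := by
          gcongr
          have : (0 : ℝ) < 2 ^ p := by positivity
          linarith
  calc _ ≤ ∫⁻ r in Ioo (0 : ℝ) (2 ^ p) ∪ Ico (2 ^ p) R,
        (∫⁻ y in G.ball x R, betaSq G k μ y r ∂μ) / ENNReal.ofReal r := lintegral_mono_set hsub
    _ ≤ M + N * ENNReal.ofReal R :=
        (lintegral_union_le _ _ _).trans (add_le_add hsmall hlarge)
    _ = ENNReal.ofReal (M.toReal + N.toReal * R) := by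
        rw [ENNReal.ofReal_add (by positivity) (by positivity), ENNReal.ofReal_mul (by positivity),
          ENNReal.ofReal_toReal hMfin, ENNReal.ofReal_toReal hNfin]
    _ ≤ _ := by
        refine ENNReal.ofReal_le_ofReal ?_
        have h1 : M.toReal ≤ M.toReal / R₀ ^ (k + 2) * R ^ (k + 2) := by
          rw [div_mul_eq_mul_div, le_div_iff₀ (by positivity)]
          gcongr
        have h2 : N.toReal * R ≤ N.toReal / R₀ ^ (k + 1) * R ^ (k + 2) := by
          rw [div_mul_eq_mul_div, le_div_iff₀ (by positivity), pow_succ R (k + 1), mul_assoc,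
            mul_comm R]
          gcongr
        have h3 : 0 < R ^ (k + 2) := by positivity
        linarith

/-- Good measures which are well approximated by vertical planes, off a Carleson family of cubes,
are uniformly rectifiable. -/
theorem isUniformlyRectifiable_of_isCarleson {G : Geometry n} {k : ℕ} (hkn : k < n) {C₀ : ℝ}
    (hC₀ : 0 < C₀) {μ : Measure (Pt n)} [IsLocallyFiniteMeasure μ] (hμ : IsADR G k C₀ μ)
    (hgood : GoodForLP G k μ) (D : DyadicGrid G k μ)
    (hα : ∀ lam : ℝ, 0 < lam → D.IsCarleson (D.badCubes C₀ k lam)) :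
    IsUniformlyRectifiable G k μ := by
  obtain ⟨C₁, hC₁, hflat⟩ := exists_lintegral_tsum_flatness_le hkn.le hC₀ hμ hgood D hα
  set C₂ : ℝ := C₀ * 2 ^ (k + 4) * C₁ with hC₂
  have hC₂0 : 0 < C₂ := by positivity
  have hsmall : ∀ x ∈ μ.support, ∀ R : ℝ, 0 < R →
      ENNReal.ofReal (8 * R) < G.ediam μ.support →
      ∫⁻ r in Ioo (0 : ℝ) R, (∫⁻ y in G.ball x R, betaSq G k μ y r ∂μ) / ENNReal.ofReal r
        ≤ ENNReal.ofReal (C₂ * R ^ (k + 2)) := by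
    intro x hx R hR hRd
    obtain ⟨p, hp1, hp2⟩ := exists_zpow_between hR
    have hpd : ENNReal.ofReal ((2 : ℝ) ^ p) < G.ediam μ.support :=
      (ENNReal.ofReal_le_ofReal (by linarith)).trans_lt hRd
    calc _ ≤ ∫⁻ r in Ioo (0 : ℝ) (2 ^ p),
          (∫⁻ y in G.ball x R, betaSq G k μ y r ∂μ) / ENNReal.ofReal r :=
          lintegral_mono_set (Ioo_subset_Ioo_right hp1.le)
      _ ≤ _ := lintegral_betaSq_le hC₀ hμ hpd _
      _ ≤ ENNReal.ofReal (C₀ * 2 ^ (k + 4)) * ENNReal.ofReal (C₁ * R ^ (k + 2)) := by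
          gcongr
          exact hflat x hx R hR hRd p hp2
      _ = _ := by
          rw [← ENNReal.ofReal_mul (by positivity), hC₂, mul_assoc (C₀ * 2 ^ (k + 4))]
  -- At diameter zero regularity says nothing, but every `β`-number vanishes. At infinite diameter
  -- every radius is small.
  by_cases h0 : G.ediam μ.support = 0
  · refine ⟨1, one_pos, fun x hx R hR => ?_⟩
    have hz : ∀ r, ∫⁻ y in G.ball x R, betaSq G k μ y r ∂μ = 0 := by
      intro r
      refine lintegral_eq_zero_of_ae_eq_zero (ae_restrict_of_ae ?_)
      filter_upwards [Measure.support_mem_ae (μ := μ)] with y hy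
      refine betaSq_eq_zero G hkn.le r ?_
      filter_upwards [Measure.support_mem_ae (μ := μ)] with z hz
      have h1 := d_le_ediam G hy hz
      rw [h0, nonpos_iff_eq_zero, ENNReal.ofReal_eq_zero] at h1
      exact le_antisymm h1 (G.d_nonneg y z)
    simp [hz]
  by_cases htop : G.ediam μ.support = ⊤
  · exact ⟨C₂, hC₂0, fun x hx R hR =>
      hsmall x hx R hR (by rw [htop]; exact ENNReal.ofReal_lt_top)⟩
  set d := (G.ediam μ.support).toReal with hd
  have hd0 : 0 < d := ENNReal.toReal_pos h0 htop
  have hdd : ENNReal.ofReal d = G.ediam μ.support := ENNReal.ofReal_toReal htop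
  have hlt : ∀ s : ℝ, s < d → ENNReal.ofReal s < G.ediam μ.support := fun s hs => by
    rw [← hdd]; exact (ENNReal.ofReal_lt_ofReal_iff hd0).mpr hs
  -- Splitting at `d / 16` keeps `8R < d` for small radii and `8R₀ = d / 2 < d` at the threshold.
  obtain ⟨C₃, hC₃, hlarge⟩ := exists_lintegral_betaSq_large_le hkn.le hC₀ hμ hgood D hα
    (R₀ := d / 16) (by positivity) (hlt _ (by linarith)) htop
  refine ⟨max C₂ C₃, by positivity, fun x hx R hR => ?_⟩
  rcases lt_or_ge R (d / 16) with h | h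
  · refine (hsmall x hx R hR (hlt _ (by linarith))).trans (ENNReal.ofReal_le_ofReal ?_)
    gcongr
    exact le_max_left _ _
  · refine (hlarge x R h).trans (ENNReal.ofReal_le_ofReal ?_)
    gcongr
    exact le_max_right _ _

end HorizGeom

end

theorem theorem4p2 {n : ℕ} (G : HorizGeom.Geometry n) (k : ℕ) (hk : 1 ≤ k) (hkn : k < n)
    (C₀ : ℝ) (hC₀ : 0 < C₀)
    (μ : Measure (HorizGeom.Pt n)) [IsLocallyFiniteMeasure μ]
    (hμ : HorizGeom.IsADR G k C₀ μ)
    (hgood : HorizGeom.GoodForLP G k μ)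
    (D : HorizGeom.DyadicGrid G k μ)
    (hα : ∀ lam : ℝ, 0 < lam → D.IsCarleson (D.badCubes C₀ k lam)) :
    HorizGeom.IsUniformlyRectifiable G k μ :=
  HorizGeom.isUniformlyRectifiable_of_isCarleson hkn hC₀ hμ hgood D hα
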